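/- Let $H\neq\{0\}$ be a real or complex Hilbert space and let $A$ be a self-adjoint operator on $H$ which is strictly positive ($\langle Ax,x\rangle>0$ for all nonzero $x\in D(A)$) and whose domain, with the graph norm, is compactly embedded in $H$ (equivalently, $A$ has compact inverse). Let $\varepsilon\ge 0$ and consider, for $b>0$, the system $$\ddot u+Au+\dot u=b\dot v,\qquad \ddot v+Av-\varepsilon\dot v=-b\dot u .$$ Then $A$ has a positive self-adjoint square root $A^{1/2}$ and a smallest eigenvalue $\lambda_1>0$, and for every $b>0$ the first-order operator $$(u,x,v,y)\mapsto(x,\,-Au-x+by,\,y,\,-Av+\varepsilon y-bx)$$ with domain $D(A)\times D(A^{1/2})\times D(A)\times D(A^{1/2})$ generates a strongly continuous semigroup $S_b(t)$ on $\mathcal H=D(A^{1/2})\times H\times D(A^{1/2})\times H$, with norm $\|(u,x,v,y)\|^2=\|A^{1/2}u\|^2+\|x\|^2+\|A^{1/2}v\|^2+\|y\|^2$. Let $\omega_\star(b)=\inf\{\omega\in\mathbb R:\exists M\ge1\ \forall t\ge0\ \|S_b(t)\|\le Me^{\omega t}\}$ be its growth bound. Say that $S_b$ blows up exponentially if $\omega_\star(b)>0$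 and there are $z\in\mathcal H$ and $c,\alpha>0$ with $\|S_b(t)z\|\ge ce^{\alpha t}$ for all $t\ge0$; that $S_b$ is bounded without decay if $\sup_{t\ge0}\|S_b(t)\|<\infty$ but $\|S_b(t)z\|\not\to0$ as $t\to\infty$ for some $z\in\mathcal H$; and write $\|S_b(t)\|\asymp f(t)$ if $c f(t)\le\|S_b(t)\|\le C f(t)$ for all $t\ge 0$, with some constants $c,C>0$. Then: 1. If $\varepsilon>1$, then $S_b$ blows up exponentially for every $b>0$. 2. If $\varepsilon=1$, then $S_b$ blows up exponentially for $0<b<1$; $\|S_1(t)\|\asymp 1+t$; and $S_b$ is bounded without decay for $b>1$. 3. If $\varepsilon<1$, then for $b>0$: (a) $S_b$ blows up exponentially if $b<\sqrt\varepsilon$; it is bounded without decay if $b=\sqrt\varepsilon$; and if $b>\sqrt\varepsilon$ there are $C,\alpha>0$ with $\|S_b(t)\|\le Ce^{-\alpha t}$ for all $t\ge0$. (b) The best exponential decay rate is attained exactly at $b=\frac{1+\varepsilon}2$: $\omega_\star\big(\frac{1+\varepsilon}2\big)<\omega_\star(b)$ for every $b>0$ with $b\ne\frac{1+\varepsilon}2$.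 Moreover $\omega_\star(b)\to0$ as $b\to\infty$. (c) If $\lambda_1\ge\frac{(1-\varepsilon)^2}{16}$ and $b=\frac{1+\varepsilon}2$, then $\omega_\star(b)=-\frac{1-\varepsilon}4$, and the decay rate $\frac{1-\varepsilon}4$ holds up to a polynomial correction: $\|S_b(t)\|\asymp(1+t)\,e^{-\frac{1-\varepsilon}4t}$ if $\lambda_1>\frac{(1-\varepsilon)^2}{16}$, and $\|S_b(t)\|\asymp(1+t)^3\,e^{-\frac{1-\varepsilon}4t}$ if $\lambda_1=\frac{(1-\varepsilon)^2}{16}$. -/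

import Mathlib

open Filter Topology
open scoped NNReal InnerProductSpace

noncomputable section

namespace CoupledSystem

section Operators

variable {𝕜 H : Type*} [RCLike 𝕜] [NormedAddCommGroup H] [InnerProductSpace 𝕜 H]

/-- Strict positivity of an unbounded operator: `⟨x, A x⟩ > 0` for every nonzero `x` in the
domain. -/
def IsStrictlyPos (A : H →ₗ.[𝕜] H) : Prop :=
  ∀ x : A.domain, x ≠ 0 → 0 < RCLike.re ⟪(x : H), A x⟫_𝕜

/-- The domain of `A`, with the graph norm, is compactly embedded into `H`: the unit ball of the
(maximum form of the) graph norm is relatively compact in `H`. -/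
def HasCompactDomain (A : H →ₗ.[𝕜] H) : Prop :=
  IsCompact (closure {x : H | ∃ h : x ∈ A.domain, ‖x‖ ≤ 1 ∧ ‖A ⟨x, h⟩‖ ≤ 1})

/-- The eigenvalues of `A` in `ℝ` (a self-adjoint operator has no others). -/
def eigenvalues (A : H →ₗ.[𝕜] H) : Set ℝ :=
  {μ | ∃ x : A.domain, x ≠ 0 ∧ A x = (μ : 𝕜) • (x : H)}

/-- The first eigenvalue of `A`. -/
def firstEigenvalue (A : H →ₗ.[𝕜] H) : ℝ := sInf (eigenvalues A)

variable [CompleteSpace H]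

/-- `B` is a positive self-adjoint square root of `A`: `B` is self-adjoint, `⟨x, B x⟩ ≥ 0` on its
domain, and `A = B ∘ B`, including equality of domains, i.e. `(x, z)` is in the graph of `A` iff
`y = B x` and `z = B y` for some `y`. -/
structure IsPosSqrt (A B : H →ₗ.[𝕜] H) : Prop where
  selfAdjoint : IsSelfAdjoint B
  nonneg : ∀ x : B.domain, 0 ≤ RCLike.re ⟪(x : H), B x⟫_𝕜
  sq : ∀ x z : H, (x, z) ∈ A.graph ↔ ∃ y : H, (x, y) ∈ B.graph ∧ (y, z) ∈ B.graph

open Classical in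
/-- The operator `A ^ (1/2)`. -/
def opSqrt (A : H →ₗ.[𝕜] H) : H →ₗ.[𝕜] H :=
  if h : ∃ B : H →ₗ.[𝕜] H, IsPosSqrt A B then h.choose else ⊥

/-- The space `D(A ^ (1/2))`, to be normed by `‖u‖ = ‖A ^ (1/2) u‖`. -/
def SqrtDomain (A : H →ₗ.[𝕜] H) : Type _ := (opSqrt A).domain

instance (A : H →ₗ.[𝕜] H) : AddCommGroup (SqrtDomain A) :=
  inferInstanceAs (AddCommGroup (opSqrt A).domain)

instance (A : H →ₗ.[𝕜] H) : Module 𝕜 (SqrtDomain A) :=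
  inferInstanceAs (Module 𝕜 (opSqrt A).domain)

/-- The inclusion of `D(A ^ (1/2))` into `H`. -/
def SqrtDomain.incl (A : H →ₗ.[𝕜] H) : SqrtDomain A →ₗ[𝕜] H := (opSqrt A).domain.subtype

/-- The map `u ↦ A ^ (1/2) u` on `D(A ^ (1/2))`. -/
def SqrtDomain.apply (A : H →ₗ.[𝕜] H) : SqrtDomain A →ₗ[𝕜] H := (opSqrt A).toFun

/-- An element of `H` lying in `D(A ^ (1/2))`, as an element of that space. -/
def SqrtDomain.mk (A : H →ₗ.[𝕜] H) (x : H) (hx : x ∈ (opSqrt A).domain) : SqrtDomain A := ⟨x, hx⟩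

/-- The norm `‖u‖ = ‖A ^ (1/2) u‖`. It is a genuine norm as soon as `A ^ (1/2)` is injective, which
is the case for strictly positive `A`; no property of `A` is needed to write it down. -/
instance (A : H →ₗ.[𝕜] H) : SeminormedAddCommGroup (SqrtDomain A) :=
  SeminormedAddCommGroup.induced (SqrtDomain A) H (SqrtDomain.apply A)

instance (A : H →ₗ.[𝕜] H) : NormedSpace 𝕜 (SqrtDomain A) :=
  NormedSpace.induced 𝕜 (SqrtDomain A) H (SqrtDomain.apply A)

/-- The energy space `D(A ^ (1/2)) × H × D(A ^ (1/2)) × H` with its Hilbertian product norm. Its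
elements are `z = ((u, x), (v, y))`, where `x`, `y` stand for the velocities of `u`, `v`. -/
abbrev EnergySpace (A : H →ₗ.[𝕜] H) : Type _ :=
  WithLp 2 (WithLp 2 (SqrtDomain A × H) × WithLp 2 (SqrtDomain A × H))

/-- The component `u ∈ D(A ^ (1/2))` of `z`, as a vector of `H`. -/
def compU (A : H →ₗ.[𝕜] H) : EnergySpace A →ₗ[𝕜] H where
  toFun z := SqrtDomain.incl A z.fst.fst
  map_add' z w := map_add (SqrtDomain.incl A) z.fst.fst w.fst.fst
  map_smul' c z := map_smul (SqrtDomain.incl A) c z.fst.fst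

/-- The component `x ∈ H` of `z`. -/
def compX (A : H →ₗ.[𝕜] H) : EnergySpace A →ₗ[𝕜] H where
  toFun z := z.fst.snd
  map_add' _ _ := rfl
  map_smul' _ _ := rfl

/-- The component `v ∈ D(A ^ (1/2))` of `z`, as a vector of `H`. -/
def compV (A : H →ₗ.[𝕜] H) : EnergySpace A →ₗ[𝕜] H where
  toFun z := SqrtDomain.incl A z.snd.fst
  map_add' z w := map_add (SqrtDomain.incl A) z.snd.fst w.snd.fst
  map_smul' c z := map_smul (SqrtDomain.incl A) c z.snd.fst

/-- The component `y ∈ H` of `z`. -/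
def compY (A : H →ₗ.[𝕜] H) : EnergySpace A →ₗ[𝕜] H where
  toFun z := z.snd.snd
  map_add' _ _ := rfl
  map_smul' _ _ := rfl

/-- The vector of the energy space with given components. -/
def mkVec (A : H →ₗ.[𝕜] H) (u : SqrtDomain A) (x : H) (v : SqrtDomain A) (y : H) :
    EnergySpace A :=
  WithLp.toLp 2 (WithLp.toLp 2 (u, x), WithLp.toLp 2 (v, y))

/-- The space `D(A) × D(A ^ (1/2)) × D(A) × D(A ^ (1/2))`. -/
def systemDomain (A : H →ₗ.[𝕜] H) : Submodule 𝕜 (EnergySpace A) where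
  carrier := {z | compU A z ∈ A.domain ∧ compX A z ∈ (opSqrt A).domain ∧
    compV A z ∈ A.domain ∧ compY A z ∈ (opSqrt A).domain}
  add_mem' := by
    rintro z w ⟨h1, h2, h3, h4⟩ ⟨k1, k2, k3, k4⟩
    exact ⟨by rw [map_add]; exact add_mem h1 k1, by rw [map_add]; exact add_mem h2 k2,
      by rw [map_add]; exact add_mem h3 k3, by rw [map_add]; exact add_mem h4 k4⟩
  zero_mem' := by
    refine ⟨?_, ?_, ?_, ?_⟩ <;> rw [map_zero] <;> exact Submodule.zero_mem _
  smul_mem' := by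
    rintro c z ⟨h1, h2, h3, h4⟩
    exact ⟨by rw [map_smul]; exact Submodule.smul_mem _ c h1,
      by rw [map_smul]; exact Submodule.smul_mem _ c h2,
      by rw [map_smul]; exact Submodule.smul_mem _ c h3,
      by rw [map_smul]; exact Submodule.smul_mem _ c h4⟩

/-- The operator of the first-order form of
`u'' + A u + u' = b v'`, `v'' + A v - ε v' = - b u'`, namely
`(u, x, v, y) ↦ (x, - A u - x + b y, y, - A v + ε y - b x)`, with domain
`D(A) × D(A ^ (1/2)) × D(A) × D(A ^ (1/2))`. -/
def systemOp (A : H →ₗ.[𝕜] H) (ε b : ℝ) : EnergySpace A →ₗ.[𝕜] EnergySpace A where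
  domain := systemDomain A
  toFun :=
    { toFun := fun z => mkVec A
        (SqrtDomain.mk A (compX A z) z.2.2.1)
        (- A ⟨compU A z, z.2.1⟩ - compX A z + (b : 𝕜) • compY A z)
        (SqrtDomain.mk A (compY A z) z.2.2.2.2)
        (- A ⟨compV A z, z.2.2.2.1⟩ + (ε : 𝕜) • compY A z - (b : 𝕜) • compX A z)
      map_add' := by
        intro z w
        have e1 : A ⟨compU A ((z + w : systemDomain A) : EnergySpace A), (z + w).2.1⟩
            = A ⟨compU A z, z.2.1⟩ + A ⟨compU A w, w.2.1⟩ := by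
          rw [← LinearPMap.map_add]; rfl
        have e2 : A ⟨compV A ((z + w : systemDomain A) : EnergySpace A), (z + w).2.2.2.1⟩
            = A ⟨compV A z, z.2.2.2.1⟩ + A ⟨compV A w, w.2.2.2.1⟩ := by
          rw [← LinearPMap.map_add]; rfl
        have add_mk : ∀ (u u' v v' : SqrtDomain A) (x x' y y' : H),
            mkVec A u x v y + mkVec A u' x' v' y'
              = mkVec A (u + u') (x + x') (v + v') (y + y') := fun _ _ _ _ _ _ _ _ => rfl
        rw [add_mk, e1, e2]
        congr 1
        · rw [Submodule.coe_add, map_add, map_add, smul_add]; abel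
        · rw [Submodule.coe_add, map_add, map_add, smul_add, smul_add]; abel
      map_smul' := by
        intro c z
        have e1 : A ⟨compU A ((c • z : systemDomain A) : EnergySpace A), (c • z).2.1⟩
            = c • A ⟨compU A z, z.2.1⟩ := by
          rw [← LinearPMap.map_smul]; rfl
        have e2 : A ⟨compV A ((c • z : systemDomain A) : EnergySpace A), (c • z).2.2.2.1⟩
            = c • A ⟨compV A z, z.2.2.2.1⟩ := by
          rw [← LinearPMap.map_smul]; rfl
        have smul_mk : ∀ (u v : SqrtDomain A) (x y : H),
            c • mkVec A u x v y = mkVec A (c • u) (c • x) (c • v) (c • y) :=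
          fun _ _ _ _ => rfl
        rw [RingHom.id_apply, smul_mk, e1, e2]
        congr 1
        · rw [Submodule.coe_smul, map_smul, map_smul, smul_add, smul_sub, smul_neg,
            smul_comm c (b : 𝕜)]
        · rw [Submodule.coe_smul, map_smul, map_smul, smul_sub, smul_add, smul_neg,
            smul_comm c (b : 𝕜), smul_comm c (ε : 𝕜)] }

end Operators

section Semigroups

variable {𝕜 E : Type*} [RCLike 𝕜] [SeminormedAddCommGroup E] [NormedSpace 𝕜 E]

/-- `S` is a strongly continuous semigroup with infinitesimal generator `G`: `z` is in the domain
of `G` with `G z = w` if and only if `(S(t) z - z) / t → w` as `t → 0+`. -/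
structure IsSemigroupGeneratedBy (S : ℝ≥0 → E →L[𝕜] E) (G : E →ₗ.[𝕜] E) : Prop where
  zero : S 0 = ContinuousLinearMap.id 𝕜 E
  add : ∀ s t : ℝ≥0, S (s + t) = (S s).comp (S t)
  continuous : ∀ z : E, Continuous fun t : ℝ≥0 => S t z
  generator : ∀ z w : E, (z, w) ∈ G.graph ↔
    Tendsto (fun t : ℝ≥0 => (((t : ℝ)⁻¹ : ℝ) : 𝕜) • (S t z - z)) (𝓝[>] 0) (𝓝 w)

open Classical in
/-- The strongly continuous semigroup generated by `G`. -/
def semigroup (G : E →ₗ.[𝕜] E) : ℝ≥0 → E →L[𝕜] E :=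
  if h : ∃ S : ℝ≥0 → E →L[𝕜] E, IsSemigroupGeneratedBy S G then h.choose else 0

/-- The growth bound of a semigroup. -/
def growthBound (S : ℝ≥0 → E →L[𝕜] E) : ℝ :=
  sInf {ω : ℝ | ∃ M : ℝ, 1 ≤ M ∧ ∀ t : ℝ≥0, ‖S t‖ ≤ M * Real.exp (ω * t)}

/-- The norm of `S` blows up exponentially, and so does some trajectory. -/
def BlowsUpExponentially (S : ℝ≥0 → E →L[𝕜] E) : Prop :=
  0 < growthBound S ∧
    ∃ z : E, ∃ c α : ℝ, 0 < c ∧ 0 < α ∧ ∀ t : ℝ≥0, c * Real.exp (α * t) ≤ ‖S t z‖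

/-- `S` is bounded, but some trajectory does not decay to zero. -/
def BoundedNotDecaying (S : ℝ≥0 → E →L[𝕜] E) : Prop :=
  (∃ C : ℝ, ∀ t : ℝ≥0, ‖S t‖ ≤ C) ∧ ∃ z : E, ¬ Tendsto (fun t : ℝ≥0 => ‖S t z‖) atTop (𝓝 0)

/-- `S` decays exponentially in norm. -/
def DecaysExponentially (S : ℝ≥0 → E →L[𝕜] E) : Prop :=
  ∃ C α : ℝ, 0 < α ∧ ∀ t : ℝ≥0, ‖S t‖ ≤ C * Real.exp (-(α * t))

/-- The norm of `S(t)` is, up to multiplicative constants, exactly `(1 + t) ^ d * exp (ω t)`. -/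
def HasExactRate (S : ℝ≥0 → E →L[𝕜] E) (d : ℕ) (ω : ℝ) : Prop :=
  ∃ c C : ℝ, 0 < c ∧ ∀ t : ℝ≥0, c * ((1 + (t : ℝ)) ^ d * Real.exp (ω * t)) ≤ ‖S t‖ ∧
    ‖S t‖ ≤ C * ((1 + (t : ℝ)) ^ d * Real.exp (ω * t))

end Semigroups

/-- The semigroup of the coupled system on the energy space. -/
def S {𝕜 H : Type*} [RCLike 𝕜] [NormedAddCommGroup H] [InnerProductSpace 𝕜 H] [CompleteSpace H]
    (A : H →ₗ.[𝕜] H) (ε b : ℝ) : ℝ≥0 → EnergySpace A →L[𝕜] EnergySpace A :=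
  semigroup (systemOp A ε b)

end CoupledSystem

end

open CoupledSystem

/-! Strict positivity and the compact embedding give an orthonormal eigenbasis of `A` with
eigenvalues `μ ^ 2`, `μ ≥ μ₁ = √λ₁ > 0`. In the coefficients of `A ^ (1/2) u`, `x`, `A ^ (1/2) v`,
`y` the energy space is an `ℓ²` sum of copies of `𝕜⁴`, and the generator acts on each copy by a
matrix (`exists_energyIso`, `mem_graph_systemOp_iff_coeff`). Everything thus reduces to the planar
equation `X'' + μ² X = N X'` with `N = (-1, b; -b, ε)`. Its exponents are the roots of `s² - w s +
μ² = 0`, where `w` is an eigenvalue of `N`, i.e. `w² + (1 - ε) w + b² - ε = 0`.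

Lower bounds come from explicit solutions at the lowest frequency `μ₁`. Upper bounds must be uniform
in `μ ≥ μ₁`, so they come from energy estimates rather than from diagonalising each mode. If `P` is
positive definite and `⟨P X, N X⟩ ≤ 0`, then `P(X') + μ² P(X)` does not grow
(`exists_energyBound_const`); if the sign is strict, a small multiple of `⟨P X, X'⟩` added to it
yields uniform decay (`exists_energyBound_decay`).

At `b = (1 + ε) / 2` the two `w` coalesce in a Jordan block: `v - u` solves a scalar damped
oscillator, which drives `u` through the same oscillator. Multiplication by `exp (r t)` brings the
rate to zero, and integrating the two equations in turn produces a factor `1 + t` when the remaining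
stiffness is positive, and `(1 + t) ^ 3` when it may vanish. Resonant solutions of the form
polynomial times exponential show that both factors are sharp.

For the other `b`, the relations `s₁ + s₂ = w`, `s₁ s₂ = μ²` place an exponent strictly to the right
of the optimal abscissa (`exists_isExponent_re_gt`). The same relations push one towards the
imaginary axis as `b → ∞` (`exists_isExponent_re_ge_neg`). -/

noncomputable section

namespace CoupledSystem

/-! ### Diagonal operators and positive square roots -/

section Diagonal

variable {𝕜 H ι : Type*} [RCLike 𝕜] [NormedAddCommGroup H] [InnerProductSpace 𝕜 H]

theorem graph_mem_iff {E F : Type*} [AddCommGroup E] [Module 𝕜 E] [AddCommGroup F] [Module 𝕜 F]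
    (T : E →ₗ.[𝕜] F) (x : E) (y : F) :
    (x, y) ∈ T.graph ↔ ∃ h : x ∈ T.domain, T ⟨x, h⟩ = y := by
  rw [LinearPMap.mem_graph_iff]
  constructor
  · rintro ⟨z, hz, hy⟩
    simp only at hz hy
    subst hz
    exact ⟨z.2, hy⟩
  · rintro ⟨h, hy⟩
    exact ⟨⟨x, h⟩, rfl, hy⟩

/-- The diagonal operator with real diagonal entries `μ i` in a Hilbert basis, on its maximal
domain. -/
def diagOp (e : HilbertBasis ι 𝕜 H) (μ : ι → ℝ) : H →ₗ.[𝕜] H :=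
  Submodule.toLinearPMap
    { carrier := {p : H × H | ∀ i, e.repr p.2 i = (μ i : 𝕜) * e.repr p.1 i}
      add_mem' := fun {p q} hp hq i => by
        have h1 := hp i
        have h2 := hq i
        simp only [Prod.snd_add, Prod.fst_add, map_add, lp.coeFn_add, Pi.add_apply]
        rw [h1, h2, mul_add]
      zero_mem' := fun i => by simp
      smul_mem' := fun c p hp i => by
        have h1 := hp i
        simp only [Prod.smul_snd, Prod.smul_fst, map_smul, lp.coeFn_smul, Pi.smul_apply,
          smul_eq_mul]
        rw [h1, mul_left_comm] }

/-- The relation is single-valued, as `Submodule.toLinearPMap` requires to preserve it: a pair `(0,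
y)` forces every coefficient of `y` to vanish. -/
theorem mem_graph_diagOp (e : HilbertBasis ι 𝕜 H) (μ : ι → ℝ) (x y : H) :
    (x, y) ∈ (diagOp e μ).graph ↔ ∀ i, e.repr y i = (μ i : 𝕜) * e.repr x i := by
  rw [diagOp, Submodule.toLinearPMap_graph_eq]
  · rfl
  · rintro ⟨x, y⟩ h hx
    simp only at hx
    subst hx
    refine e.repr.map_eq_zero_iff.1 (lp.ext (funext fun i => ?_))
    have := h i
    simpa using this

/-- Parseval for two vectors whose coefficients are related by a real diagonal matrix. -/
theorem inner_diag (e : HilbertBasis ι 𝕜 H) {μ : ι → ℝ} {x y u v : H}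
    (hx : ∀ i, e.repr y i = (μ i : 𝕜) * e.repr x i)
    (hu : ∀ i, e.repr v i = (μ i : 𝕜) * e.repr u i) : ⟪y, u⟫_𝕜 = ⟪x, v⟫_𝕜 := by
  rw [← e.tsum_inner_mul_inner y u, ← e.tsum_inner_mul_inner x v]
  congr 1
  ext i
  have h1 := hx i
  have h2 := hu i
  rw [e.repr_apply_apply, e.repr_apply_apply] at h1 h2
  rw [h2, ← inner_conj_symm, h1, ← inner_conj_symm x]
  simp only [map_mul, RCLike.conj_ofReal]
  ring

theorem basis_mem_graph_diagOp (e : HilbertBasis ι 𝕜 H) (μ : ι → ℝ) (i : ι) :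
    (e i, (μ i : 𝕜) • e i) ∈ (diagOp e μ).graph := by
  classical
  rw [mem_graph_diagOp]
  intro j
  rw [map_smul, e.repr_self]
  by_cases h : j = i
  · subst h; simp [RCLike.real_smul_eq_coe_mul]
  · simp [h]

variable [CompleteSpace H]

/-- A densely defined symmetric operator whose graph contains the graph of its adjoint is
self-adjoint. -/
theorem isSelfAdjoint_of_symmetric_of_maximal (T : H →ₗ.[𝕜] H) (hd : Dense (T.domain : Set H))
    (hs : T.IsFormalAdjoint T)
    (hm : ∀ y w : H, (∀ x : T.domain, ⟪w, (x : H)⟫_𝕜 = ⟪y, T x⟫_𝕜) → (y, w) ∈ T.graph) :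
    IsSelfAdjoint T := by
  rw [LinearPMap.isSelfAdjoint_def]
  refine le_antisymm ?_ (hs.le_adjoint hd)
  refine LinearPMap.le_of_le_graph ?_
  rintro ⟨y, w⟩ hyw
  obtain ⟨hy, rfl⟩ := (graph_mem_iff _ _ _).1 hyw
  exact hm _ _ fun x => LinearPMap.adjoint_isFormalAdjoint hd ⟨y, hy⟩ x

theorem formalAdjoint_of_isSelfAdjoint {B : H →ₗ.[𝕜] H} (hB : IsSelfAdjoint B) :
    B.IsFormalAdjoint B := by
  have h := LinearPMap.adjoint_isFormalAdjoint hB.dense_domain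
  rwa [(LinearPMap.isSelfAdjoint_def).1 hB] at h

theorem inner_eq_inner_of_mem_graph {B : H →ₗ.[𝕜] H} (hB : IsSelfAdjoint B) {x y u v : H}
    (hx : (x, y) ∈ B.graph) (hu : (u, v) ∈ B.graph) : ⟪y, u⟫_𝕜 = ⟪x, v⟫_𝕜 := by
  obtain ⟨hx', rfl⟩ := (graph_mem_iff _ _ _).1 hx
  obtain ⟨hu', rfl⟩ := (graph_mem_iff _ _ _).1 hu
  exact formalAdjoint_of_isSelfAdjoint hB ⟨x, hx'⟩ ⟨u, hu'⟩

theorem mem_graph_of_isSelfAdjoint {B : H →ₗ.[𝕜] H} (hB : IsSelfAdjoint B) {y w : H}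
    (h : ∀ x : B.domain, ⟪w, (x : H)⟫_𝕜 = ⟪y, B x⟫_𝕜) : (y, w) ∈ B.graph := by
  have hy := LinearPMap.mem_adjoint_domain_of_exists (T := B) y ⟨w, h⟩
  have h2 : (y, w) ∈ B.adjoint.graph :=
    (graph_mem_iff _ _ _).2 ⟨hy, LinearPMap.adjoint_apply_eq hB.dense_domain _ h⟩
  rwa [(LinearPMap.isSelfAdjoint_def).1 hB] at h2

theorem isSelfAdjoint_diagOp (e : HilbertBasis ι 𝕜 H) (μ : ι → ℝ) :
    IsSelfAdjoint (diagOp e μ) := by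
  have hbas := basis_mem_graph_diagOp e μ
  refine isSelfAdjoint_of_symmetric_of_maximal _ ?_ ?_ ?_
  · have h1 : Submodule.span 𝕜 (Set.range e) ≤ (diagOp e μ).domain := by
      rw [Submodule.span_le]
      rintro _ ⟨i, rfl⟩
      exact ((graph_mem_iff _ _ _).1 (hbas i)).1
    have h2 : Dense (Submodule.span 𝕜 (Set.range e) : Set H) := by
      rw [Submodule.dense_iff_topologicalClosure_eq_top]
      exact e.dense_span
    exact h2.mono h1
  · intro x y
    exact inner_diag e ((mem_graph_diagOp e μ _ _).1 (LinearPMap.mem_graph _ x))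
      ((mem_graph_diagOp e μ _ _).1 (LinearPMap.mem_graph _ y))
  · intro y w h
    rw [mem_graph_diagOp]
    intro i
    obtain ⟨hi, hi'⟩ := (graph_mem_iff _ _ _).1 (hbas i)
    have h1 := h ⟨e i, hi⟩
    rw [hi', inner_smul_right] at h1
    rw [e.repr_apply_apply, e.repr_apply_apply, ← inner_conj_symm, h1, ← inner_conj_symm (e i) y]
    simp

/-- A self-adjoint operator with a Hilbert basis of eigenvectors is the maximal diagonal
operator. -/
theorem mem_graph_iff_of_eigenbasis (e : HilbertBasis ι 𝕜 H) (μ : ι → ℝ) {B : H →ₗ.[𝕜] H}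
    (hB : IsSelfAdjoint B) (hBe : ∀ i, (e i, (μ i : 𝕜) • e i) ∈ B.graph) (x y : H) :
    (x, y) ∈ B.graph ↔ ∀ i, e.repr y i = (μ i : 𝕜) * e.repr x i := by
  have key : ∀ x y : H, (x, y) ∈ B.graph → ∀ i, e.repr y i = (μ i : 𝕜) * e.repr x i := by
    intro x y h i
    rw [e.repr_apply_apply, e.repr_apply_apply, ← inner_eq_inner_of_mem_graph hB (hBe i) h,
      inner_smul_left, RCLike.conj_ofReal]
  -- By Parseval `y` is the value at `x` of the adjoint of `B`, which is `B`; this maximality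
  -- settles the domain.
  refine ⟨key x y, fun h => mem_graph_of_isSelfAdjoint hB fun v => ?_⟩
  exact inner_diag e h (key _ _ (LinearPMap.mem_graph _ v))

/-- If `A` is diagonal with eigenvalues `μ i ^ 2`, `μ i > 0`, the diagonal operator with entries
`μ i` is a positive square root. -/
theorem isPosSqrt_diagOp (e : HilbertBasis ι 𝕜 H) {μ : ι → ℝ} (hμ : ∀ i, 0 < μ i)
    {A : H →ₗ.[𝕜] H}
    (hA : ∀ x y, (x, y) ∈ A.graph ↔ ∀ i, e.repr y i = ((μ i ^ 2 : ℝ) : 𝕜) * e.repr x i) :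
    IsPosSqrt A (diagOp e μ) := by
  refine ⟨isSelfAdjoint_diagOp e μ, ?_, ?_⟩
  · intro x
    have hx := (mem_graph_diagOp e μ _ _).1 (LinearPMap.mem_graph _ x)
    have hs := e.hasSum_inner_mul_inner (x : H) (diagOp e μ x)
    refine (RCLike.hasSum_re 𝕜 hs).nonneg fun i => ?_
    have h1 := hx i
    rw [e.repr_apply_apply, e.repr_apply_apply] at h1
    rw [h1, ← inner_conj_symm, mul_left_comm, RCLike.conj_mul, RCLike.re_ofReal_mul]
    have : (0:ℝ) ≤ RCLike.re ((‖⟪e i, (x : H)⟫_𝕜‖ : 𝕜) ^ 2) := by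
      rw [← RCLike.ofReal_pow, RCLike.ofReal_re]; positivity
    exact mul_nonneg (hμ i).le this
  · intro x z
    rw [hA]
    constructor
    · intro h
      -- The intermediate vector has coefficients `μ i * x i`, square summable because `μ² ≤ 1 +
      -- μ⁴`.
      have hm : Memℓp (fun i => (μ i : 𝕜) * e.repr x i) 2 := by
        refine memℓp_gen ?_
        have s1 := (lp.memℓp (e.repr x)).summable (by norm_num)
        have s2 := (lp.memℓp (e.repr z)).summable (by norm_num)
        refine Summable.of_nonneg_of_le (fun i => by positivity) (fun i => ?_) (s1.add s2)
        rw [h i]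
        simp only [ENNReal.toReal_ofNat, norm_mul, RCLike.norm_ofReal, Real.rpow_ofNat]
        rw [mul_pow, mul_pow, sq_abs, sq_abs]
        nlinarith [sq_nonneg ((μ i) ^ 2 - 1), sq_nonneg (‖e.repr x i‖),
          mul_nonneg (sq_nonneg ((μ i) ^ 2 - 1)) (sq_nonneg (‖e.repr x i‖)),
          mul_nonneg (sq_nonneg ((μ i) ^ 2)) (sq_nonneg (‖e.repr x i‖))]
      refine ⟨e.repr.symm ⟨_, hm⟩, (mem_graph_diagOp ..).2 fun i => ?_,
        (mem_graph_diagOp ..).2 fun i => ?_⟩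
      · rw [LinearIsometryEquiv.apply_symm_apply]
      · rw [LinearIsometryEquiv.apply_symm_apply, h i]
        push_cast
        ring
    · rintro ⟨y, h1, h2⟩ i
      rw [mem_graph_diagOp] at h1 h2
      rw [h2, h1]
      push_cast
      ring

/-- A positive square root acts on an eigenvector by the root of the eigenvalue. -/
theorem IsPosSqrt.eigenvector {A B : H →ₗ.[𝕜] H} (h : IsPosSqrt A B) {μ : ℝ} (hμ : 0 < μ) {x : H}
    (hx : (x, ((μ ^ 2 : ℝ) : 𝕜) • x) ∈ A.graph) : (x, (μ : 𝕜) • x) ∈ B.graph := by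
  obtain ⟨y, h1, h2⟩ := (h.sq _ _).1 hx
  -- Factor `B² - μ² = (B + μ)(B - μ)`: the vector `(B - μ) x` is mapped by `B` to `-μ` times
  -- itself, and nonnegativity of `B` forces it to vanish.
  have h3 : (y - (μ : 𝕜) • x, (-(μ : 𝕜)) • (y - (μ : 𝕜) • x)) ∈ B.graph := by
    have := B.graph.sub_mem h2 (B.graph.smul_mem (μ : 𝕜) h1)
    convert this using 1
    ext
    · simp
    · simp only [RCLike.ofReal_pow, Prod.snd_sub, Prod.smul_snd, smul_sub, neg_smul]
      rw [smul_smul, pow_two]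
      abel
  obtain ⟨hd, h4⟩ := (graph_mem_iff _ _ _).1 h3
  have h5 := h.nonneg ⟨_, hd⟩
  rw [h4, inner_smul_right, inner_self_eq_norm_sq_to_K, ← RCLike.ofReal_neg, ← RCLike.ofReal_pow,
    RCLike.re_ofReal_mul, RCLike.ofReal_re] at h5
  have h6 : ‖y - (μ : 𝕜) • x‖ ^ 2 = 0 := by
    nlinarith [sq_nonneg ‖y - (μ : 𝕜) • x‖]
  have h7 : y = (μ : 𝕜) • x := by
    rwa [sq_eq_zero_iff, norm_eq_zero, sub_eq_zero] at h6
  rwa [h7] at h1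

end Diagonal

/-! ### Compact inverse and eigenbasis of `A` -/

section Spectral

universe u v

variable {𝕜 : Type u} {H : Type v} [RCLike 𝕜] [NormedAddCommGroup H] [InnerProductSpace 𝕜 H]

theorem IsStrictlyPos.eq_zero_of_mem_graph {A : H →ₗ.[𝕜] H} (hpos : IsStrictlyPos A) {x : H}
    (h : (x, 0) ∈ A.graph) : x = 0 := by
  obtain ⟨hx, h0⟩ := (graph_mem_iff _ _ _).1 h
  by_contra hne
  have := hpos ⟨x, hx⟩ (fun h => hne (congrArg Subtype.val h))
  rw [h0] at this
  simp at this

theorem isLeast_eigenvalues {ι : Type*} {A : H →ₗ.[𝕜] H} (e : HilbertBasis ι 𝕜 H) {lam : ι → ℝ}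
    {i₀ : ι} (hmin : ∀ i, lam i₀ ≤ lam i)
    (hgraph : ∀ x y, (x, y) ∈ A.graph ↔ ∀ i, e.repr y i = (lam i : 𝕜) * e.repr x i) :
    IsLeast (eigenvalues A) (lam i₀) := by
  constructor
  · have h : (e i₀, (lam i₀ : 𝕜) • e i₀) ∈ A.graph := by
      rw [hgraph, ← mem_graph_diagOp]
      exact basis_mem_graph_diagOp e lam i₀
    obtain ⟨h1, h2⟩ := (graph_mem_iff _ _ _).1 h
    exact ⟨⟨e i₀, h1⟩, fun h => e.orthonormal.ne_zero i₀ (congrArg Subtype.val h), h2⟩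
  · rintro μ ⟨x, hx0, hx⟩
    have h1 := (hgraph _ _).1 (LinearPMap.mem_graph A x)
    have hx4 : ∃ i, e.repr (x : H) i ≠ 0 := by
      by_contra! h0
      refine hx0 (Subtype.ext (e.repr.map_eq_zero_iff.1 (lp.ext (funext fun i => ?_))))
      simpa using h0 i
    obtain ⟨i, hi⟩ := hx4
    have h5 := h1 i
    rw [hx, map_smul, lp.coeFn_smul, Pi.smul_apply, smul_eq_mul] at h5
    have h6 := mul_right_cancel₀ hi h5
    rw [RCLike.ofReal_inj] at h6
    rw [h6]
    exact hmin i

variable [CompleteSpace H]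

/-- A strictly positive self-adjoint operator with compactly embedded domain is bounded below. -/
theorem exists_pos_le_norm_apply {A : H →ₗ.[𝕜] H} (hA : IsSelfAdjoint A) (hpos : IsStrictlyPos A)
    (hcpt : HasCompactDomain A) : ∃ c : ℝ, 0 < c ∧ ∀ x y, (x, y) ∈ A.graph → c * ‖x‖ ≤ ‖y‖ := by
  by_contra! hcon
  -- Unit vectors with images tending to zero: by compactness they have a limit point, of norm one,
  -- which lies in the kernel since the graph is closed.
  have hseq : ∀ n : ℕ, ∃ p : H × H, p ∈ A.graph ∧ ‖p.1‖ = 1 ∧ ‖p.2‖ ≤ 1 / ((n : ℝ) + 1) := by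
    intro n
    obtain ⟨x, y, hxy, hlt⟩ := hcon (1 / ((n : ℝ) + 1)) (by positivity)
    have hx : 0 < ‖x‖ := by
      by_contra h0
      have : ‖x‖ = 0 := le_antisymm (not_lt.1 h0) (norm_nonneg _)
      rw [this, mul_zero] at hlt
      exact absurd hlt (not_lt.2 (norm_nonneg _))
    refine ⟨((‖x‖⁻¹ : ℝ) : 𝕜) • (x, y), A.graph.smul_mem _ hxy, ?_, ?_⟩
    · simp only [Prod.smul_fst, norm_smul, RCLike.norm_ofReal, abs_inv, abs_norm]
      exact inv_mul_cancel₀ hx.ne'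
    · simp only [Prod.smul_snd, norm_smul, RCLike.norm_ofReal, abs_inv, abs_norm]
      rw [inv_mul_le_iff₀ hx, mul_comm]
      exact hlt.le
  choose p hp1 hp2 hp3 using hseq
  have hmem : ∀ n, (p n).1 ∈ closure {x : H | ∃ h : x ∈ A.domain, ‖x‖ ≤ 1 ∧ ‖A ⟨x, h⟩‖ ≤ 1} := by
    intro n
    refine subset_closure ?_
    obtain ⟨h, h'⟩ := (graph_mem_iff _ _ _).1 (hp1 n)
    refine ⟨h, (hp2 n).le, ?_⟩
    rw [h']
    refine (hp3 n).trans ?_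
    rw [div_le_one (by positivity)]
    linarith [n.cast_nonneg (α := ℝ)]
  obtain ⟨a, -, φ, hφ, hlim⟩ := hcpt.tendsto_subseq hmem
  have hlim2 : Tendsto (fun n => (p n).2) atTop (𝓝 0) :=
    squeeze_zero_norm hp3 tendsto_one_div_add_atTop_nhds_zero_nat
  have hgraph : (a, (0 : H)) ∈ A.graph := by
    have hcl : IsClosed (A.graph : Set (H × H)) := hA.isClosed
    refine hcl.mem_of_tendsto (hlim.prodMk_nhds (hlim2.comp hφ.tendsto_atTop))
      (Eventually.of_forall fun n => hp1 (φ n))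
  have ha : a = 0 := hpos.eq_zero_of_mem_graph hgraph
  have hn : Tendsto (fun n => ‖(p (φ n)).1‖) atTop (𝓝 ‖a‖) := hlim.norm
  simp only [hp2] at hn
  have := tendsto_nhds_unique hn tendsto_const_nhds
  rw [ha, norm_zero] at this
  exact zero_ne_one this

/-- The bounded inverse. -/
theorem exists_inverse {A : H →ₗ.[𝕜] H} (hA : IsSelfAdjoint A) (hpos : IsStrictlyPos A)
    (hcpt : HasCompactDomain A) : ∃ R : H →L[𝕜] H, IsCompactOperator R ∧
      (R : H →ₗ[𝕜] H).IsSymmetric ∧ ∀ x y, (x, y) ∈ A.graph ↔ x = R y := by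
  obtain ⟨c, hc, hbound⟩ := exists_pos_le_norm_apply hA hpos hcpt
  have hcl : IsClosed (A.graph : Set (H × H)) := hA.isClosed
  have : CompleteSpace A.graph := hcl.completeSpace_coe
  -- Inverting `A` means inverting the second projection of its graph, a Banach space. The lower
  -- bound makes this projection injective with closed range, and the orthogonal complement of the
  -- range is the kernel of the adjoint `A`, which is zero.
  let f : A.graph →L[𝕜] H := (ContinuousLinearMap.snd 𝕜 H H).comp A.graph.subtypeL
  have hf : ∀ p : A.graph, f p = (p : H × H).2 := fun p => rfl
  have hanti : AntilipschitzWith (Real.toNNReal (max c⁻¹ 1)) f := by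
    refine ContinuousLinearMap.antilipschitz_of_bound f fun p => ?_
    rw [Real.coe_toNNReal _ (le_max_of_le_right zero_le_one)]
    have h1 : ‖p‖ = max ‖(p : H × H).1‖ ‖(p : H × H).2‖ := rfl
    rw [h1, hf]
    refine max_le ?_ ?_
    · have := hbound _ _ p.2
      calc ‖(p : H × H).1‖ = c⁻¹ * (c * ‖(p : H × H).1‖) := by field_simp
        _ ≤ c⁻¹ * ‖(p : H × H).2‖ := by gcongr
        _ ≤ _ := by gcongr; exact le_max_left _ _
    · calc ‖(p : H × H).2‖ = 1 * ‖(p : H × H).2‖ := by ring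
        _ ≤ _ := by gcongr; exact le_max_right _ _
  have hclr : IsClosed (Set.range f) := hanti.isClosed_range f.uniformContinuous
  have hrange : f.range = ⊤ := by
    have : CompleteSpace f.range :=
      IsComplete.completeSpace_coe (s := (f.range : Set H))
        (by rw [LinearMap.coe_range]; exact hclr.isComplete)
    rw [← Submodule.orthogonal_eq_bot_iff, Submodule.eq_bot_iff]
    intro w hw
    refine hpos.eq_zero_of_mem_graph (mem_graph_of_isSelfAdjoint hA fun x => ?_)
    rw [inner_zero_left]
    have := (Submodule.mem_orthogonal' _ _).1 hw (A x)
      ⟨⟨((x : H), A x), LinearPMap.mem_graph _ x⟩, rfl⟩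
    exact this.symm
  have hker : f.ker = ⊥ := LinearMap.ker_eq_bot.2 hanti.injective
  let g := ContinuousLinearEquiv.ofBijective f hker hrange
  let R : H →L[𝕜] H :=
    (ContinuousLinearMap.fst 𝕜 H H).comp (A.graph.subtypeL.comp (g.symm : H →L[𝕜] A.graph))
  have hRg : ∀ y, (R y, y) ∈ A.graph := by
    intro y
    have h1 : ((g.symm y : A.graph) : H × H).2 = y := by
      have := ContinuousLinearEquiv.ofBijective_apply_symm_apply f hker hrange y
      exact this
    have h2 : ((g.symm y : A.graph) : H × H) = (R y, y) := Prod.ext rfl h1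
    rw [← h2]
    exact (g.symm y).2
  have hiff : ∀ x y, (x, y) ∈ A.graph ↔ x = R y := by
    intro x y
    constructor
    · intro h
      have h3 := A.graph.sub_mem h (hRg y)
      have h4 : (x - R y, (0 : H)) ∈ A.graph := by simpa using h3
      exact sub_eq_zero.1 (hpos.eq_zero_of_mem_graph h4)
    · rintro rfl
      exact hRg y
  refine ⟨R, ?_, ?_, hiff⟩
  · refine ⟨_, hcpt, ?_⟩
    -- `‖y‖ ≤ c` gives `‖R y‖ ≤ 1`, and `‖y‖ ≤ 1` bounds `A (R y) = y`.
    refine Filter.mem_of_superset (Metric.closedBall_mem_nhds (0 : H) (lt_min hc one_pos)) ?_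
    intro y hy
    rw [mem_closedBall_zero_iff, le_min_iff] at hy
    refine subset_closure ?_
    obtain ⟨h, h'⟩ := (graph_mem_iff _ _ _).1 (hRg y)
    refine ⟨h, ?_, by rw [h']; exact hy.2⟩
    have := hbound _ _ (hRg y)
    nlinarith
  · intro x y
    exact (inner_eq_inner_of_mem_graph hA (hRg x) (hRg y)).symm

/-- The eigenbasis of a symmetric compact operator. -/
theorem exists_hilbertBasis_eigenvectors (R : H →L[𝕜] H) (hR : IsCompactOperator R)
    (hs : (R : H →ₗ[𝕜] H).IsSymmetric) :
    ∃ (ι : Type (max u v)) (e : HilbertBasis ι 𝕜 H) (ρ : ι → 𝕜), ∀ i, R (e i) = ρ i • e i := by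
  have hcl : ∀ μ : 𝕜, IsClosed (Module.End.eigenspace (R : H →ₗ[𝕜] H) μ : Set H) := by
    intro μ
    have : (Module.End.eigenspace (R : H →ₗ[𝕜] H) μ : Set H) = {x | R x = μ • x} := by
      ext x
      simp
    rw [this]
    exact isClosed_eq R.continuous (continuous_const_smul μ)
  have : ∀ μ : 𝕜, CompleteSpace (Module.End.eigenspace (R : H →ₗ[𝕜] H) μ) :=
    fun μ => (hcl μ).completeSpace_coe
  -- Hilbert bases of all eigenspaces are glued; their span is dense because the eigenspaces of a
  -- compact symmetric operator, the kernel included, have dense sum.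
  choose w b hb using fun μ : 𝕜 =>
    exists_hilbertBasis 𝕜 (Module.End.eigenspace (R : H →ₗ[𝕜] H) μ)
  have hortho := hs.orthogonalFamily_eigenspaces
  have hv := hortho.orthonormal_sigma_orthonormal (v_family := fun μ => (b μ : w μ → _))
    fun μ => (b μ).orthonormal
  refine ⟨Σ μ : 𝕜, w μ, HilbertBasis.mkOfOrthogonalEqBot hv ?_, fun a => a.1, ?_⟩
  · rw [← ContinuousLinearMap.orthogonalComplement_iSup_eigenspaces_eq_bot hR hs]
    refine le_antisymm ?_ (Submodule.orthogonal_le ?_)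
    · rw [← Submodule.iInf_orthogonal, le_iInf_iff]
      intro μ x hx
      rw [Submodule.mem_orthogonal]
      intro u hu
      have hdense := (b μ).dense_span
      let g : Module.End.eigenspace (R : H →ₗ[𝕜] H) μ →L[𝕜] 𝕜 :=
        (innerSL 𝕜 x).comp (Submodule.subtypeL _)
      have hg : g = 0 := by
        refine ContinuousLinearMap.ext_on (s := Set.range (b μ)) ?_ ?_
        · exact (Submodule.dense_iff_topologicalClosure_eq_top.2 hdense)
        · rintro _ ⟨i, rfl⟩
          have := (Submodule.mem_orthogonal' _ _).1 hx ((b μ i : _) : H)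
            (Submodule.subset_span ⟨⟨μ, i⟩, rfl⟩)
          simpa [g] using this
      have h2 : g ⟨u, hu⟩ = 0 := by rw [hg]; rfl
      rw [← inner_conj_symm]
      have h3 : ⟪x, u⟫_𝕜 = 0 := h2
      rw [h3, map_zero]
    · rw [Submodule.span_le]
      rintro _ ⟨⟨μ, i⟩, rfl⟩
      exact Submodule.mem_iSup_of_mem μ (b μ i).2
  · rintro ⟨μ, i⟩
    rw [HilbertBasis.coe_mkOfOrthogonalEqBot]
    exact Module.End.mem_eigenspace_iff.1 (b μ i).2

/-- Diagonalisation of a strictly positive self-adjoint operator with compactly embedded domain. -/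
theorem exists_eigenbasis [Nontrivial H] {A : H →ₗ.[𝕜] H} (hA : IsSelfAdjoint A)
    (hpos : IsStrictlyPos A) (hcpt : HasCompactDomain A) :
    ∃ (ι : Type (max u v)) (e : HilbertBasis ι 𝕜 H) (lam : ι → ℝ) (i₀ : ι),
      (∀ i, 0 < lam i) ∧ (∀ i, lam i₀ ≤ lam i) ∧
      ∀ x y, (x, y) ∈ A.graph ↔ ∀ i, e.repr y i = (lam i : 𝕜) * e.repr x i := by
  obtain ⟨R, hRc, hRs, hR⟩ := exists_inverse hA hpos hcpt
  obtain ⟨ι, e, ρ, he⟩ := exists_hilbertBasis_eigenvectors R hRc hRs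
  have hne : ∀ i, e i ≠ 0 := fun i => e.orthonormal.ne_zero i
  have hρ0 : ∀ i, ρ i ≠ 0 := by
    intro i h0
    have h1 := he i
    rw [h0, zero_smul] at h1
    have h2 : ((0 : H), e i) ∈ A.graph := (hR _ _).2 h1.symm
    obtain ⟨h3, h4⟩ := (graph_mem_iff _ _ _).1 h2
    apply hne i
    rw [← h4]
    exact map_zero A.toFun
  have hgr : ∀ i, (e i, (ρ i)⁻¹ • e i) ∈ A.graph := by
    intro i
    rw [hR, map_smul, he i, smul_smul, inv_mul_cancel₀ (hρ0 i), one_smul]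
  have hin : ∀ i, ⟪e i, (ρ i)⁻¹ • e i⟫_𝕜 = (ρ i)⁻¹ := by
    intro i
    rw [inner_smul_right, inner_self_eq_norm_sq_to_K, e.orthonormal.1 i]
    simp
  have hreal : ∀ i, ((RCLike.re (ρ i)⁻¹ : ℝ) : 𝕜) = (ρ i)⁻¹ := by
    intro i
    have h1 := inner_eq_inner_of_mem_graph hA (hgr i) (hgr i)
    rw [← inner_conj_symm, hin] at h1
    exact RCLike.conj_eq_iff_re.1 h1
  have hposi : ∀ i, 0 < RCLike.re (ρ i)⁻¹ := by
    intro i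
    obtain ⟨h1, h2⟩ := (graph_mem_iff _ _ _).1 (hgr i)
    have := hpos ⟨e i, h1⟩ (fun h => hne i (congrArg Subtype.val h))
    rwa [h2, hin] at this
  have hgr' : ∀ i, (e i, ((RCLike.re (ρ i)⁻¹ : ℝ) : 𝕜) • e i) ∈ A.graph := by
    intro i
    rw [hreal]
    exact hgr i
  have hgraph := mem_graph_iff_of_eigenbasis e (fun i => RCLike.re (ρ i)⁻¹) hA hgr'
  have hρnorm : ∀ i, ‖ρ i‖ = (RCLike.re (ρ i)⁻¹)⁻¹ := by
    intro i
    have h1 : ‖(ρ i)⁻¹‖ = RCLike.re (ρ i)⁻¹ := by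
      conv_lhs => rw [← hreal i]
      rw [RCLike.norm_ofReal, abs_of_pos (hposi i)]
    rw [← h1, norm_inv, inv_inv]
  have hρle : ∀ i, ‖ρ i‖ ≤ ‖R‖ := by
    intro i
    have := R.le_opNorm (e i)
    rwa [he i, norm_smul, e.orthonormal.1 i, mul_one, mul_one] at this
  -- The least eigenvalue of `A` is `1 / ‖R‖`: the norm of a self-adjoint operator is its spectral
  -- radius, and a nonzero spectral value of a compact operator is an eigenvalue. Over `ℝ`
  -- nonemptiness of the spectrum needs an argument: an empty spectrum would give `R = 0`.
  have hmax : ∃ i₀, ‖ρ i₀‖ = ‖R‖ := by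
    have hsa : IsSelfAdjoint R := hRs.isSelfAdjoint
    have hspec : (spectrum 𝕜 R).Nonempty := by
      by_contra hemp
      rw [Set.not_nonempty_iff_eq_empty] at hemp
      have h1 := R.spectralRadius_eq_nnnorm hsa
      rw [spectralRadius, hemp] at h1
      simp only [Set.mem_empty_iff_false, not_false_eq_true, iSup_neg,
        ENNReal.bot_eq_zero, ENNReal.iSup_zero] at h1
      have h2 : R = 0 := by
        have : ‖R‖₊ = 0 := by exact_mod_cast h1.symm
        simpa using this
      obtain ⟨x, hx⟩ := exists_ne (0 : H)
      have h3 : (R x, x) ∈ A.graph := (hR _ _).2 rfl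
      rw [h2] at h3
      obtain ⟨h4, h5⟩ := (graph_mem_iff _ _ _).1 h3
      exact hx (h5.symm.trans (map_zero A.toFun))
    obtain ⟨k, hk, hk2⟩ := spectrum.exists_nnnorm_eq_spectralRadius_of_nonempty hspec
    rw [R.spectralRadius_eq_nnnorm hsa] at hk2
    have hk3 : ‖k‖ = ‖R‖ := by
      have : ‖k‖₊ = ‖R‖₊ := by exact_mod_cast hk2
      exact congrArg NNReal.toReal this
    have hRpos : ‖R‖ ≠ 0 := by
      intro h0
      obtain ⟨x, hx⟩ := exists_ne (0 : H)
      have h3 : (R x, x) ∈ A.graph := (hR _ _).2 rfl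
      rw [norm_eq_zero.1 h0] at h3
      obtain ⟨h4, h5⟩ := (graph_mem_iff _ _ _).1 h3
      exact hx (h5.symm.trans (map_zero A.toFun))
    have hk0 : k ≠ 0 := by
      rintro rfl
      rw [norm_zero] at hk3
      exact hRpos hk3.symm
    have hev := (hRc.hasEigenvalue_iff_mem_spectrum hk0).2 hk
    obtain ⟨x, hx⟩ := hev.exists_hasEigenvector
    have hx1 : R x = k • x := hx.apply_eq_smul
    have hx2 : (x, k⁻¹ • x) ∈ A.graph := by
      rw [hR, map_smul, hx1, smul_smul, inv_mul_cancel₀ hk0, one_smul]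
    have hx3 := (hgraph _ _).1 hx2
    have hx4 : ∃ i, e.repr x i ≠ 0 := by
      by_contra! h0
      refine hx.2 (e.repr.map_eq_zero_iff.1 (lp.ext (funext fun i => ?_)))
      simpa using h0 i
    obtain ⟨i, hi⟩ := hx4
    have h5 := hx3 i
    rw [map_smul, lp.coeFn_smul, Pi.smul_apply, smul_eq_mul, hreal] at h5
    have h6 := inv_injective (mul_right_cancel₀ hi h5)
    exact ⟨i, by rw [← h6, hk3]⟩
  obtain ⟨i₀, hi₀⟩ := hmax
  refine ⟨ι, e, _, i₀, hposi, fun i => ?_, hgraph⟩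
  have h1 := hρle i
  rw [← hi₀, hρnorm, hρnorm] at h1
  exact (inv_le_inv₀ (hposi i) (hposi i₀)).1 h1

end Spectral

/-! ### Flows of bounded operators -/

section LinearFlow

variable {𝕜 V : Type*} [RCLike 𝕜] [NormedAddCommGroup V] [NormedSpace 𝕜 V]

/-- The flow `exp (t M)` of a bounded operator. -/
def linFlow (M : V →L[𝕜] V) (t : ℝ) : V →L[𝕜] V :=
  NormedSpace.exp ((t : 𝕜) • M)

theorem linFlow_zero (M : V →L[𝕜] V) : linFlow M 0 = 1 := by
  simp [linFlow]

theorem linFlow_apply_gen (M : V →L[𝕜] V) (z : V) (t : ℝ) :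
    linFlow M t (M z) = M (linFlow M t z) := by
  have h1 : Commute (linFlow M t) M := ((Commute.refl M).smul_left (t : 𝕜)).exp_left
  exact congrArg (fun f => f z) h1

variable [CompleteSpace V]

theorem linFlow_add (M : V →L[𝕜] V) (s t : ℝ) :
    linFlow M (s + t) = linFlow M s * linFlow M t := by
  rw [linFlow, linFlow, linFlow, RCLike.ofReal_add, add_smul]
  have := NormedAlgebra.restrictScalars ℚ 𝕜 (V →L[𝕜] V)
  exact NormedSpace.exp_add_of_commute (((Commute.refl M).smul_left _).smul_right _)

variable [NormedSpace ℝ V] [IsScalarTower ℝ 𝕜 V]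

theorem hasDerivAt_linFlow (M : V →L[𝕜] V) (z : V) (t : ℝ) :
    HasDerivAt (fun t => linFlow M t z) (M (linFlow M t z)) t := by
  have h1 := hasDerivAt_exp_smul_const' (𝕂 := 𝕜) M (t : 𝕜)
  have h2 : HasDerivAt (fun u : 𝕜 => NormedSpace.exp (u • M) z)
      ((M * NormedSpace.exp ((t : 𝕜) • M)) z) (t : 𝕜) :=
    (ContinuousLinearMap.apply 𝕜 V z).hasFDerivAt.comp_hasDerivAt _ h1
  have h3 : HasDerivAt (fun t : ℝ => (t : 𝕜)) 1 t := by
    have := (RCLike.ofRealCLM (K := 𝕜)).hasDerivAt (x := t)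
    simpa using this
  have h4 := h2.scomp t h3
  rw [one_smul] at h4
  exact h4

/-- A right-differentiable solution of an autonomous linear equation is given by the flow. -/
theorem eq_linFlow_of_hasDerivWithinAt (M : V →L[𝕜] V) {f : ℝ → V} (hc : Continuous f)
    (hf : ∀ t, 0 ≤ t → HasDerivWithinAt f (M (f t)) (Set.Ici t) t) {t : ℝ} (ht : 0 ≤ t) :
    f t = linFlow M t (f 0) := by
  refine ODE_solution_unique (v := fun _ => M) (K := ‖M‖₊) (a := 0) (b := t) (f := f)
    (g := fun t => linFlow M t (f 0)) (fun _ => M.lipschitz) hc.continuousOn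
    (fun s hs => hf s hs.1) ?_ (fun s _ => (hasDerivAt_linFlow M _ s).hasDerivWithinAt)
    (by simp [linFlow_zero]) ⟨ht, le_rfl⟩
  exact (continuous_iff_continuousAt.2
    fun s => (hasDerivAt_linFlow M (f 0) s).continuousAt).continuousOn

end LinearFlow

/-! ### The matrix of one mode -/

section Modes

variable (𝕜 : Type*) [RCLike 𝕜]

/-- The space of one mode: the coefficients of `A ^ (1/2) u`, `x`, `A ^ (1/2) v`, `y`. -/
abbrev Mode : Type _ := EuclideanSpace 𝕜 (Fin 4)

/-- The generator on a mode with frequency `μ`. -/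
def modeGen (ε b μ : ℝ) : Mode 𝕜 →L[𝕜] Mode 𝕜 :=
  Matrix.toEuclideanCLM (𝕜 := 𝕜)
    !![0, (μ : 𝕜), 0, 0; -(μ : 𝕜), -1, 0, (b : 𝕜); 0, 0, 0, (μ : 𝕜); 0, -(b : 𝕜), -(μ : 𝕜), (ε : 𝕜)]

variable {𝕜}

theorem modeGen_apply (ε b μ : ℝ) (z : Mode 𝕜) :
    modeGen 𝕜 ε b μ z = !₂[(μ : 𝕜) * z 1, -(μ : 𝕜) * z 0 - z 1 + (b : 𝕜) * z 3, (μ : 𝕜) * z 3,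
      -(b : 𝕜) * z 1 - (μ : 𝕜) * z 2 + (ε : 𝕜) * z 3] := by
  have h : (modeGen 𝕜 ε b μ z).ofLp = _ := Matrix.ofLp_toEuclideanCLM (𝕜 := 𝕜) _ z
  ext i
  rw [h]
  fin_cases i <;> simp [Matrix.mulVec, dotProduct, Fin.sum_univ_four] <;> ring

end Modes

/-! ### Diagonal operators on `ℓ²` -/

section DiagonalSemigroup

variable {𝕜 V ι : Type*} [RCLike 𝕜] [NormedAddCommGroup V] [NormedSpace 𝕜 V]



theorem lp_two_norm_sq (f : lp (fun _ : ι => V) 2) : ‖f‖ ^ 2 = ∑' i, ‖f i‖ ^ 2 := by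
  have := lp.norm_rpow_eq_tsum (p := 2) (by norm_num) f
  simpa using this

theorem lp_two_summable (f : lp (fun _ : ι => V) 2) : Summable fun i => ‖f i‖ ^ 2 := by
  have := (lp.memℓp f).summable (by norm_num)
  simpa using this

theorem memlp_two_of_summable {f : ι → V} (h : Summable fun i => ‖f i‖ ^ 2) : Memℓp f 2 := by
  refine memℓp_gen ?_
  simpa using h

theorem lp_two_norm_le {f g : lp (fun _ : ι => V) 2} {C : ℝ} (hC : 0 ≤ C)
    (h : ∀ i, ‖f i‖ ≤ C * ‖g i‖) : ‖f‖ ≤ C * ‖g‖ := by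
  refine le_of_sq_le_sq ?_ (by positivity)
  rw [mul_pow, lp_two_norm_sq, lp_two_norm_sq, ← tsum_mul_left]
  refine Summable.tsum_le_tsum (fun i => ?_) (lp_two_summable f)
    ((lp_two_summable g).mul_left _)
  rw [← mul_pow]
  exact pow_le_pow_left₀ (norm_nonneg _) (h i) 2

/-- Dominated convergence in `ℓ²`. -/
theorem lp_two_tendsto_zero {α : Type*} {l : Filter α} {f : α → lp (fun _ : ι => V) 2}
    (g : lp (fun _ : ι => V) 2) (C : ℝ) (hbound : ∀ᶠ a in l, ∀ i, ‖f a i‖ ≤ C * ‖g i‖)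
    (hlim : ∀ i, Tendsto (fun a => f a i) l (𝓝 0)) : Tendsto f l (𝓝 0) := by
  have h1 : Tendsto (fun a => ∑' i, ‖f a i‖ ^ 2) l (𝓝 (∑' _ : ι, (0 : ℝ))) := by
    refine tendsto_tsum_of_dominated_convergence (bound := fun i => C ^ 2 * ‖g i‖ ^ 2)
      ((lp_two_summable g).mul_left _) (fun i => ?_) ?_
    · have := ((hlim i).norm).pow 2
      simpa using this
    · filter_upwards [hbound] with a ha i
      rw [Real.norm_of_nonneg (by positivity), ← mul_pow]
      exact pow_le_pow_left₀ (norm_nonneg _) (ha i) 2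
  rw [tsum_zero] at h1
  rw [tendsto_zero_iff_norm_tendsto_zero]
  have h2 := (Real.continuous_sqrt.tendsto 0).comp h1
  rw [Real.sqrt_zero] at h2
  refine h2.congr fun a => ?_
  simp only [Function.comp_apply]
  rw [← lp_two_norm_sq, Real.sqrt_sq (norm_nonneg _)]

theorem lp_two_tendsto {α : Type*} {l : Filter α} {f : α → lp (fun _ : ι => V) 2}
    {f₀ : lp (fun _ : ι => V) 2}
    (g : lp (fun _ : ι => V) 2) (C : ℝ) (hbound : ∀ᶠ a in l, ∀ i, ‖f a i - f₀ i‖ ≤ C * ‖g i‖)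
    (hlim : ∀ i, Tendsto (fun a => f a i) l (𝓝 (f₀ i))) : Tendsto f l (𝓝 f₀) := by
  rw [← tendsto_sub_nhds_zero_iff]
  refine lp_two_tendsto_zero g C ?_ fun i => ?_
  · simpa using hbound
  · have := (hlim i).sub_const (f₀ i)
    rw [sub_self] at this
    exact this

/-- The diagonal operator on `ℓ²` with uniformly bounded entries. -/
def lpDiag (ψ : ι → V →L[𝕜] V) (C : ℝ) (hC : 0 ≤ C) (h : ∀ i, ‖ψ i‖ ≤ C) :
    lp (fun _ : ι => V) 2 →L[𝕜] lp (fun _ : ι => V) 2 :=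
  LinearMap.mkContinuous
    { toFun := fun f => ⟨fun i => ψ i (f i), memlp_two_of_summable (by
        refine Summable.of_nonneg_of_le (fun i => by positivity) (fun i => ?_)
          ((lp_two_summable f).mul_left (C ^ 2))
        rw [← mul_pow]
        exact pow_le_pow_left₀ (norm_nonneg _) ((ψ i).le_of_opNorm_le (h i) _) 2)⟩
      map_add' := fun f g => lp.ext (funext fun i => map_add (ψ i) (f i) (g i))
      map_smul' := fun c f => lp.ext (funext fun i => map_smul (ψ i) c (f i)) } C
    fun f => lp_two_norm_le hC fun i => (ψ i).le_of_opNorm_le (h i) _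

end DiagonalSemigroup

/-! ### Semigroups with diagonal generator -/

section DiagonalSemigroup

variable {𝕜 V ι E : Type*} [RCLike 𝕜] [NormedAddCommGroup V] [NormedSpace 𝕜 V] [CompleteSpace V]
  [NormedSpace ℝ V] [IsScalarTower ℝ 𝕜 V] [SeminormedAddCommGroup E] [NormedSpace 𝕜 E]
  {G : E →ₗ.[𝕜] E} {M : ι → V →L[𝕜] V} (Φ : E ≃ₗᵢ[𝕜] lp (fun _ : ι => V) 2)

/-- The bound involves `‖M z‖` and `K` but not `‖M‖`, so it remains uniform over modes whose
generators are not uniformly bounded. -/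
theorem norm_linFlow_sub_le (M : V →L[𝕜] V) {K : ℝ} (hK : 0 ≤ K)
    (h : ∀ t, 0 ≤ t → ‖linFlow M t‖ ≤ Real.exp (K * t)) (z : V) {t : ℝ} (ht : 0 ≤ t) (ht1 : t ≤ 1) :
    ‖linFlow M t z - z‖ ≤ Real.exp K * ‖M z‖ * t := by
  have := (convex_Icc (0 : ℝ) t).norm_image_sub_le_of_norm_hasDerivWithin_le
    (f := fun t => linFlow M t z) (f' := fun s => M (linFlow M s z)) (C := Real.exp K * ‖M z‖)
    (x := 0) (y := t) (fun s _ => (hasDerivAt_linFlow M z s).hasDerivWithinAt) (fun s hs => ?_)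
    ⟨le_rfl, ht⟩ ⟨ht, le_rfl⟩
  · simpa [linFlow_zero, abs_of_nonneg ht] using this
  · rw [← linFlow_apply_gen]
    refine (linFlow M s).le_of_opNorm_le ((h s hs.1).trans ?_) _
    rw [Real.exp_le_exp]
    nlinarith [hs.2]

theorem tendsto_nnreal_coe_nhdsGT_zero :
    Tendsto (fun t : ℝ≥0 => (t : ℝ)) (𝓝[>] 0) (𝓝[≠] 0) := by
  refine tendsto_nhdsWithin_iff.2 ⟨?_, ?_⟩
  · exact (NNReal.continuous_coe.tendsto' 0 0 rfl).mono_left nhdsWithin_le_nhds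
  · filter_upwards [self_mem_nhdsWithin] with t ht
    exact (NNReal.coe_pos.2 ht).ne'

theorem tendsto_linFlow_quotient (M : V →L[𝕜] V) (z : V) :
    Tendsto (fun t : ℝ≥0 => (((t : ℝ)⁻¹ : ℝ) : 𝕜) • (linFlow M t z - z)) (𝓝[>] 0)
      (𝓝 (M z)) := by
  have h1 := hasDerivAt_iff_tendsto_slope_zero.1 (hasDerivAt_linFlow M z 0)
  have h2 := h1.comp tendsto_nnreal_coe_nhdsGT_zero
  simp only [linFlow_zero, one_apply_eq_self] at h2
  refine h2.congr fun t => ?_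
  simp only [Function.comp_apply, zero_add]
  exact (algebraMap_smul 𝕜 (t : ℝ)⁻¹ _).symm

/-- Fibrewise bounded flows on `ℓ²` form a strongly continuous semigroup, generated by the maximal
diagonal operator. -/
theorem exists_isSemigroupGeneratedBy
    (hG : ∀ z w, (z, w) ∈ G.graph ↔ ∀ i, Φ w i = M i (Φ z i)) {K : ℝ} (hK : 0 ≤ K)
    (h : ∀ i t, 0 ≤ t → ‖linFlow (M i) t‖ ≤ Real.exp (K * t)) :
    ∃ S : ℝ≥0 → E →L[𝕜] E, IsSemigroupGeneratedBy S G := by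
  let D : ℝ≥0 → lp (fun _ : ι => V) 2 →L[𝕜] lp (fun _ : ι => V) 2 := fun t =>
    lpDiag (fun i => linFlow (M i) t) (Real.exp (K * t)) (Real.exp_pos _).le fun i => h i t t.2
  have hD : ∀ t f i, D t f i = linFlow (M i) t (f i) := fun t f i => rfl
  obtain ⟨S, hS'⟩ : ∃ S : ℝ≥0 → E →L[𝕜] E, ∀ t z, S t z = Φ.symm (D t (Φ z)) :=
    ⟨fun t => (Φ.symm : lp (fun _ : ι => V) 2 →L[𝕜] E).comp
      ((D t).comp (Φ : E →L[𝕜] lp (fun _ : ι => V) 2)), fun _ _ => rfl⟩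
  have hS : ∀ t z i, Φ (S t z) i = linFlow (M i) t (Φ z i) := by
    intro t z i
    rw [hS', LinearIsometryEquiv.apply_symm_apply, hD]
  refine ⟨S, ?_, ?_, ?_, ?_⟩
  · ext z
    refine Φ.injective (lp.ext (funext fun i => ?_))
    rw [hS]
    simp [linFlow_zero]
  · intro s t
    ext z
    refine Φ.injective (lp.ext (funext fun i => ?_))
    rw [ContinuousLinearMap.comp_apply, hS, hS, hS, NNReal.coe_add, linFlow_add]
    rfl
  · intro z
    have h1 : Continuous fun t : ℝ≥0 => D t (Φ z) := by
      rw [continuous_iff_continuousAt]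
      intro t₀
      refine lp_two_tendsto (Φ z) (Real.exp (K * (t₀ + 1)) + Real.exp (K * t₀)) ?_ fun i => ?_
      · have : ∀ᶠ t : ℝ≥0 in 𝓝 t₀, t < t₀ + 1 := eventually_lt_nhds (by simp)
        filter_upwards [this] with t ht i
        rw [hD, hD, add_mul]
        refine (norm_sub_le _ _).trans (add_le_add ?_ ?_)
        · refine ContinuousLinearMap.le_of_opNorm_le _ ((h i t t.2).trans ?_) _
          rw [Real.exp_le_exp]
          refine mul_le_mul_of_nonneg_left ?_ hK
          exact_mod_cast ht.le
        · exact ContinuousLinearMap.le_of_opNorm_le _ (h i t₀ t₀.2) _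
      · simp only [hD]
        exact ((hasDerivAt_linFlow (M i) (Φ z i) t₀).continuousAt.tendsto).comp
          (NNReal.continuous_coe.tendsto t₀)
    exact (Φ.symm.continuous.comp h1).congr fun t => (hS' t z).symm
  · intro z w
    have hq : ∀ t : ℝ≥0, ∀ i, Φ ((((t : ℝ)⁻¹ : ℝ) : 𝕜) • (S t z - z)) i =
        (((t : ℝ)⁻¹ : ℝ) : 𝕜) • (linFlow (M i) t (Φ z i) - Φ z i) := by
      intro t i
      rw [map_smul, map_sub, lp.coeFn_smul, Pi.smul_apply, lp.coeFn_sub, Pi.sub_apply, hS]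
    have hev : ∀ i, Tendsto (fun t : ℝ≥0 => Φ ((((t : ℝ)⁻¹ : ℝ) : 𝕜) • (S t z - z)) i) (𝓝[>] 0)
        (𝓝 (M i (Φ z i))) := by
      intro i
      simp only [hq]
      exact tendsto_linFlow_quotient (M i) (Φ z i)
    rw [hG]
    constructor
    · intro hw
      have h1 : Tendsto (fun t : ℝ≥0 => Φ ((((t : ℝ)⁻¹ : ℝ) : 𝕜) • (S t z - z))) (𝓝[>] 0)
          (𝓝 (Φ w)) := by
        -- Since `M i (Φ z i) = Φ w i`, the difference quotients are dominated in `ℓ²` by a multiple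
        -- of `Φ w`.
        refine lp_two_tendsto (Φ w) (Real.exp K + 1) ?_ fun i => ?_
        · have h2 : ∀ᶠ t : ℝ≥0 in 𝓝[>] 0, t < 1 := nhdsWithin_le_nhds (eventually_lt_nhds one_pos)
          filter_upwards [h2, self_mem_nhdsWithin] with t ht ht0 i
          have ht0' : (0 : ℝ) < t := NNReal.coe_pos.2 ht0
          rw [hq, add_mul, one_mul]
          refine (norm_sub_le _ _).trans (add_le_add ?_ le_rfl)
          rw [norm_smul, RCLike.norm_ofReal, abs_of_pos (inv_pos.2 ht0'), inv_mul_le_iff₀ ht0', hw i,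
            mul_comm (t : ℝ)]
          exact norm_linFlow_sub_le (M i) hK (h i) _ t.2 (by exact_mod_cast ht.le)
        · rw [hw i]
          exact hev i
      have h3 := (Φ.symm.continuous.tendsto _).comp h1
      simpa [Function.comp_def] using h3
    · intro hw i
      have h1 := (Φ.continuous.tendsto w).comp hw
      have h2 := ((lp.evalCLM 𝕜 (fun _ : ι => V) 2 i).continuous.tendsto (Φ w)).comp h1
      exact tendsto_nhds_unique h2 (hev i)

/-- A semigroup with a diagonal generator acts by the flows of the diagonal entries. -/
theorem IsSemigroupGeneratedBy.apply_eq_linFlow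
    (hG : ∀ z w, (z, w) ∈ G.graph ↔ ∀ i, Φ w i = M i (Φ z i))
    {S : ℝ≥0 → E →L[𝕜] E} (hS : IsSemigroupGeneratedBy S G) (t : ℝ≥0) (z : E) (i : ι) :
    Φ (S t z) i = linFlow (M i) t (Φ z i) := by
  classical
  -- On the domain of `G`, each coordinate of a trajectory is right-differentiable and solves the
  -- equation of its entry, hence is the flow.
  have key : ∀ z w, (z, w) ∈ G.graph → Φ (S t z) i = linFlow (M i) t (Φ z i) := by
    intro z w hzw
    let f : ℝ → V := fun s => Φ (S s.toNNReal z) i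
    have hev : Continuous fun z : E => Φ z i :=
      (lp.evalCLM 𝕜 (fun _ : ι => V) 2 i).continuous.comp Φ.continuous
    have hfc : Continuous f := hev.comp ((hS.continuous z).comp continuous_real_toNNReal)
    have hgen : ∀ s : ℝ≥0, (S s z, S s w) ∈ G.graph := by
      intro s
      rw [hS.generator]
      have h1 := ((S s).continuous.tendsto w).comp ((hS.generator z w).1 hzw)
      refine h1.congr fun h => ?_
      simp only [Function.comp_apply]
      rw [map_smul, map_sub]
      have h2 : S s (S h z) = S h (S s z) := by
        rw [← ContinuousLinearMap.comp_apply, ← hS.add, add_comm, hS.add]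
        rfl
      rw [h2]
    have hder : ∀ s, 0 ≤ s → HasDerivWithinAt f (M i (f s)) (Set.Ici s) s := by
      intro s hs
      rw [← hasDerivWithinAt_Ioi_iff_Ici, hasDerivWithinAt_iff_tendsto_slope' Set.self_notMem_Ioi]
      have h1 := (hS.generator _ _).1 (hgen s.toNNReal)
      have h2 := ((hev.tendsto _).comp h1)
      have h3 : Tendsto (fun τ : ℝ => (τ - s).toNNReal) (𝓝[>] s) (𝓝[>] 0) := by
        refine tendsto_nhdsWithin_iff.2 ⟨?_, ?_⟩
        · have : Continuous fun τ : ℝ => (τ - s).toNNReal := by fun_prop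
          exact (this.tendsto' s 0 (by simp)).mono_left nhdsWithin_le_nhds
        · filter_upwards [self_mem_nhdsWithin] with τ hτ
          exact Real.toNNReal_pos.2 (sub_pos.2 hτ)
      have h4 := h2.comp h3
      have h5 : Φ (S s.toNNReal w) i = M i (f s) := (hG _ _).1 (hgen s.toNNReal) i
      rw [h5] at h4
      refine h4.congr' ?_
      filter_upwards [self_mem_nhdsWithin] with τ hτ
      have hτ' : s < τ := hτ
      have h6 : S (τ - s).toNNReal (S s.toNNReal z) = S τ.toNNReal z := by
        rw [← ContinuousLinearMap.comp_apply, ← hS.add, ← Real.toNNReal_add (sub_pos.2 hτ').le hs,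
          sub_add_cancel]
      simp only [Function.comp_apply, slope_def_module]
      rw [h6, Real.coe_toNNReal _ (sub_pos.2 hτ').le, map_smul, map_sub, lp.coeFn_smul,
        Pi.smul_apply, lp.coeFn_sub, Pi.sub_apply]
      exact algebraMap_smul 𝕜 (τ - s)⁻¹ _
    have := eq_linFlow_of_hasDerivWithinAt (M i) hfc hder t.2
    have h0 : f 0 = Φ z i := by
      simp only [f, Real.toNNReal_zero, hS.zero]
      rfl
    have h1 : f t = Φ (S t z) i := by
      simp only [f, Real.toNNReal_coe]
    rw [h0] at this
    exact h1.symm.trans this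
  let ev : lp (fun _ : ι => V) 2 →L[𝕜] V := lp.evalCLM 𝕜 (fun _ : ι => V) 2 i
  let L₁ : lp (fun _ : ι => V) 2 →L[𝕜] V :=
    (ev.comp (Φ : E →L[𝕜] lp (fun _ : ι => V) 2)).comp
      ((S t).comp (Φ.symm : lp (fun _ : ι => V) 2 →L[𝕜] E))
  let L₂ : lp (fun _ : ι => V) 2 →L[𝕜] V := (linFlow (M i) t).comp ev
  -- Vectors carried by a single coordinate lie in the domain of `G`, and they determine a bounded
  -- operator on `ℓ²`.
  have hL : L₁ = L₂ := by
    refine lp.ext_continuousLinearMap (by norm_num) fun j => ?_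
    ext a
    have hd : (Φ.symm (lp.single 2 j a), Φ.symm (lp.single 2 j (M j a))) ∈ G.graph := by
      rw [hG]
      intro k
      rw [LinearIsometryEquiv.apply_symm_apply, LinearIsometryEquiv.apply_symm_apply]
      by_cases hk : k = j
      · subst hk
        rw [lp.single_apply_self, lp.single_apply_self]
      · rw [lp.single_apply_ne _ _ _ hk, lp.single_apply_ne _ _ _ hk, map_zero]
    have := key _ _ hd
    rw [LinearIsometryEquiv.apply_symm_apply] at this
    exact this
  have := congrArg (fun L => L (Φ z)) hL
  have h2 : L₁ (Φ z) = Φ (S t (Φ.symm (Φ z))) i := rfl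
  have h3 : L₂ (Φ z) = linFlow (M i) t (Φ z i) := rfl
  rw [LinearIsometryEquiv.symm_apply_apply] at h2
  rw [← h2, ← h3]
  exact this

variable {S : ℝ≥0 → E →L[𝕜] E}

omit [CompleteSpace V] [NormedSpace ℝ V] [IsScalarTower ℝ 𝕜 V] in
theorem norm_le_of_linFlow_le (hS : ∀ t z i, Φ (S t z) i = linFlow (M i) t (Φ z i)) {t : ℝ≥0}
    {C : ℝ} (hC : 0 ≤ C) (h : ∀ i, ‖linFlow (M i) t‖ ≤ C) : ‖S t‖ ≤ C := by
  refine ContinuousLinearMap.opNorm_le_bound _ hC fun z => ?_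
  rw [← Φ.norm_map, ← Φ.norm_map z]
  refine lp_two_norm_le hC fun i => ?_
  rw [hS]
  exact ContinuousLinearMap.le_of_opNorm_le _ (h i) _

omit [CompleteSpace V] [NormedSpace ℝ V] [IsScalarTower ℝ 𝕜 V] in
theorem exists_norm_eq_linFlow (hS : ∀ t z i, Φ (S t z) i = linFlow (M i) t (Φ z i)) (i : ι)
    (a : V) : ∃ z : E, ‖z‖ = ‖a‖ ∧ ∀ t, ‖S t z‖ = ‖linFlow (M i) t a‖ := by
  classical
  refine ⟨Φ.symm (lp.single 2 i a), ?_, fun t => ?_⟩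
  · rw [LinearIsometryEquiv.norm_map, lp.norm_single (by norm_num)]
  · have h1 : Φ (S t (Φ.symm (lp.single 2 i a))) = lp.single 2 i (linFlow (M i) t a) := by
      refine lp.ext (funext fun j => ?_)
      rw [hS, LinearIsometryEquiv.apply_symm_apply]
      by_cases hj : j = i
      · subst hj
        rw [lp.single_apply_self, lp.single_apply_self]
      · rw [lp.single_apply_ne _ _ _ hj, lp.single_apply_ne _ _ _ hj, map_zero]
    rw [← Φ.norm_map, h1, lp.norm_single (by norm_num)]

omit [CompleteSpace V] [NormedSpace ℝ V] [IsScalarTower ℝ 𝕜 V] in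
theorem norm_linFlow_le (hS : ∀ t z i, Φ (S t z) i = linFlow (M i) t (Φ z i)) (i : ι) (t : ℝ≥0) :
    ‖linFlow (M i) t‖ ≤ ‖S t‖ := by
  refine ContinuousLinearMap.opNorm_le_bound _ (norm_nonneg _) fun a => ?_
  obtain ⟨z, hz, hz'⟩ := exists_norm_eq_linFlow Φ hS i a
  rw [← hz', ← hz]
  exact (S t).le_opNorm z

end DiagonalSemigroup

/-! ### Differential inequalities -/

section Comparison

theorem le_mul_exp_of_deriv_le {F F' : ℝ → ℝ} {k : ℝ} (hF : ∀ t, HasDerivAt F (F' t) t)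
    (h : ∀ t, F' t ≤ k * F t) {T : ℝ} (hT : 0 ≤ T) : F T ≤ F 0 * Real.exp (k * T) := by
  have hd : ∀ t, HasDerivAt (fun t => F t * Real.exp (-(k * t)))
      (F' t * Real.exp (-(k * t)) + F t * (Real.exp (-(k * t)) * (-(k * 1)))) t := fun t =>
    (hF t).mul (((hasDerivAt_id t).const_mul k).neg.exp)
  have hanti : Antitone fun t => F t * Real.exp (-(k * t)) := by
    refine antitone_of_deriv_nonpos (fun t => (hd t).differentiableAt) fun t => ?_
    rw [(hd t).deriv]
    have := h t
    have := Real.exp_pos (-(k * t))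
    nlinarith
  have h1 := hanti hT
  simp only [mul_zero, neg_zero, Real.exp_zero, mul_one] at h1
  rw [Real.exp_neg] at h1
  rwa [← div_eq_mul_inv, div_le_iff₀ (Real.exp_pos _)] at h1

/-- Formally `(√F)' ≤ C`. As the root is not differentiable at zeros of `F`, the argument runs on
`√(F + δ²)` with `δ` arbitrarily small. -/
theorem sqrt_le_of_deriv_le {F F' : ℝ → ℝ} {C T : ℝ} (hF : ∀ t, HasDerivAt F (F' t) t)
    (h0 : ∀ t, 0 ≤ F t) (hC : 0 ≤ C) (hT : 0 ≤ T)
    (h : ∀ t, 0 ≤ t → t ≤ T → F' t ≤ 2 * C * √(F t)) : √(F T) ≤ √(F 0) + C * T := by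
  refine le_of_forall_pos_le_add fun δ hδ => ?_
  have hpos : ∀ t, 0 < F t + δ ^ 2 := fun t => by have := h0 t; positivity
  have hd : ∀ t, HasDerivAt (fun t => √(F t + δ ^ 2) - C * t)
      (F' t / (2 * √(F t + δ ^ 2)) - C * 1) t := fun t =>
    (((hF t).add_const _).sqrt (hpos t).ne').sub ((hasDerivAt_id t).const_mul C)
  have hanti : AntitoneOn (fun t => √(F t + δ ^ 2) - C * t) (Set.Icc 0 T) := by
    refine antitoneOn_of_deriv_nonpos (convex_Icc _ _)
      (fun t _ => (hd t).continuousAt.continuousWithinAt)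
      (fun t _ => (hd t).differentiableAt.differentiableWithinAt) fun t ht => ?_
    rw [interior_Icc] at ht
    rw [(hd t).deriv, mul_one, sub_nonpos, div_le_iff₀ (by have := hpos t; positivity)]
    refine (h t ht.1.le ht.2.le).trans ?_
    have : √(F t) ≤ √(F t + δ ^ 2) := Real.sqrt_le_sqrt (by nlinarith)
    nlinarith
  have h1 := hanti ⟨le_rfl, hT⟩ ⟨hT, le_rfl⟩ hT
  simp only [mul_zero, sub_zero] at h1
  have h2 : √(F T) ≤ √(F T + δ ^ 2) := Real.sqrt_le_sqrt (by nlinarith)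
  have h3 : √(F 0 + δ ^ 2) ≤ √(F 0) + δ := by
    refine Real.sqrt_le_iff.2 ⟨by positivity, ?_⟩
    nlinarith [Real.sq_sqrt (h0 0), mul_nonneg (Real.sqrt_nonneg (F 0)) hδ.le]
  linarith

theorem abs_le_of_deriv_le {f f' : ℝ → ℝ} {C T : ℝ} (hf : ∀ t, HasDerivAt f (f' t) t)
    (hT : 0 ≤ T) (h : ∀ t, 0 ≤ t → t ≤ T → |f' t| ≤ C) : |f T| ≤ |f 0| + C * T := by
  have := (convex_Icc (0 : ℝ) T).norm_image_sub_le_of_norm_hasDerivWithin_le (f := f) (f' := f')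
    (C := C) (x := 0) (y := T) (fun s _ => (hf s).hasDerivWithinAt) (fun s hs => h s hs.1 hs.2)
    ⟨le_rfl, hT⟩ ⟨hT, le_rfl⟩
  rw [Real.norm_eq_abs, Real.norm_eq_abs, sub_zero, abs_of_nonneg hT] at this
  have h2 := abs_sub_abs_le_abs_sub (f T) (f 0)
  linarith

end Comparison

/-! ### Lyapunov forms, uniform in the frequency -/

section Energy

/-- `(u, x, v, y)` solves `u'' + μ² u + u' = b v'`, `v'' + μ² v - ε v' = -b u'` with `x = u'`,
`y = v'`. -/
structure IsModeSol {F : Type*} [NormedAddCommGroup F] [NormedSpace ℝ F] (ε b μ : ℝ)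
    (u x v y : ℝ → F) : Prop where
  du : ∀ t, HasDerivAt u (x t) t
  dx : ∀ t, HasDerivAt x (-(μ ^ 2 • u t) - x t + b • y t) t
  dv : ∀ t, HasDerivAt v (y t) t
  dy : ∀ t, HasDerivAt y (-(μ ^ 2 • v t) + ε • y t - b • x t) t

/-- The energy of a mode. -/
def modeEnergy {F : Type*} [NormedAddCommGroup F] (μ : ℝ) (u x v y : ℝ → F) (t : ℝ) : ℝ :=
  μ ^ 2 * ‖u t‖ ^ 2 + ‖x t‖ ^ 2 + μ ^ 2 * ‖v t‖ ^ 2 + ‖y t‖ ^ 2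

theorem modeEnergy_real (μ : ℝ) (u x v y : ℝ → ℝ) (t : ℝ) :
    modeEnergy μ u x v y t = μ ^ 2 * u t ^ 2 + x t ^ 2 + μ ^ 2 * v t ^ 2 + y t ^ 2 := by
  simp [modeEnergy]

theorem modeEnergy_nonneg {F : Type*} [NormedAddCommGroup F] (μ : ℝ) (u x v y : ℝ → F) (t : ℝ) :
    0 ≤ modeEnergy μ u x v y t := by
  unfold modeEnergy
  positivity

/-- The energy norm of the solutions at frequencies at least `μ₁` grows at most by `g t`. -/
def EnergyBound (ε b μ₁ : ℝ) (g : ℝ → ℝ) : Prop :=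
  ∀ μ, μ₁ ≤ μ → ∀ u x v y : ℝ → ℝ, IsModeSol ε b μ u x v y → ∀ t, 0 ≤ t →
    modeEnergy μ u x v y t ≤ g t ^ 2 * modeEnergy μ u x v y 0

/-- The coupling `b` is skew and does no work, so energy enters only through `ε y²`. This crude
bound suffices to generate the semigroup and to keep the set defining `growthBound` nonempty. -/
theorem energyBound_exp {ε : ℝ} (hε : 0 ≤ ε) (b μ₁ : ℝ) :
    EnergyBound ε b μ₁ fun t => Real.exp (ε * t) := by
  intro μ _ u x v y hs t ht
  have hd : ∀ t, HasDerivAt (modeEnergy μ u x v y) (-2 * x t ^ 2 + 2 * ε * y t ^ 2) t := by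
    intro t
    rw [funext (modeEnergy_real μ u x v y)]
    have := ((((hs.du t).pow 2).const_mul (μ ^ 2)).add ((hs.dx t).pow 2)).add
      (((hs.dv t).pow 2).const_mul (μ ^ 2)) |>.add ((hs.dy t).pow 2)
    refine this.congr_deriv ?_
    simp only [smul_eq_mul]
    ring
  have := le_mul_exp_of_deriv_le (k := 2 * ε) hd (fun t => ?_) ht
  · rw [← Real.exp_nat_mul, mul_comm]
    convert this using 3
    push_cast
    ring
  · rw [modeEnergy_real]
    nlinarith [mul_nonneg hε (sq_nonneg (x t)), sq_nonneg (x t),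
      mul_nonneg hε (mul_nonneg (sq_nonneg μ) (sq_nonneg (u t))),
      mul_nonneg hε (mul_nonneg (sq_nonneg μ) (sq_nonneg (v t)))]

/-- The quadratic form with matrix `(α, β; β, γ)`. -/
def quad (α β γ x y : ℝ) : ℝ := α * x ^ 2 + 2 * β * (x * y) + γ * y ^ 2

/-- For a positive definite matrix, the trace bounds the larger eigenvalue from above, hence
determinant over trace bounds the smaller one from below. -/
theorem exists_quad_bounds {α β γ : ℝ} (hα : 0 < α) (hdet : β ^ 2 < α * γ) :
    ∃ c C : ℝ, 0 < c ∧ 0 < C ∧ ∀ x y, c * (x ^ 2 + y ^ 2) ≤ quad α β γ x y ∧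
      quad α β γ x y ≤ C * (x ^ 2 + y ^ 2) := by
  have hγ : 0 < γ := by
    by_contra h
    nlinarith [sq_nonneg β]
  have hs : 0 < α + γ := by linarith
  have hc : 0 < (α * γ - β ^ 2) / (α + γ) := div_pos (by linarith) hs
  set c := (α * γ - β ^ 2) / (α + γ) with hcdef
  have hc2 : c * (α + γ) = α * γ - β ^ 2 := div_mul_cancel₀ _ hs.ne'
  refine ⟨c, α + γ, hc, hs, fun x y => ⟨?_, ?_⟩⟩
  · have hαc : 0 < α - c := by
      rw [sub_pos, hcdef, div_lt_iff₀ hs]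
      nlinarith [sq_nonneg β, sq_nonneg α]
    have key : 0 ≤ (α - c) * (quad α β γ x y - c * (x ^ 2 + y ^ 2)) := by
      have : (α - c) * (quad α β γ x y - c * (x ^ 2 + y ^ 2)) =
          ((α - c) * x + β * y) ^ 2 + c ^ 2 * y ^ 2 := by
        unfold quad
        linear_combination (-y ^ 2) * hc2
      rw [this]
      positivity
    have := nonneg_of_mul_nonneg_right key hαc
    linarith
  · have h1 : 0 ≤ γ * (γ * x ^ 2 - 2 * β * (x * y) + α * y ^ 2) := by
      have : γ * (γ * x ^ 2 - 2 * β * (x * y) + α * y ^ 2) =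
          (γ * x - β * y) ^ 2 + (α * γ - β ^ 2) * y ^ 2 := by ring
      rw [this]
      have : 0 ≤ α * γ - β ^ 2 := by linarith
      positivity
    have := nonneg_of_mul_nonneg_right h1 hγ
    unfold quad
    nlinarith

/-- Using one form for positions and velocities makes the `μ²` terms cancel; what remains is twice
`⟨P X', N X'⟩`, free of `μ`. -/
theorem IsModeSol.hasDerivAt_quad {ε b μ : ℝ} {u x v y : ℝ → ℝ} (hs : IsModeSol ε b μ u x v y)
    (α β γ t : ℝ) :
    HasDerivAt (fun t => quad α β γ (x t) (y t) + μ ^ 2 * quad α β γ (u t) (v t))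
      (2 * ((α * x t + β * y t) * (-x t + b * y t) + (β * x t + γ * y t) * (-b * x t + ε * y t)))
      t := by
  unfold quad
  have h1 := ((((hs.dx t).pow 2).const_mul α).add
    (((hs.dx t).mul (hs.dy t)).const_mul (2 * β))).add (((hs.dy t).pow 2).const_mul γ)
  have h2 := ((((hs.du t).pow 2).const_mul α).add
    (((hs.du t).mul (hs.dv t)).const_mul (2 * β))).add (((hs.dv t).pow 2).const_mul γ)
  refine (h1.add (h2.const_mul (μ ^ 2))).congr_deriv ?_
  simp only [smul_eq_mul]
  ring

theorem exists_energyBound_const {ε b α β γ : ℝ} (hα : 0 < α) (hdet : β ^ 2 < α * γ)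
    (hneg : ∀ x y, (α * x + β * y) * (-x + b * y) + (β * x + γ * y) * (-b * x + ε * y) ≤ 0)
    (μ₁ : ℝ) : ∃ C, 0 ≤ C ∧ EnergyBound ε b μ₁ fun _ => C := by
  obtain ⟨c, C, hc, hC, hq⟩ := exists_quad_bounds hα hdet
  refine ⟨√(C / c), Real.sqrt_nonneg _, ?_⟩
  intro μ _ u x v y hs t ht
  simp only
  rw [Real.sq_sqrt (by positivity), div_mul_eq_mul_div, le_div_iff₀ hc]
  have h1 := le_mul_exp_of_deriv_le (k := 0) (hs.hasDerivAt_quad α β γ)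
    (fun t => by rw [zero_mul]; linarith [hneg (x t) (y t)]) ht
  rw [zero_mul, Real.exp_zero, mul_one] at h1
  have h2 := (hq (x t) (y t)).1
  have h3 := (hq (u t) (v t)).1
  have h4 := (hq (x 0) (y 0)).2
  have h5 := (hq (u 0) (v 0)).2
  have h6 := mul_le_mul_of_nonneg_left h3 (sq_nonneg μ)
  have h7 := mul_le_mul_of_nonneg_left h5 (sq_nonneg μ)
  rw [modeEnergy_real, modeEnergy_real]
  nlinarith

/-- Young's inequality for the form: expand it at `s (p, q) - (r, w)` and divide by `s`. -/
theorem two_mul_polar_le {α β γ s : ℝ} (hqn : ∀ x y, 0 ≤ quad α β γ x y) (p q r w : ℝ)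
    (hs : 0 < s) : 2 * ((α * p + β * q) * r + (β * p + γ * q) * w) ≤
      s * quad α β γ p q + quad α β γ r w / s := by
  have h1 := hqn (s * p - r) (s * q - w)
  have h2 : quad α β γ (s * p - r) (s * q - w) = s * (s * quad α β γ p q -
      2 * ((α * p + β * q) * r + (β * p + γ * q) * w) + quad α β γ r w / s) := by
    unfold quad
    field_simp
    ring
  rw [h2] at h1
  have := nonneg_of_mul_nonneg_right h1 hs
  linarith

theorem coupling_sq_le (ε b x y : ℝ) : (-x + b * y) ^ 2 + (-b * x + ε * y) ^ 2 ≤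
    (2 * (1 + b ^ 2) + 2 * (b ^ 2 + ε ^ 2)) * (x ^ 2 + y ^ 2) := by
  nlinarith [sq_nonneg (x + b * y), sq_nonneg (b * x + ε * y), sq_nonneg x,
    sq_nonneg y, sq_nonneg (ε * x), sq_nonneg (b * x), sq_nonneg (b * y), sq_nonneg (ε * y)]

/-- Uniform exponential decay from a strict Lyapunov form. -/
theorem exists_energyBound_decay {ε b α β γ d : ℝ} (hα : 0 < α) (hdet : β ^ 2 < α * γ)
    (hd : 0 < d)
    (hneg : ∀ x y, (α * x + β * y) * (-x + b * y) + (β * x + γ * y) * (-b * x + ε * y) ≤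
      -d * (x ^ 2 + y ^ 2))
    {μ₁ : ℝ} (hμ₁ : 0 < μ₁) :
    ∃ C a, 0 ≤ C ∧ 0 < a ∧ EnergyBound ε b μ₁ fun t => C * Real.exp (-(a * t)) := by
  obtain ⟨c, C, hc, hC, hq⟩ := exists_quad_bounds hα hdet
  have hqn : ∀ x y, 0 ≤ quad α β γ x y := fun x y =>
    le_trans (by positivity) (hq x y).1
  set K₀ : ℝ := 2 * (1 + b ^ 2) + 2 * (b ^ 2 + ε ^ 2) with hK₀
  have hK₀p : 0 < K₀ := by rw [hK₀]; positivity
  set K₁ : ℝ := C + C * K₀ / (2 * μ₁ ^ 2) with hK₁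
  have hK₁p : 0 < K₁ := by rw [hK₁]; positivity
  -- `κ ≤ μ₁` gives `κ |B| ≤ E / 2`; `κ K₁ ≤ d` lets the dissipation absorb the velocity terms of `κ
  -- B'`.
  obtain ⟨κ, hκ, hκ1, hκ2⟩ : ∃ κ : ℝ, 0 < κ ∧ κ ≤ μ₁ ∧ κ * K₁ ≤ d :=
    ⟨min μ₁ (d / K₁), lt_min hμ₁ (by positivity), min_le_left _ _,
      (mul_le_mul_of_nonneg_right (min_le_right _ _) hK₁p.le).trans
        (div_mul_cancel₀ _ hK₁p.ne').le⟩
  -- These bounds give `(E + κ B)' ≤ -a E`. With `E + κ B ≤ 3 E / 2` the energy decays at rate `2 a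
  -- / 3`, its square root at `a / 3`.
  obtain ⟨a, ha, ha1, ha2⟩ : ∃ a : ℝ, 0 < a ∧ a * C ≤ d ∧ a ≤ κ / 2 :=
    ⟨min (d / C) (κ / 2), lt_min (by positivity) (by positivity),
      (mul_le_mul_of_nonneg_right (min_le_left _ _) hC.le).trans (div_mul_cancel₀ _ hC.ne').le,
      min_le_right _ _⟩
  refine ⟨√(3 * C / c), a / 3, Real.sqrt_nonneg _, by positivity, ?_⟩
  intro μ hμ u x v y hs t ht
  have hμp : 0 < μ := hμ₁.trans_le hμ
  have hμsq : μ₁ ^ 2 ≤ μ ^ 2 := pow_le_pow_left₀ hμ₁.le hμ 2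
  -- `E` dissipates velocities only; the derivative of `B` contains `-μ² P(u, v)` and supplies the
  -- missing dissipation of positions.
  let B : ℝ → ℝ := fun t => (α * u t + β * v t) * x t + (β * u t + γ * v t) * y t
  let E : ℝ → ℝ := fun t => quad α β γ (x t) (y t) + μ ^ 2 * quad α β γ (u t) (v t)
  have hE : ∀ t, HasDerivAt E _ t := hs.hasDerivAt_quad α β γ
  have hB : ∀ t, HasDerivAt B (quad α β γ (x t) (y t) +
      ((α * u t + β * v t) * (-x t + b * y t) + (β * u t + γ * v t) * (-b * x t + ε * y t)) -
      μ ^ 2 * quad α β γ (u t) (v t)) t := by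
    intro t
    have h1 := ((((hs.du t).const_mul α).add ((hs.dv t).const_mul β)).mul (hs.dx t)).add
      ((((hs.du t).const_mul β).add ((hs.dv t).const_mul γ)).mul (hs.dy t))
    refine h1.congr_deriv ?_
    unfold quad
    simp only [smul_eq_mul, Pi.add_apply]
    ring
  have hcs := fun s p q r w hs => two_mul_polar_le (s := s) hqn p q r w hs
  have hBle : ∀ t, κ * |B t| ≤ E t / 2 := by
    intro t
    have h1 := hcs μ₁ (u t) (v t) (x t) (y t) hμ₁
    have h2 := hcs μ₁ (-u t) (-v t) (x t) (y t) hμ₁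
    have h3 : quad α β γ (-u t) (-v t) = quad α β γ (u t) (v t) := by unfold quad; ring
    rw [h3] at h2
    have h4 : 2 * |B t| ≤ μ₁ * quad α β γ (u t) (v t) + quad α β γ (x t) (y t) / μ₁ := by
      rcases abs_cases (B t) with ⟨h, _⟩ | ⟨h, _⟩ <;> rw [h] <;> simp only [B] <;> linarith
    have h5 : κ * (μ₁ * quad α β γ (u t) (v t) + quad α β γ (x t) (y t) / μ₁) ≤ E t := by
      have h6 : κ * (μ₁ * quad α β γ (u t) (v t)) ≤ μ ^ 2 * quad α β γ (u t) (v t) := by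
        rw [← mul_assoc]
        refine mul_le_mul_of_nonneg_right ?_ (hqn _ _)
        nlinarith
      have h7 : κ * (quad α β γ (x t) (y t) / μ₁) ≤ quad α β γ (x t) (y t) := by
        rw [mul_div_assoc', div_le_iff₀ hμ₁, mul_comm]
        exact mul_le_mul_of_nonneg_left hκ1 (hqn _ _)
      simp only [E]
      linarith
    linarith [mul_le_mul_of_nonneg_left h4 hκ.le]
  have hEn : ∀ t, 0 ≤ E t := fun t => by
    have := hqn (x t) (y t); have := hqn (u t) (v t); simp only [E]; positivity
  have hL := le_mul_exp_of_deriv_le (F := fun t => E t + κ * B t) (k := -(2 * a / 3))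
    (fun t => (hE t).add ((hB t).const_mul κ)) (fun t => ?_) ht
  · have h1 := hBle t
    have h2 := hBle 0
    have h3 := le_abs_self (B 0)
    have h4 := neg_abs_le (B t)
    have h5 : E t ≤ 3 * E 0 * Real.exp (-(2 * a / 3) * t) := by
      have h6 : (E 0 + κ * B 0) ≤ 3 / 2 * E 0 := by
        linarith [mul_le_mul_of_nonneg_left h3 hκ.le]
      have h7 := mul_le_mul_of_nonneg_right h6 (Real.exp_pos (-(2 * a / 3) * t)).le
      have h8 : E t / 2 ≤ E t + κ * B t := by
        linarith [mul_le_mul_of_nonneg_left h4 hκ.le]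
      linarith
    have h6 : (√(3 * C / c) * Real.exp (-(a / 3 * t))) ^ 2 =
        3 * C / c * Real.exp (-(2 * a / 3) * t) := by
      rw [mul_pow, Real.sq_sqrt (by positivity), ← Real.exp_nat_mul]
      congr 2
      push_cast
      ring
    rw [h6]
    have h7 : c * modeEnergy μ u x v y t ≤ E t := by
      have h8 := (hq (x t) (y t)).1
      have h9 := mul_le_mul_of_nonneg_left (hq (u t) (v t)).1 (sq_nonneg μ)
      rw [modeEnergy_real]
      simp only [E]
      linarith
    have h10 : E 0 ≤ C * modeEnergy μ u x v y 0 := by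
      have h8 := (hq (x 0) (y 0)).2
      have h9 := mul_le_mul_of_nonneg_left (hq (u 0) (v 0)).2 (sq_nonneg μ)
      rw [modeEnergy_real]
      simp only [E]
      linarith
    have h11 : 3 * C / c * Real.exp (-(2 * a / 3) * t) * modeEnergy μ u x v y 0 =
        3 * (C * modeEnergy μ u x v y 0) * Real.exp (-(2 * a / 3) * t) / c := by ring
    rw [h11, le_div_iff₀ hc, mul_comm _ c]
    refine h7.trans (h5.trans ?_)
    gcongr
  · have h1 := hneg (x t) (y t)
    have h2 := hcs (μ₁ ^ 2) (u t) (v t) (-x t + b * y t) (-b * x t + ε * y t) (by positivity)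
    have h3 : quad α β γ (-x t + b * y t) (-b * x t + ε * y t) ≤
        C * (K₀ * (x t ^ 2 + y t ^ 2)) := by
      refine (hq _ _).2.trans (mul_le_mul_of_nonneg_left ?_ hC.le)
      exact coupling_sq_le ε b (x t) (y t)
    have h4 := (hq (x t) (y t)).2
    have h5 : quad α β γ (-x t + b * y t) (-b * x t + ε * y t) / μ₁ ^ 2 ≤
        C * (K₀ * (x t ^ 2 + y t ^ 2)) / μ₁ ^ 2 := by gcongr
    have h6 : μ₁ ^ 2 * quad α β γ (u t) (v t) ≤ μ ^ 2 * quad α β γ (u t) (v t) :=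
      mul_le_mul_of_nonneg_right hμsq (hqn _ _)
    have h7 : C * (K₀ * (x t ^ 2 + y t ^ 2)) / μ₁ ^ 2 =
        2 * ((K₁ - C) * (x t ^ 2 + y t ^ 2)) := by
      rw [hK₁]
      field_simp
      ring
    rw [h7] at h5
    have h8 : quad α β γ (x t) (y t) + ((α * u t + β * v t) * (-x t + b * y t) +
        (β * u t + γ * v t) * (-b * x t + ε * y t)) - μ ^ 2 * quad α β γ (u t) (v t) ≤
        K₁ * (x t ^ 2 + y t ^ 2) - μ ^ 2 * quad α β γ (u t) (v t) / 2 := by linarith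
    have h9 := mul_le_mul_of_nonneg_left h8 hκ.le
    have h10 := mul_le_mul_of_nonneg_right hκ2 (by positivity : 0 ≤ x t ^ 2 + y t ^ 2)
    have h11 : a * E t ≤ d * (x t ^ 2 + y t ^ 2) + κ / 2 * (μ ^ 2 * quad α β γ (u t) (v t)) := by
      have h12 : a * quad α β γ (x t) (y t) ≤ d * (x t ^ 2 + y t ^ 2) := by
        calc a * quad α β γ (x t) (y t) ≤ a * (C * (x t ^ 2 + y t ^ 2)) := by gcongr
          _ = a * C * (x t ^ 2 + y t ^ 2) := by ring
          _ ≤ _ := by gcongr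
      have h13 : a * (μ ^ 2 * quad α β γ (u t) (v t)) ≤
          κ / 2 * (μ ^ 2 * quad α β γ (u t) (v t)) := by
        have := hqn (u t) (v t)
        gcongr
      simp only [E]
      linarith
    have h14 : E t + κ * B t ≤ 3 / 2 * E t := by
      have h1 := hBle t
      linarith [mul_le_mul_of_nonneg_left (le_abs_self (B t)) hκ.le]
    have h15 := mul_le_mul_of_nonneg_left h14 ha.le
    linarith

end Energy

/-! ### Growth at the critical coupling `b = (1 + ε) / 2` -/

section Critical

/-- The system `η'' + d η' + κ η = 0`, `ζ'' + d ζ' + κ ζ = b (η' - r η)` in first-order form. -/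
structure IsForcedSol (d κ b r : ℝ) (η h ζ k : ℝ → ℝ) : Prop where
  dη : ∀ t, HasDerivAt η (h t) t
  dh : ∀ t, HasDerivAt h (-(d * h t) - κ * η t) t
  dζ : ∀ t, HasDerivAt ζ (k t) t
  dk : ∀ t, HasDerivAt k (-(d * k t) - κ * ζ t + b * (h t - r * η t)) t

theorem abs_le_sqrt_energy {κ h η : ℝ} (hκ : 0 ≤ κ) : |h| ≤ √(h ^ 2 + κ * η ^ 2) :=
  Real.abs_le_sqrt (by nlinarith [mul_nonneg hκ (sq_nonneg η)])

/-- The derivative of `k² + κ ζ²` is `-2 d k² + 2 f k`; the damping only helps, and `|k|` is at most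
the root of the energy. -/
theorem forced_energy_le {d κ C T : ℝ} {ζ k f : ℝ → ℝ} (hd : 0 ≤ d) (hκ : 0 ≤ κ) (hC : 0 ≤ C)
    (dζ : ∀ t, HasDerivAt ζ (k t) t)
    (dk : ∀ t, HasDerivAt k (-(d * k t) - κ * ζ t + f t) t)
    (hT : 0 ≤ T) (hf : ∀ t, 0 ≤ t → t ≤ T → |f t| ≤ C) :
    √(k T ^ 2 + κ * ζ T ^ 2) ≤ √(k 0 ^ 2 + κ * ζ 0 ^ 2) + C * T := by
  refine sqrt_le_of_deriv_le (F := fun t => k t ^ 2 + κ * ζ t ^ 2)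
    (F' := fun t => -2 * d * k t ^ 2 + 2 * (f t * k t)) (fun t => ?_) (fun t => by positivity)
    hC hT fun t h0 h1 => ?_
  · refine (((dk t).pow 2).add (((dζ t).pow 2).const_mul κ)).congr_deriv ?_
    ring
  · have h2 : f t * k t ≤ C * √(k t ^ 2 + κ * ζ t ^ 2) := by
      refine (le_abs_self _).trans ?_
      rw [abs_mul]
      exact mul_le_mul (hf t h0 h1) (abs_le_sqrt_energy hκ) (abs_nonneg _) hC
    have h3 := mul_nonneg hd (sq_nonneg (k t))
    linarith

/-- The quantities of a forced system controlled by its growth. -/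
structure ForcedBound (κ s : ℝ) (η h ζ k : ℝ) : Prop where
  eη : √(h ^ 2 + κ * η ^ 2) ≤ s
  eζ : √(k ^ 2 + κ * ζ ^ 2) ≤ s
  aη : |η| ≤ s
  aζ : |ζ| ≤ s

/-- Since `κ` may vanish, the energy controls velocities only. Thus `h` is bounded, `η` and the
forcing grow linearly, `k` quadratically and `ζ` cubically, with a constant independent of `κ`. -/
theorem IsForcedSol.bound_cubic {d κ b r q : ℝ} {η h ζ k : ℝ → ℝ} (hs : IsForcedSol d κ b r η h ζ k)
    (hd : 0 ≤ d) (hκ : 0 ≤ κ) (h0 : ForcedBound κ q (η 0) (h 0) (ζ 0) (k 0)) {T : ℝ} (hT : 0 ≤ T) :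
    ForcedBound κ ((2 + |b| * (1 + |r|)) * (1 + T) ^ 3 * q) (η T) (h T) (ζ T) (k T) := by
  have hq : 0 ≤ q := (abs_nonneg _).trans h0.aη
  set B := |b| * (1 + |r|) with hB
  have hBn : 0 ≤ B := by positivity
  have e1 : ∀ t, 0 ≤ t → √(h t ^ 2 + κ * η t ^ 2) ≤ q := by
    intro t ht
    have := forced_energy_le (f := fun _ => 0) (C := 0) hd hκ le_rfl hs.dη
      (fun t => by simpa using hs.dh t) ht (fun t _ _ => by simp)
    linarith [h0.eη]
  have a1 : ∀ t, 0 ≤ t → |η t| ≤ q * (1 + t) := by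
    intro t ht
    have := abs_le_of_deriv_le hs.dη ht fun s hs0 _ => (abs_le_sqrt_energy hκ).trans (e1 s hs0)
    linarith [h0.aη]
  have f1 : ∀ T, 0 ≤ T → ∀ t, 0 ≤ t → t ≤ T → |b * (h t - r * η t)| ≤ B * (q * (1 + T)) := by
    intro T hT t h0 h1
    rw [abs_mul, hB, mul_assoc]
    refine mul_le_mul_of_nonneg_left ?_ (abs_nonneg _)
    have h2 : |h t| ≤ q := (abs_le_sqrt_energy hκ).trans (e1 t h0)
    have h3 : |η t| ≤ q * (1 + T) := (a1 t h0).trans (by gcongr)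
    calc |h t - r * η t| ≤ |h t| + |r| * |η t| := by
          rw [← abs_mul]; exact abs_sub _ _
      _ ≤ q * (1 + T) + |r| * (q * (1 + T)) := by
          have : q ≤ q * (1 + T) := by nlinarith
          gcongr
          linarith
      _ = _ := by ring
  have e2 : ∀ T, 0 ≤ T → √(k T ^ 2 + κ * ζ T ^ 2) ≤ q + B * (q * (1 + T)) * T := by
    intro T hT
    have := forced_energy_le hd hκ (by positivity) hs.dζ hs.dk hT (f1 T hT)
    linarith [h0.eζ]
  have a2 : |ζ T| ≤ q + (q + B * (q * (1 + T)) * T) * T := by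
    have := abs_le_of_deriv_le (C := q + B * (q * (1 + T)) * T) hs.dζ hT fun s hs0 hsT =>
      (abs_le_sqrt_energy hκ).trans ((e2 s hs0).trans (by gcongr))
    linarith [h0.aζ]
  have hqB : 0 ≤ q * B := by positivity
  have p1 : 0 ≤ T * T := by positivity
  have p2 : 0 ≤ T * T * T := by positivity
  have i1 : q ≤ (2 + B) * (1 + T) ^ 3 * q := by
    have : 1 ≤ (2 + B) * (1 + T) ^ 3 := by
      have : (1 : ℝ) ≤ (1 + T) ^ 3 := one_le_pow₀ (by linarith)
      nlinarith
    nlinarith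
  have i2 : q * (1 + T) ≤ (2 + B) * (1 + T) ^ 3 * q := by
    have h1 : (1 : ℝ) ≤ (1 + T) ^ 2 := one_le_pow₀ (by linarith)
    have h2 : 1 + T ≤ (2 + B) * (1 + T) ^ 3 := by
      have : 1 ≤ (2 + B) * (1 + T) ^ 2 := by nlinarith
      calc 1 + T = 1 * (1 + T) := by ring
        _ ≤ ((2 + B) * (1 + T) ^ 2) * (1 + T) := by gcongr
        _ = _ := by ring
    calc q * (1 + T) ≤ q * ((2 + B) * (1 + T) ^ 3) := by gcongr
      _ = _ := by ring
  have i3 : q + B * (q * (1 + T)) * T ≤ (2 + B) * (1 + T) ^ 3 * q := by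
    have : 0 ≤ (2 + B) * (1 + T) ^ 3 * q - (q + B * (q * (1 + T)) * T) := by
      have : (2 + B) * (1 + T) ^ 3 * q - (q + B * (q * (1 + T)) * T) =
        q * (1 + 6 * T + 6 * (T * T) + 2 * (T * T * T)) +
          (q * B) * (1 + 2 * T + 2 * (T * T) + T * T * T) := by ring
      rw [this]
      positivity
    linarith
  have i4 : q + (q + B * (q * (1 + T)) * T) * T ≤ (2 + B) * (1 + T) ^ 3 * q := by
    have : 0 ≤ (2 + B) * (1 + T) ^ 3 * q - (q + (q + B * (q * (1 + T)) * T) * T) := by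
      have : (2 + B) * (1 + T) ^ 3 * q - (q + (q + B * (q * (1 + T)) * T) * T) =
        q * (1 + 5 * T + 6 * (T * T) + 2 * (T * T * T)) +
          (q * B) * (1 + 3 * T + 2 * (T * T)) := by ring
      rw [this]
      positivity
    linarith
  exact ⟨(e1 T hT).trans i1, (e2 T hT).trans i3, (a1 T hT).trans i2, a2.trans i4⟩

theorem abs_le_of_energy_le {κ c s h η : ℝ} (hc : 0 < c) (hκ : c ^ 2 ≤ κ)
    (h1 : √(h ^ 2 + κ * η ^ 2) ≤ s) : |η| ≤ s / c := by
  rw [le_div_iff₀ hc, mul_comm]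
  refine le_trans ?_ h1
  refine Real.le_sqrt_of_sq_le ?_
  rw [mul_pow, sq_abs]
  nlinarith [sq_nonneg h, mul_le_mul_of_nonneg_right hκ (sq_nonneg η)]

/-- With stiffness at least `c² > 0` the energy also controls positions, so the forcing stays
bounded and only one power of `T` is lost. -/
theorem IsForcedSol.bound_linear {d κ b r q c : ℝ} {η h ζ k : ℝ → ℝ}
    (hs : IsForcedSol d κ b r η h ζ k) (hd : 0 ≤ d) (hc : 0 < c) (hκ : c ^ 2 ≤ κ)
    (h0 : ForcedBound κ q (η 0) (h 0) (ζ 0) (k 0)) {T : ℝ} (hT : 0 ≤ T) :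
    ForcedBound κ ((1 + 1 / c) * (1 + |b| * (1 + |r| / c)) * (1 + T) ^ 1 * q)
      (η T) (h T) (ζ T) (k T) := by
  have hq : 0 ≤ q := (abs_nonneg _).trans h0.aη
  have hκ0 : 0 ≤ κ := (sq_nonneg c).trans hκ
  set B := |b| * (1 + |r| / c) with hB
  have hBn : 0 ≤ B := by positivity
  have e1 : ∀ t, 0 ≤ t → √(h t ^ 2 + κ * η t ^ 2) ≤ q := by
    intro t ht
    have := forced_energy_le (f := fun _ => 0) (C := 0) hd hκ0 le_rfl hs.dη
      (fun t => by simpa using hs.dh t) ht (fun t _ _ => by simp)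
    linarith [h0.eη]
  have f1 : ∀ t, 0 ≤ t → t ≤ T → |b * (h t - r * η t)| ≤ B * q := by
    intro t h0 h1
    rw [abs_mul, hB, mul_assoc]
    refine mul_le_mul_of_nonneg_left ?_ (abs_nonneg _)
    have h2 : |h t| ≤ q := (abs_le_sqrt_energy hκ0).trans (e1 t h0)
    have h3 : |η t| ≤ q / c := abs_le_of_energy_le hc hκ (e1 t h0)
    calc |h t - r * η t| ≤ |h t| + |r| * |η t| := by
          rw [← abs_mul]; exact abs_sub _ _
      _ ≤ q + |r| * (q / c) := by gcongr
      _ = _ := by ring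
  have e2 : √(k T ^ 2 + κ * ζ T ^ 2) ≤ (1 + B) * (1 + T) ^ 1 * q := by
    have := forced_energy_le hd hκ0 (by positivity) hs.dζ hs.dk hT f1
    have h2 : q + B * q * T ≤ (1 + B) * (1 + T) ^ 1 * q := by
      have : 0 ≤ q * T + B * q := by positivity
      linarith
    linarith [h0.eζ]
  have hle : q ≤ (1 + B) * (1 + T) ^ 1 * q := by
    have : 0 ≤ q * T + B * q + B * q * T := by positivity
    linarith
  have hS : ∀ x, x ≤ (1 + B) * (1 + T) ^ 1 * q → x ≤ (1 + 1 / c) * (1 + B) * (1 + T) ^ 1 * q := by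
    intro x hx
    have : 0 ≤ 1 / c * ((1 + B) * (1 + T) ^ 1 * q) := by positivity
    linarith
  have hS' : ∀ x, x ≤ (1 + B) * (1 + T) ^ 1 * q / c →
      x ≤ (1 + 1 / c) * (1 + B) * (1 + T) ^ 1 * q := by
    intro x hx
    have h1 : 0 ≤ (1 + B) * (1 + T) ^ 1 * q := by positivity
    have h2 : (1 + B) * (1 + T) ^ 1 * q / c = 1 / c * ((1 + B) * (1 + T) ^ 1 * q) := by ring
    linarith
  exact ⟨hS _ ((e1 T hT).trans hle), hS _ e2,
    hS' _ (abs_le_of_energy_le hc hκ ((e1 T hT).trans hle)),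
    hS' _ (abs_le_of_energy_le hc hκ e2)⟩

/-- Undoes the substitution: for `κ + m = μ²`, `u = ζ`, `x = k - r ζ`, `v = η + ζ` and `y = k + h -
r (η + ζ)`, the left side is the mode energy of the rescaled quantities. -/
theorem ForcedBound.sq_le {κ s r m η h ζ k : ℝ} (hκ : 0 ≤ κ) (hm : 0 ≤ m)
    (hb : ForcedBound κ s η h ζ k) :
    (κ + m) * ζ ^ 2 + (k - r * ζ) ^ 2 + (κ + m) * (η + ζ) ^ 2 + (k + h - r * (η + ζ)) ^ 2 ≤
      5 * ((1 + m) + (1 + |r|) ^ 2) * s ^ 2 := by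
  have hs : 0 ≤ s := (abs_nonneg _).trans hb.aη
  have q1 : ∀ {p w : ℝ}, √(p ^ 2 + κ * w ^ 2) ≤ s → κ * w ^ 2 ≤ s ^ 2 := by
    intro p w h1
    have h2 := Real.sqrt_le_iff.1 h1
    nlinarith [sq_nonneg p]
  have sqle : ∀ {p w : ℝ}, |p| ≤ w → p ^ 2 ≤ w ^ 2 := fun h => by
    rw [← sq_abs]; exact pow_le_pow_left₀ (abs_nonneg _) h 2
  have c1 := q1 hb.eη
  have c2 := q1 hb.eζ
  have s1 := sqle hb.aη
  have s2 := sqle hb.aζ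
  have hh : |h| ≤ s := (abs_le_sqrt_energy hκ).trans hb.eη
  have hk : |k| ≤ s := (abs_le_sqrt_energy hκ).trans hb.eζ
  have t1 : (k - r * ζ) ^ 2 ≤ ((1 + |r|) * s) ^ 2 := by
    refine sqle ((abs_sub _ _).trans ?_)
    rw [abs_mul]
    nlinarith [mul_le_mul_of_nonneg_left hb.aζ (abs_nonneg r)]
  have t2 : (k + h - r * (η + ζ)) ^ 2 ≤ (2 * (1 + |r|) * s) ^ 2 := by
    refine sqle ((abs_sub _ _).trans ?_)
    rw [abs_mul]
    have h1 := abs_add_le k h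
    have h2 := mul_le_mul_of_nonneg_left ((abs_add_le η ζ).trans (add_le_add hb.aη hb.aζ))
      (abs_nonneg r)
    linarith
  have t3 : (κ + m) * ζ ^ 2 ≤ (1 + m) * s ^ 2 := by
    nlinarith [mul_le_mul_of_nonneg_left s2 hm]
  have t4 : (κ + m) * η ^ 2 ≤ (1 + m) * s ^ 2 := by
    nlinarith [mul_le_mul_of_nonneg_left s1 hm]
  have t5 : (κ + m) * (η + ζ) ^ 2 ≤ 2 * ((κ + m) * η ^ 2 + (κ + m) * ζ ^ 2) := by
    nlinarith [mul_nonneg (add_nonneg hκ hm) (sq_nonneg (η - ζ))]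
  have t6 : ((1 + |r|) * s) ^ 2 = (1 + |r|) ^ 2 * s ^ 2 := by ring
  have t7 : (2 * (1 + |r|) * s) ^ 2 = 4 * ((1 + |r|) ^ 2 * s ^ 2) := by ring
  rw [t6] at t1
  rw [t7] at t2
  linarith

theorem exp_rescale {f f' : ℝ → ℝ} (hf : ∀ t, HasDerivAt f (f' t) t) (r t : ℝ) :
    HasDerivAt (fun t => Real.exp (r * t) * f t) (Real.exp (r * t) * (f' t + r * f t)) t := by
  have h1 : HasDerivAt (fun t => Real.exp (r * t)) (Real.exp (r * t) * (r * 1)) t :=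
    ((hasDerivAt_id t).const_mul r).exp
  refine (h1.mul (hf t)).congr_deriv ?_
  ring

/-- At `b = (1 + ε) / 2` the rescaled difference `v - u` solves a scalar damped oscillator, which
drives `u`. -/
theorem IsModeSol.isForcedSol {ε b μ r d : ℝ} {u x v y : ℝ → ℝ} (hs : IsModeSol ε b μ u x v y)
    (hb : b = (1 + ε) / 2) (hd : 2 * r + d = (1 - ε) / 2) :
    IsForcedSol d (μ ^ 2 - r * (r + d)) b r (fun t => Real.exp (r * t) * (v t - u t))
      (fun t => Real.exp (r * t) * (y t - x t + r * (v t - u t)))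
      (fun t => Real.exp (r * t) * u t) (fun t => Real.exp (r * t) * (x t + r * u t)) := by
  -- The factor `exp (r t)` shifts exponents by `r`, turning `s² + (2 r + d) s + μ²` into `s² + d s
  -- + μ² - r (r + d)`.
  have hvu := fun t => (hs.dv t).sub (hs.du t)
  have hε : ε = 1 - 2 * (2 * r + d) := by linarith
  subst hb
  subst hε
  refine ⟨exp_rescale hvu r, fun t => ?_, exp_rescale hs.du r, fun t => ?_⟩
  · refine (exp_rescale (fun t => ((hs.dy t).sub (hs.dx t)).add ((hvu t).const_mul r)) r
      t).congr_deriv ?_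
    simp only [smul_eq_mul, Pi.sub_apply, Pi.add_apply]
    ring
  · refine (exp_rescale (fun t => (hs.dx t).add ((hs.du t).const_mul r)) r t).congr_deriv ?_
    simp only [smul_eq_mul, Pi.add_apply]
    ring

/-- The energy controls `μ U` and `μ V`; controlling the positions themselves costs the factor `1 /
μ₁²`. -/
theorem forcedBound_initial {μ₁ μ κ r U X V Y : ℝ} (hμ₁ : 0 < μ₁) (hμ : μ₁ ≤ μ)
    (hκ : κ ≤ μ ^ 2) :
    ForcedBound κ (√((8 + (8 * r ^ 2 + 2) / μ₁ ^ 2) * (μ ^ 2 * U ^ 2 + X ^ 2 + μ ^ 2 * V ^ 2 + Y ^ 2)))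
      (V - U) (Y - X + r * (V - U)) U (X + r * U) := by
  set N := μ ^ 2 * U ^ 2 + X ^ 2 + μ ^ 2 * V ^ 2 + Y ^ 2 with hN
  have hμsq : μ₁ ^ 2 ≤ μ ^ 2 := pow_le_pow_left₀ hμ₁.le hμ 2
  have hm : 0 < μ₁ ^ 2 := by positivity
  have hUV : U ^ 2 + V ^ 2 ≤ N / μ₁ ^ 2 := by
    rw [le_div_iff₀ hm, hN]
    nlinarith [mul_le_mul_of_nonneg_right hμsq (sq_nonneg U),
      mul_le_mul_of_nonneg_right hμsq (sq_nonneg V), sq_nonneg X, sq_nonneg Y]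
  have hr := mul_le_mul_of_nonneg_left hUV (sq_nonneg r)
  have hNn : 0 ≤ N := by rw [hN]; positivity
  have hNd : 0 ≤ N / μ₁ ^ 2 := by positivity
  have e : (8 + (8 * r ^ 2 + 2) / μ₁ ^ 2) * N = 8 * N + 8 * (r ^ 2 * (N / μ₁ ^ 2)) +
      2 * (N / μ₁ ^ 2) := by ring
  have hrN : 0 ≤ r ^ 2 * (N / μ₁ ^ 2) := by positivity
  have k1 : κ * U ^ 2 ≤ μ ^ 2 * U ^ 2 := mul_le_mul_of_nonneg_right hκ (sq_nonneg U)
  have k2 : κ * (V - U) ^ 2 ≤ μ ^ 2 * (V - U) ^ 2 := mul_le_mul_of_nonneg_right hκ (sq_nonneg _)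
  have k3 : μ ^ 2 * (V - U) ^ 2 ≤ 2 * (μ ^ 2 * U ^ 2) + 2 * (μ ^ 2 * V ^ 2) := by
    nlinarith [mul_nonneg (sq_nonneg μ) (sq_nonneg (V + U))]
  have k4 : (Y - X + r * (V - U)) ^ 2 ≤ 4 * X ^ 2 + 4 * Y ^ 2 + 4 * (r ^ 2 * (U ^ 2 + V ^ 2)) := by
    nlinarith [sq_nonneg (Y - X - r * (V - U)), sq_nonneg (Y + X), mul_nonneg (sq_nonneg r)
      (sq_nonneg (V + U))]
  have k5 : (X + r * U) ^ 2 ≤ 2 * X ^ 2 + 2 * (r ^ 2 * (U ^ 2 + V ^ 2)) := by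
    nlinarith [sq_nonneg (X - r * U), mul_nonneg (sq_nonneg r) (sq_nonneg V)]
  have n1 : 0 ≤ μ ^ 2 * U ^ 2 := by positivity
  have n2 : 0 ≤ μ ^ 2 * V ^ 2 := by positivity
  have n3 := sq_nonneg X
  have n4 := sq_nonneg Y
  refine ⟨Real.sqrt_le_sqrt ?_, Real.sqrt_le_sqrt ?_, Real.abs_le_sqrt ?_, Real.abs_le_sqrt ?_⟩
  · rw [e]; linarith
  · rw [e]; linarith
  · rw [e]; nlinarith [sq_nonneg (V + U)]
  · rw [e]; nlinarith [sq_nonneg V]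

/-- Transfer of growth bounds from the rescaled forced system. -/
theorem energyBound_of_forcedBound {ε b r d μ₁ C : ℝ} {n : ℕ} (hb : b = (1 + ε) / 2)
    (hd : 2 * r + d = (1 - ε) / 2) (hμ₁ : 0 < μ₁) (hr0 : 0 ≤ r * (r + d))
    (hr1 : r * (r + d) ≤ μ₁ ^ 2) (hC : 0 ≤ C)
    (H : ∀ μ, μ₁ ≤ μ → ∀ q (η h ζ k : ℝ → ℝ), IsForcedSol d (μ ^ 2 - r * (r + d)) b r η h ζ k →
      ForcedBound (μ ^ 2 - r * (r + d)) q (η 0) (h 0) (ζ 0) (k 0) → ∀ T, 0 ≤ T →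
      ForcedBound (μ ^ 2 - r * (r + d)) (C * (1 + T) ^ n * q) (η T) (h T) (ζ T) (k T)) :
    ∃ C', 0 ≤ C' ∧ EnergyBound ε b μ₁ fun t => C' * ((1 + t) ^ n * Real.exp (-r * t)) := by
  set m := r * (r + d) with hm
  set K := 5 * ((1 + m) + (1 + |r|) ^ 2) with hK
  have hKn : 0 ≤ K := by rw [hK]; positivity
  set K' := 8 + (8 * r ^ 2 + 2) / μ₁ ^ 2 with hK'
  have hKn' : 0 ≤ K' := by rw [hK']; positivity
  refine ⟨C * √(K * K'), by positivity, ?_⟩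
  intro μ hμ u x v y hs t ht
  have hμsq : μ₁ ^ 2 ≤ μ ^ 2 := pow_le_pow_left₀ hμ₁.le hμ 2
  have h1 := H μ hμ (√(K' * modeEnergy μ u x v y 0)) _ _ _ _ (hs.isForcedSol hb hd) (by
    have := forcedBound_initial (κ := μ ^ 2 - m) (r := r) (U := u 0) (X := x 0) (V := v 0)
      (Y := y 0) hμ₁ hμ (by linarith)
    simp only [mul_zero, Real.exp_zero, one_mul]
    rwa [modeEnergy_real]) t ht
  have h2 := h1.sq_le (r := r) (by linarith) hr0
  have h3 : (C * (1 + t) ^ n * √(K' * modeEnergy μ u x v y 0)) ^ 2 =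
      C ^ 2 * ((1 + t) ^ n) ^ 2 * (K' * modeEnergy μ u x v y 0) := by
    rw [mul_pow, mul_pow, Real.sq_sqrt (mul_nonneg hKn' (modeEnergy_nonneg _ _ _ _ _ _))]
  rw [h3, sub_add_cancel] at h2
  have h4 : μ ^ 2 * (Real.exp (r * t) * u t) ^ 2 +
      (Real.exp (r * t) * (x t + r * u t) - r * (Real.exp (r * t) * u t)) ^ 2 +
      μ ^ 2 * (Real.exp (r * t) * (v t - u t) + Real.exp (r * t) * u t) ^ 2 +
      (Real.exp (r * t) * (x t + r * u t) + Real.exp (r * t) * (y t - x t + r * (v t - u t)) -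
        r * (Real.exp (r * t) * (v t - u t) + Real.exp (r * t) * u t)) ^ 2 =
      Real.exp (r * t) ^ 2 * modeEnergy μ u x v y t := by
    rw [modeEnergy_real]
    ring
  rw [h4] at h2
  have h5 : (C * √(K * K') * ((1 + t) ^ n * Real.exp (-r * t))) ^ 2 =
      (K * (C ^ 2 * ((1 + t) ^ n) ^ 2 * K')) * (Real.exp (r * t) ^ 2)⁻¹ := by
    rw [mul_pow, mul_pow, mul_pow _ (Real.exp _), Real.sq_sqrt (by positivity), neg_mul,
      Real.exp_neg, inv_pow]
    ring
  rw [h5]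
  have h6 : 0 < Real.exp (r * t) ^ 2 := by positivity
  rw [mul_right_comm, ← div_eq_mul_inv, le_div_iff₀ h6]
  linarith

/-- With `d = 0` the stiffness is `μ² - r² ≥ μ₁² - r² > 0`, uniformly over the modes. -/
theorem exists_energyBound_linear {ε b r μ₁ : ℝ} (hb : b = (1 + ε) / 2) (hr : r = (1 - ε) / 4)
    (hμ₁ : 0 < μ₁) (hlt : r ^ 2 < μ₁ ^ 2) :
    ∃ C, 0 ≤ C ∧ EnergyBound ε b μ₁ fun t => C * ((1 + t) ^ 1 * Real.exp (-r * t)) := by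
  have hc : 0 < √(μ₁ ^ 2 - r ^ 2) := Real.sqrt_pos.2 (by linarith)
  refine energyBound_of_forcedBound (d := 0) hb (by linarith) hμ₁ (by nlinarith) (by linarith)
    (C := (1 + 1 / √(μ₁ ^ 2 - r ^ 2)) * (1 + |b| * (1 + |r| / √(μ₁ ^ 2 - r ^ 2)))) (by positivity)
    fun μ hμ q η h ζ k hs h0 T hT => hs.bound_linear le_rfl hc ?_ h0 hT
  rw [Real.sq_sqrt (by linarith)]
  have hμsq : μ₁ ^ 2 ≤ μ ^ 2 := pow_le_pow_left₀ hμ₁.le hμ 2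
  linarith

/-- Covers zero stiffness at the lowest frequency, both for the double root (`d = 0`) and for the
overdamped case (`d > 0`). In the latter only the exponential rate matters. -/
theorem exists_energyBound_cubic {ε b r d μ₁ : ℝ} (hb : b = (1 + ε) / 2)
    (hd : 2 * r + d = (1 - ε) / 2) (hd0 : 0 ≤ d) (hμ₁ : 0 < μ₁) (hr0 : 0 ≤ r * (r + d))
    (hr1 : r * (r + d) ≤ μ₁ ^ 2) :
    ∃ C, 0 ≤ C ∧ EnergyBound ε b μ₁ fun t => C * ((1 + t) ^ 3 * Real.exp (-r * t)) := by
  refine energyBound_of_forcedBound (d := d) hb hd hμ₁ hr0 hr1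
    (C := 2 + |b| * (1 + |r|)) (by positivity)
    fun μ hμ q η h ζ k hs h0 T hT => hs.bound_cubic hd0 ?_ h0 hT
  have hμsq : μ₁ ^ 2 ≤ μ ^ 2 := pow_le_pow_left₀ hμ₁.le hμ 2
  linarith

end Critical

/-! ### Matrix flows and scalar solutions -/

section ModeFlow

variable {𝕜 : Type*} [RCLike 𝕜]

theorem Mode.norm_sq (z : Mode 𝕜) :
    ‖z‖ ^ 2 = ‖z 0‖ ^ 2 + ‖z 1‖ ^ 2 + ‖z 2‖ ^ 2 + ‖z 3‖ ^ 2 := by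
  rw [EuclideanSpace.norm_sq_eq, Fin.sum_univ_four]

theorem hasDerivAt_coord {f : ℝ → Mode 𝕜} {f' : Mode 𝕜} {t : ℝ} (h : HasDerivAt f f' t)
    (L : 𝕜 →L[ℝ] ℝ) (i : Fin 4) : HasDerivAt (fun t => L (f t i)) (L (f' i)) t :=
  (L.comp (PiLp.proj (𝕜 := ℝ) 2 (fun _ : Fin 4 => 𝕜) i)).hasFDerivAt.comp_hasDerivAt t h

/-- Coordinates `0` and `2` store `A ^ (1/2) u` and `A ^ (1/2) v`, hence the division by `μ`. With
`L` the real or imaginary part, real estimates serve both scalar fields. -/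
theorem isModeSol_linFlow {μ : ℝ} (hμ : 0 < μ) (ε b : ℝ) (z : Mode 𝕜) (L : 𝕜 →L[ℝ] ℝ) :
    IsModeSol ε b μ (fun t => L (linFlow (modeGen 𝕜 ε b μ) t z 0) / μ)
      (fun t => L (linFlow (modeGen 𝕜 ε b μ) t z 1))
      (fun t => L (linFlow (modeGen 𝕜 ε b μ) t z 2) / μ)
      (fun t => L (linFlow (modeGen 𝕜 ε b μ) t z 3)) := by
  have hr : ∀ (c : ℝ) (w : 𝕜), L ((c : 𝕜) * w) = c * L w := fun c w => by
    rw [← RCLike.real_smul_eq_coe_mul, map_smul, smul_eq_mul]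
  have hd := fun t => hasDerivAt_linFlow (modeGen 𝕜 ε b μ) z t
  have h2 := fun t => modeGen_apply ε b μ (linFlow (modeGen 𝕜 ε b μ) t z)
  refine ⟨fun t => ?_, fun t => ?_, fun t => ?_, fun t => ?_⟩
  · refine ((hasDerivAt_coord (hd t) L 0).div_const μ).congr_deriv ?_
    rw [h2]
    simp only [Matrix.cons_val_zero]
    rw [hr]
    field_simp
  · refine (hasDerivAt_coord (hd t) L 1).congr_deriv ?_
    rw [h2]
    simp only [Matrix.cons_val_one, Matrix.cons_val_zero]
    rw [map_add, map_sub, ← RCLike.ofReal_neg, hr, hr]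
    simp only [smul_eq_mul]
    field_simp
  · refine ((hasDerivAt_coord (hd t) L 2).div_const μ).congr_deriv ?_
    rw [h2]
    simp only [Matrix.cons_val]
    rw [hr]
    field_simp
  · refine (hasDerivAt_coord (hd t) L 3).congr_deriv ?_
    rw [h2]
    simp only [Matrix.cons_val]
    rw [map_add, map_sub, ← RCLike.ofReal_neg, hr, hr, hr]
    simp only [smul_eq_mul]
    field_simp
    ring

theorem norm_linFlow_le_of_energyBound {ε b μ₁ μ : ℝ} {g : ℝ → ℝ} (hg : EnergyBound ε b μ₁ g)
    (hμ₁ : 0 < μ₁) (hμ : μ₁ ≤ μ) {t : ℝ} (ht : 0 ≤ t) (hgt : 0 ≤ g t) :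
    ‖linFlow (modeGen 𝕜 ε b μ) t‖ ≤ g t := by
  have hμp : 0 < μ := hμ₁.trans_le hμ
  refine ContinuousLinearMap.opNorm_le_bound _ hgt fun z => ?_
  refine le_of_sq_le_sq ?_ (by positivity)
  have key : ∀ L : 𝕜 →L[ℝ] ℝ, ∀ t, modeEnergy μ
      (fun t => L (linFlow (modeGen 𝕜 ε b μ) t z 0) / μ)
      (fun t => L (linFlow (modeGen 𝕜 ε b μ) t z 1))
      (fun t => L (linFlow (modeGen 𝕜 ε b μ) t z 2) / μ)
      (fun t => L (linFlow (modeGen 𝕜 ε b μ) t z 3)) t =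
      L (linFlow (modeGen 𝕜 ε b μ) t z 0) ^ 2 + L (linFlow (modeGen 𝕜 ε b μ) t z 1) ^ 2 +
      L (linFlow (modeGen 𝕜 ε b μ) t z 2) ^ 2 + L (linFlow (modeGen 𝕜 ε b μ) t z 3) ^ 2 := by
    intro L t
    rw [modeEnergy_real]
    field_simp
  have h1 := hg μ hμ _ _ _ _ (isModeSol_linFlow hμp ε b z RCLike.reCLM) t ht
  have h2 := hg μ hμ _ _ _ _ (isModeSol_linFlow hμp ε b z RCLike.imCLM) t ht
  rw [key, key] at h1 h2
  simp only [linFlow_zero, one_apply_eq_self, RCLike.reCLM_apply, RCLike.imCLM_apply] at h1 h2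
  rw [mul_pow, Mode.norm_sq, Mode.norm_sq]
  simp only [RCLike.norm_sq_eq_def]
  nlinarith

theorem exists_linFlow_eq_of_isModeSol {ε b μ : ℝ} {u x v y : ℝ → ℝ}
    (hs : IsModeSol ε b μ u x v y) :
    ∃ a : Mode 𝕜, ∀ t, 0 ≤ t →
      ‖linFlow (modeGen 𝕜 ε b μ) t a‖ ^ 2 = modeEnergy μ u x v y t := by
  let f : ℝ → Mode 𝕜 := fun t =>
    !₂[((μ * u t : ℝ) : 𝕜), ((x t : ℝ) : 𝕜), ((μ * v t : ℝ) : 𝕜), ((y t : ℝ) : 𝕜)]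
  have hco : ∀ {g : ℝ → ℝ} {g' t : ℝ}, HasDerivAt g g' t →
      HasDerivAt (fun t => (g t : 𝕜)) (g' : 𝕜) t := fun {g g' t} h => by
    have := (RCLike.ofRealCLM (K := 𝕜)).hasFDerivAt.comp_hasDerivAt t h
    simpa [Function.comp_def] using this
  have hd : ∀ t, HasDerivAt f (modeGen 𝕜 ε b μ (f t)) t := by
    intro t
    have hpi : HasDerivAt (fun t => (f t).ofLp) (modeGen 𝕜 ε b μ (f t)).ofLp t := by
      rw [hasDerivAt_pi, modeGen_apply]
      intro i
      fin_cases i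
      · refine (hco ((hs.du t).const_mul μ)).congr_deriv ?_
        simp [f]
      · refine (hco (hs.dx t)).congr_deriv ?_
        simp [f]
        ring
      · refine (hco ((hs.dv t).const_mul μ)).congr_deriv ?_
        simp [f]
      · refine (hco (hs.dy t)).congr_deriv ?_
        simp [f]
        ring
    exact (PiLp.continuousLinearEquiv 2 ℝ (fun _ : Fin 4 => 𝕜)).symm.hasFDerivAt.comp_hasDerivAt
      t hpi
  have hc : Continuous f := continuous_iff_continuousAt.2 fun t => (hd t).continuousAt
  refine ⟨f 0, fun t ht => ?_⟩
  rw [← eq_linFlow_of_hasDerivWithinAt _ hc (fun t _ => (hd t).hasDerivWithinAt) ht, Mode.norm_sq,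
    modeEnergy_real]
  simp [f, mul_pow]

theorem IsModeSol.comp_clm {F F' : Type*} [NormedAddCommGroup F] [NormedSpace ℝ F]
    [NormedAddCommGroup F'] [NormedSpace ℝ F'] {ε b μ : ℝ} {u x v y : ℝ → F}
    (hs : IsModeSol ε b μ u x v y) (L : F →L[ℝ] F') :
    IsModeSol ε b μ (fun t => L (u t)) (fun t => L (x t)) (fun t => L (v t)) (fun t => L (y t)) := by
  refine ⟨fun t => ?_, fun t => ?_, fun t => ?_, fun t => ?_⟩
  · exact L.hasFDerivAt.comp_hasDerivAt t (hs.du t)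
  · have := L.hasFDerivAt.comp_hasDerivAt t (hs.dx t)
    simpa [Function.comp_def] using this
  · exact L.hasFDerivAt.comp_hasDerivAt t (hs.dv t)
  · have := L.hasFDerivAt.comp_hasDerivAt t (hs.dy t)
    simpa [Function.comp_def] using this

/-- Real and imaginary parts are two real solutions, each a trajectory of the flow, and their
energies add. So complex exponentials test the flow norm even when `𝕜` is `ℝ`. -/
theorem modeEnergy_complex_le {ε b μ : ℝ} {u x v y : ℝ → ℂ} (hs : IsModeSol ε b μ u x v y)
    {t : ℝ} (ht : 0 ≤ t) : modeEnergy μ u x v y t ≤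
      ‖linFlow (modeGen 𝕜 ε b μ) t‖ ^ 2 * modeEnergy μ u x v y 0 := by
  obtain ⟨a, ha⟩ := exists_linFlow_eq_of_isModeSol (𝕜 := 𝕜) (hs.comp_clm Complex.reCLM)
  obtain ⟨a', ha'⟩ := exists_linFlow_eq_of_isModeSol (𝕜 := 𝕜) (hs.comp_clm Complex.imCLM)
  have hsplit : ∀ t, modeEnergy μ u x v y t = ‖linFlow (modeGen 𝕜 ε b μ) t a‖ ^ 2 +
      ‖linFlow (modeGen 𝕜 ε b μ) t a'‖ ^ 2 ∨ t < 0 := by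
    intro t
    rcases lt_or_ge t 0 with h | h
    · exact Or.inr h
    · left
      rw [ha t h, ha' t h, modeEnergy_real, modeEnergy_real, modeEnergy]
      simp only [Complex.sq_norm, Complex.normSq_apply, Complex.reCLM_apply, Complex.imCLM_apply]
      ring
  have h1 := (hsplit t).resolve_right (not_lt.2 ht)
  have h0 := (hsplit 0).resolve_right (lt_irrefl 0)
  rw [linFlow_zero, one_apply_eq_self, one_apply_eq_self] at h0
  rw [h1, h0, mul_add, ← mul_pow, ← mul_pow]
  gcongr <;> exact ContinuousLinearMap.le_opNorm _ _

end ModeFlow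

/-! ### The energy space as an `ℓ²` sum of modes -/

section EnergyIso

variable {𝕜 H ι : Type*} [RCLike 𝕜] [NormedAddCommGroup H] [InnerProductSpace 𝕜 H]

theorem summable_norm_sq_repr (e : HilbertBasis ι 𝕜 H) (x : H) :
    Summable fun i => ‖e.repr x i‖ ^ 2 := lp_two_summable (e.repr x)

theorem norm_sq_eq_tsum_repr (e : HilbertBasis ι 𝕜 H) (x : H) :
    ‖x‖ ^ 2 = ∑' i, ‖e.repr x i‖ ^ 2 := by
  rw [← lp_two_norm_sq, LinearIsometryEquiv.norm_map]

variable [CompleteSpace H] {A : H →ₗ.[𝕜] H}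

theorem isPosSqrt_opSqrt (e : HilbertBasis ι 𝕜 H) {μ : ι → ℝ} (hμ : ∀ i, 0 < μ i)
    (hA : ∀ x y, (x, y) ∈ A.graph ↔ ∀ i, e.repr y i = ((μ i ^ 2 : ℝ) : 𝕜) * e.repr x i) :
    IsPosSqrt A (opSqrt A) := by
  have h : ∃ B : H →ₗ.[𝕜] H, IsPosSqrt A B := ⟨_, isPosSqrt_diagOp e hμ hA⟩
  rw [opSqrt, dif_pos h]
  exact h.choose_spec

theorem mem_graph_opSqrt (e : HilbertBasis ι 𝕜 H) {μ : ι → ℝ} (hμ : ∀ i, 0 < μ i)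
    (hA : ∀ x y, (x, y) ∈ A.graph ↔ ∀ i, e.repr y i = ((μ i ^ 2 : ℝ) : 𝕜) * e.repr x i)
    (x y : H) : (x, y) ∈ (opSqrt A).graph ↔ ∀ i, e.repr y i = (μ i : 𝕜) * e.repr x i := by
  have hB := isPosSqrt_opSqrt e hμ hA
  refine mem_graph_iff_of_eigenbasis e μ hB.selfAdjoint (fun i => hB.eigenvector (hμ i) ?_) x y
  rw [hA, ← mem_graph_diagOp]
  exact basis_mem_graph_diagOp e (fun i => μ i ^ 2) i

theorem SqrtDomain.mem_graph (u : SqrtDomain A) :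
    (SqrtDomain.incl A u, SqrtDomain.apply A u) ∈ (opSqrt A).graph :=
  LinearPMap.mem_graph (opSqrt A) u

theorem EnergySpace.norm_sq (z : EnergySpace A) :
    ‖z‖ ^ 2 = ‖SqrtDomain.apply A z.fst.fst‖ ^ 2 + ‖z.fst.snd‖ ^ 2 +
      ‖SqrtDomain.apply A z.snd.fst‖ ^ 2 + ‖z.snd.snd‖ ^ 2 := by
  rw [WithLp.prod_norm_sq_eq_of_L2, WithLp.prod_norm_sq_eq_of_L2, WithLp.prod_norm_sq_eq_of_L2,
    ← add_assoc]
  rfl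

/-- The four families of coefficients of an element of the energy space. -/
def energyCoeff (e : HilbertBasis ι 𝕜 H) (z : EnergySpace A) (i : ι) : Mode 𝕜 :=
  !₂[e.repr (SqrtDomain.apply A z.fst.fst) i, e.repr z.fst.snd i,
    e.repr (SqrtDomain.apply A z.snd.fst) i, e.repr z.snd.snd i]

theorem norm_sq_energyCoeff (e : HilbertBasis ι 𝕜 H) (z : EnergySpace A) (i : ι) :
    ‖energyCoeff e z i‖ ^ 2 = ‖e.repr (SqrtDomain.apply A z.fst.fst) i‖ ^ 2 +
      ‖e.repr z.fst.snd i‖ ^ 2 + ‖e.repr (SqrtDomain.apply A z.snd.fst) i‖ ^ 2 +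
      ‖e.repr z.snd.snd i‖ ^ 2 := by
  rw [Mode.norm_sq]
  rfl

theorem summable_energyCoeff (e : HilbertBasis ι 𝕜 H) (z : EnergySpace A) :
    Summable fun i => ‖energyCoeff e z i‖ ^ 2 := by
  simp only [norm_sq_energyCoeff]
  exact (((summable_norm_sq_repr e _).add (summable_norm_sq_repr e _)).add
    (summable_norm_sq_repr e _)).add (summable_norm_sq_repr e _)

/-- The coefficient map of the energy space. -/
def energyCoeffLin (e : HilbertBasis ι 𝕜 H) :
    EnergySpace A →ₗ[𝕜] lp (fun _ : ι => Mode 𝕜) 2 where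
  toFun z := ⟨energyCoeff e z, memlp_two_of_summable (summable_energyCoeff e z)⟩
  map_add' z w := by
    refine lp.ext (funext fun i => ?_)
    change energyCoeff e (z + w) i = energyCoeff e z i + energyCoeff e w i
    ext j
    fin_cases j <;> simp [energyCoeff]
  map_smul' c z := by
    refine lp.ext (funext fun i => ?_)
    change energyCoeff e (c • z) i = c • energyCoeff e z i
    ext j
    fin_cases j <;> simp [energyCoeff]

theorem energyCoeffLin_apply (e : HilbertBasis ι 𝕜 H) (z : EnergySpace A) (i : ι) :
    energyCoeffLin e z i = energyCoeff e z i := rfl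

theorem norm_energyCoeffLin (e : HilbertBasis ι 𝕜 H) (z : EnergySpace A) :
    ‖energyCoeffLin e z‖ = ‖z‖ := by
  refine (sq_eq_sq₀ (norm_nonneg _) (norm_nonneg _)).1 ?_
  rw [lp_two_norm_sq, EnergySpace.norm_sq]
  simp only [energyCoeffLin_apply, norm_sq_energyCoeff]
  have s := fun x => summable_norm_sq_repr e x
  rw [Summable.tsum_add (((s _).add (s _)).add (s _)) (s _),
    Summable.tsum_add ((s _).add (s _)) (s _), Summable.tsum_add (s _) (s _)]
  simp only [← norm_sq_eq_tsum_repr]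

theorem SqrtDomain.apply_injective (e : HilbertBasis ι 𝕜 H) {μ : ι → ℝ} (hμ : ∀ i, 0 < μ i)
    (hA : ∀ x y, (x, y) ∈ A.graph ↔ ∀ i, e.repr y i = ((μ i ^ 2 : ℝ) : 𝕜) * e.repr x i) :
    Function.Injective (SqrtDomain.apply A) := by
  rw [injective_iff_map_eq_zero]
  intro u hu
  have h1 := (mem_graph_opSqrt e hμ hA _ _).1 u.mem_graph
  rw [hu] at h1
  have h2 : SqrtDomain.incl A u = 0 := by
    refine e.repr.map_eq_zero_iff.1 (lp.ext (funext fun i => ?_))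
    have := h1 i
    simpa [(hμ i).ne'] using this
  exact Subtype.ext h2

/-- Dividing coefficients by `μ i ≥ μ₁ > 0` preserves square summability. -/
theorem SqrtDomain.apply_surjective (e : HilbertBasis ι 𝕜 H) {μ : ι → ℝ} {μ₁ : ℝ} (hμ₁ : 0 < μ₁)
    (hμ : ∀ i, μ₁ ≤ μ i)
    (hA : ∀ x y, (x, y) ∈ A.graph ↔ ∀ i, e.repr y i = ((μ i ^ 2 : ℝ) : 𝕜) * e.repr x i) :
    Function.Surjective (SqrtDomain.apply A) := by
  intro a
  have hm : Memℓp (fun i => ((μ i)⁻¹ : 𝕜) * e.repr a i) 2 := by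
    refine memlp_two_of_summable ?_
    refine Summable.of_nonneg_of_le (fun i => by positivity) (fun i => ?_)
      ((summable_norm_sq_repr e a).mul_left ((μ₁⁻¹) ^ 2))
    rw [norm_mul, mul_pow, norm_inv, RCLike.norm_ofReal, abs_of_pos (hμ₁.trans_le (hμ i))]
    have := hμ i
    have := hμ₁.trans_le this
    gcongr
  have hg : (e.repr.symm ⟨_, hm⟩, a) ∈ (opSqrt A).graph := by
    rw [mem_graph_opSqrt e (fun i => hμ₁.trans_le (hμ i)) hA]
    intro i
    rw [LinearIsometryEquiv.apply_symm_apply]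
    have : (μ i : 𝕜) ≠ 0 := RCLike.ofReal_ne_zero.2 (hμ₁.trans_le (hμ i)).ne'
    simp only
    rw [mul_inv_cancel_left₀ this]
  obtain ⟨h1, h2⟩ := (graph_mem_iff _ _ _).1 hg
  exact ⟨⟨_, h1⟩, h2⟩

/-- The energy space is isometric to the `ℓ²` sum of the modes. -/
theorem exists_energyIso (e : HilbertBasis ι 𝕜 H) {μ : ι → ℝ} {μ₁ : ℝ} (hμ₁ : 0 < μ₁)
    (hμ : ∀ i, μ₁ ≤ μ i)
    (hA : ∀ x y, (x, y) ∈ A.graph ↔ ∀ i, e.repr y i = ((μ i ^ 2 : ℝ) : 𝕜) * e.repr x i) :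
    ∃ Φ : EnergySpace A ≃ₗᵢ[𝕜] lp (fun _ : ι => Mode 𝕜) 2, ∀ z i, Φ z i = energyCoeff e z i := by
  -- Preserving norms does not suffice, as the energy space carries only a seminorm by construction;
  -- injectivity of `A ^ (1/2)` is needed.
  have hinj : Function.Injective (energyCoeffLin (A := A) e) := by
    rw [injective_iff_map_eq_zero]
    intro z hz
    have h1 := norm_energyCoeffLin e z
    rw [hz, norm_zero] at h1
    have h2 := EnergySpace.norm_sq z
    rw [← h1] at h2
    have hi := fun u => (map_eq_zero_iff _
      (SqrtDomain.apply_injective e (fun i => hμ₁.trans_le (hμ i)) hA) (x := u)).1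
    have a1 : SqrtDomain.apply A z.fst.fst = 0 := norm_eq_zero.1 (by
      rw [← sq_eq_zero_iff]
      nlinarith [sq_nonneg ‖SqrtDomain.apply A z.fst.fst‖, sq_nonneg ‖z.fst.snd‖,
        sq_nonneg ‖SqrtDomain.apply A z.snd.fst‖, sq_nonneg ‖z.snd.snd‖])
    have a2 : z.fst.snd = 0 := norm_eq_zero.1 (by
      rw [← sq_eq_zero_iff]
      nlinarith [sq_nonneg ‖SqrtDomain.apply A z.fst.fst‖, sq_nonneg ‖z.fst.snd‖,
        sq_nonneg ‖SqrtDomain.apply A z.snd.fst‖, sq_nonneg ‖z.snd.snd‖])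
    have a3 : SqrtDomain.apply A z.snd.fst = 0 := norm_eq_zero.1 (by
      rw [← sq_eq_zero_iff]
      nlinarith [sq_nonneg ‖SqrtDomain.apply A z.fst.fst‖, sq_nonneg ‖z.fst.snd‖,
        sq_nonneg ‖SqrtDomain.apply A z.snd.fst‖, sq_nonneg ‖z.snd.snd‖])
    have a4 : z.snd.snd = 0 := norm_eq_zero.1 (by
      rw [← sq_eq_zero_iff]
      nlinarith [sq_nonneg ‖SqrtDomain.apply A z.fst.fst‖, sq_nonneg ‖z.fst.snd‖,
        sq_nonneg ‖SqrtDomain.apply A z.snd.fst‖, sq_nonneg ‖z.snd.snd‖])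
    have b1 := hi _ a1
    have b3 := hi _ a3
    change mkVec A z.fst.fst z.fst.snd z.snd.fst z.snd.snd = mkVec A 0 0 0 0
    rw [b1, a2, b3, a4]
  have hsurj : Function.Surjective (energyCoeffLin (A := A) e) := by
    intro f
    have hco : ∀ j : Fin 4, Memℓp (fun i => f i j) 2 := fun j => by
      refine memlp_two_of_summable (Summable.of_nonneg_of_le (fun i => by positivity) (fun i => ?_)
        (lp_two_summable f))
      exact pow_le_pow_left₀ (norm_nonneg _) (PiLp.norm_apply_le _ _) 2
    obtain ⟨u, hu⟩ := SqrtDomain.apply_surjective e hμ₁ hμ hA (e.repr.symm ⟨_, hco 0⟩)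
    obtain ⟨v, hv⟩ := SqrtDomain.apply_surjective e hμ₁ hμ hA (e.repr.symm ⟨_, hco 2⟩)
    refine ⟨mkVec A u (e.repr.symm ⟨_, hco 1⟩) v (e.repr.symm ⟨_, hco 3⟩), ?_⟩
    refine lp.ext (funext fun i => ?_)
    have h1 : energyCoeffLin e (mkVec A u (e.repr.symm ⟨_, hco 1⟩) v (e.repr.symm ⟨_, hco 3⟩)) i =
      !₂[e.repr (SqrtDomain.apply A u) i, e.repr (e.repr.symm ⟨_, hco 1⟩) i,
        e.repr (SqrtDomain.apply A v) i, e.repr (e.repr.symm ⟨_, hco 3⟩) i] := rfl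
    rw [h1, hu, hv]
    simp only [LinearIsometryEquiv.apply_symm_apply]
    ext j
    fin_cases j <;> rfl
  exact ⟨⟨LinearEquiv.ofBijective _ ⟨hinj, hsurj⟩, norm_energyCoeffLin e⟩, fun z i => rfl⟩

theorem mem_graph_systemOp (ε b : ℝ) (z w : EnergySpace A) :
    (z, w) ∈ (systemOp A ε b).graph ↔
      (compX A z, SqrtDomain.apply A w.fst.fst) ∈ (opSqrt A).graph ∧
      SqrtDomain.incl A w.fst.fst = compX A z ∧
      (compU A z, -(compX A w) - compX A z + (b : 𝕜) • compY A z) ∈ A.graph ∧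
      SqrtDomain.incl A w.snd.fst = compY A z ∧
      (compV A z, -(compY A w) + (ε : 𝕜) • compY A z - (b : 𝕜) • compX A z) ∈ A.graph := by
  rw [graph_mem_iff]
  constructor
  · rintro ⟨h, rfl⟩
    refine ⟨?_, rfl, ?_, rfl, ?_⟩
    · exact SqrtDomain.mem_graph (SqrtDomain.mk A (compX A z) h.2.1)
    · refine (graph_mem_iff _ _ _).2 ⟨h.1, ?_⟩
      change A ⟨compU A z, h.1⟩ =
        -(-A ⟨compU A z, h.1⟩ - compX A z + (b : 𝕜) • compY A z) - compX A z +
          (b : 𝕜) • compY A z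
      abel
    · refine (graph_mem_iff _ _ _).2 ⟨h.2.2.1, ?_⟩
      change A ⟨compV A z, h.2.2.1⟩ =
        -(-A ⟨compV A z, h.2.2.1⟩ + (ε : 𝕜) • compY A z - (b : 𝕜) • compX A z) +
          (ε : 𝕜) • compY A z - (b : 𝕜) • compX A z
      abel
  · rintro ⟨-, h2, h3, h4, h5⟩
    obtain ⟨hu, hu'⟩ := (graph_mem_iff _ _ _).1 h3
    obtain ⟨hv, hv'⟩ := (graph_mem_iff _ _ _).1 h5
    have hx : compX A z ∈ (opSqrt A).domain := by
      rw [← h2]; exact w.fst.fst.2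
    have hy : compY A z ∈ (opSqrt A).domain := by
      rw [← h4]; exact w.snd.fst.2
    refine ⟨⟨hu, hx, hv, hy⟩, ?_⟩
    change mkVec A (SqrtDomain.mk A (compX A z) hx)
        (-A ⟨compU A z, hu⟩ - compX A z + (b : 𝕜) • compY A z)
        (SqrtDomain.mk A (compY A z) hy)
        (-A ⟨compV A z, hv⟩ + (ε : 𝕜) • compY A z - (b : 𝕜) • compX A z) =
      mkVec A w.fst.fst (compX A w) w.snd.fst (compY A w)
    have e1 : SqrtDomain.mk A (compX A z) hx = w.fst.fst := Subtype.ext h2.symm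
    have e2 : SqrtDomain.mk A (compY A z) hy = w.snd.fst := Subtype.ext h4.symm
    rw [e1, e2, hu', hv']
    congr 1 <;> abel

/-- In the coefficients, the system operator is the diagonal operator of the mode generators. -/
theorem mem_graph_systemOp_iff_coeff (e : HilbertBasis ι 𝕜 H) {μ : ι → ℝ} (hμ : ∀ i, 0 < μ i)
    (hA : ∀ x y, (x, y) ∈ A.graph ↔ ∀ i, e.repr y i = ((μ i ^ 2 : ℝ) : 𝕜) * e.repr x i)
    (ε b : ℝ) (z w : EnergySpace A) :
    (z, w) ∈ (systemOp A ε b).graph ↔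
      ∀ i, energyCoeff e w i = modeGen 𝕜 ε b (μ i) (energyCoeff e z i) := by
  have hB := mem_graph_opSqrt e hμ hA
  have hμ0 : ∀ i, (μ i : 𝕜) ≠ 0 := fun i => RCLike.ofReal_ne_zero.2 (hμ i).ne'
  have hU : ∀ i, e.repr (SqrtDomain.apply A z.fst.fst) i = (μ i : 𝕜) * e.repr (compU A z) i :=
    (hB _ _).1 (SqrtDomain.mem_graph z.fst.fst)
  have hV : ∀ i, e.repr (SqrtDomain.apply A z.snd.fst) i = (μ i : 𝕜) * e.repr (compV A z) i :=
    (hB _ _).1 (SqrtDomain.mem_graph z.snd.fst)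
  have hWU : ∀ i, e.repr (SqrtDomain.apply A w.fst.fst) i =
      (μ i : 𝕜) * e.repr (SqrtDomain.incl A w.fst.fst) i :=
    (hB _ _).1 (SqrtDomain.mem_graph w.fst.fst)
  have hWV : ∀ i, e.repr (SqrtDomain.apply A w.snd.fst) i =
      (μ i : 𝕜) * e.repr (SqrtDomain.incl A w.snd.fst) i :=
    (hB _ _).1 (SqrtDomain.mem_graph w.snd.fst)
  have hgen : ∀ i, energyCoeff e w i = modeGen 𝕜 ε b (μ i) (energyCoeff e z i) ↔
      (e.repr (SqrtDomain.apply A w.fst.fst) i = (μ i : 𝕜) * e.repr (compX A z) i ∧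
      e.repr (compX A w) i = -(μ i : 𝕜) * e.repr (SqrtDomain.apply A z.fst.fst) i -
        e.repr (compX A z) i + (b : 𝕜) * e.repr (compY A z) i ∧
      e.repr (SqrtDomain.apply A w.snd.fst) i = (μ i : 𝕜) * e.repr (compY A z) i ∧
      e.repr (compY A w) i = -(b : 𝕜) * e.repr (compX A z) i -
        (μ i : 𝕜) * e.repr (SqrtDomain.apply A z.snd.fst) i +
        (ε : 𝕜) * e.repr (compY A z) i) := by
    intro i
    rw [modeGen_apply]
    constructor
    · intro h
      have h' := fun j => congrArg (fun f : Mode 𝕜 => f j) h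
      exact ⟨h' 0, h' 1, h' 2, h' 3⟩
    · rintro ⟨h0, h1, h2, h3⟩
      ext j
      fin_cases j
      · exact h0
      · exact h1
      · exact h2
      · exact h3
  simp only [hgen]
  rw [mem_graph_systemOp]
  have heq : ∀ {x y : H}, x = y ↔ ∀ i, e.repr x i = e.repr y i := fun {x y} =>
    ⟨fun h i => by rw [h], fun h => e.repr.injective (lp.ext (funext h))⟩
  have hL1 : ∀ i, e.repr (-(compX A w) - compX A z + (b : 𝕜) • compY A z) i =
      -(e.repr (compX A w) i) - e.repr (compX A z) i + (b : 𝕜) * e.repr (compY A z) i := by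
    intro i
    simp only [e.repr_apply_apply, inner_add_right, inner_sub_right, inner_neg_right,
      inner_smul_right]
  have hL2 : ∀ i, e.repr (-(compY A w) + (ε : 𝕜) • compY A z - (b : 𝕜) • compX A z) i =
      -(e.repr (compY A w) i) + (ε : 𝕜) * e.repr (compY A z) i -
        (b : 𝕜) * e.repr (compX A z) i := by
    intro i
    simp only [e.repr_apply_apply, inner_add_right, inner_sub_right, inner_neg_right,
      inner_smul_right]
  rw [hB, hA, hA, heq, heq]
  simp only [hL1, hL2]
  constructor
  · rintro ⟨h1, h2, h3, h4, h5⟩ i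
    refine ⟨h1 i, ?_, ?_, ?_⟩
    · have := h3 i
      rw [hU]
      push_cast at this
      linear_combination -this
    · rw [hWV, h4]
    · have := h5 i
      rw [hV]
      push_cast at this
      linear_combination -this
  · intro h
    refine ⟨fun i => (h i).1, fun i => ?_, fun i => ?_, fun i => ?_, fun i => ?_⟩
    · have := (h i).1
      rw [hWU] at this
      exact mul_left_cancel₀ (hμ0 i) this
    · have := (h i).2.1
      rw [hU] at this
      push_cast
      linear_combination -this
    · have := (h i).2.2.1
      rw [hWV] at this
      exact mul_left_cancel₀ (hμ0 i) this
    · have := (h i).2.2.2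
      rw [hV] at this
      push_cast
      linear_combination -this

end EnergyIso

/-! ### From the semigroup to the mode equations -/

section Control

/-- The norms of a semigroup are governed by the solutions of the mode equations: from above by
those with frequency at least `μ₁`, from below by those with frequency `μ₁`. -/
structure ModeControlled {𝕜 E : Type*} [RCLike 𝕜] [SeminormedAddCommGroup E] [NormedSpace 𝕜 E]
    (S : ℝ≥0 → E →L[𝕜] E) (ε b μ₁ : ℝ) : Prop where
  upper : ∀ g, EnergyBound ε b μ₁ g → ∀ t : ℝ≥0, 0 ≤ g t → ‖S t‖ ≤ g t
  exists_norm_eq : ∀ u x v y : ℝ → ℝ, IsModeSol ε b μ₁ u x v y →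
    ∃ z : E, ∀ t : ℝ≥0, ‖S t z‖ ^ 2 = modeEnergy μ₁ u x v y t
  complex_le : ∀ u x v y : ℝ → ℂ, IsModeSol ε b μ₁ u x v y → ∀ t : ℝ≥0,
    modeEnergy μ₁ u x v y t ≤ ‖S t‖ ^ 2 * modeEnergy μ₁ u x v y 0

variable {𝕜 H : Type*} [RCLike 𝕜] [NormedAddCommGroup H] [InnerProductSpace 𝕜 H] [CompleteSpace H]

theorem isSemigroupGeneratedBy_semigroup {E : Type*} [SeminormedAddCommGroup E] [NormedSpace 𝕜 E]
    {G : E →ₗ.[𝕜] E} (h : ∃ S : ℝ≥0 → E →L[𝕜] E, IsSemigroupGeneratedBy S G) :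
    IsSemigroupGeneratedBy (semigroup G) G := by
  rw [semigroup, dif_pos h]
  exact h.choose_spec

theorem exists_modeControlled [Nontrivial H] {A : H →ₗ.[𝕜] H} (hA : IsSelfAdjoint A)
    (hpos : IsStrictlyPos A) (hcpt : HasCompactDomain A) :
    IsPosSqrt A (opSqrt A) ∧ ∃ μ₁ : ℝ, 0 < μ₁ ∧ IsLeast (eigenvalues A) (μ₁ ^ 2) ∧
      ∀ ε b : ℝ, 0 ≤ ε → IsSemigroupGeneratedBy (CoupledSystem.S A ε b) (systemOp A ε b) ∧
        ModeControlled (CoupledSystem.S A ε b) ε b μ₁ := by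
  obtain ⟨ι, e, lam, i₀, hlam, hmin, hgraph⟩ := exists_eigenbasis hA hpos hcpt
  let μ : ι → ℝ := fun i => √(lam i)
  have hsq : ∀ i, μ i ^ 2 = lam i := fun i => Real.sq_sqrt (hlam i).le
  have hμ : ∀ i, 0 < μ i := fun i => Real.sqrt_pos.2 (hlam i)
  have hμ₁ : ∀ i, μ i₀ ≤ μ i := fun i => Real.sqrt_le_sqrt (hmin i)
  have hgraph' : ∀ x y, (x, y) ∈ A.graph ↔
      ∀ i, e.repr y i = ((μ i ^ 2 : ℝ) : 𝕜) * e.repr x i := by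
    simp only [hsq]
    exact hgraph
  refine ⟨isPosSqrt_opSqrt e hμ hgraph', μ i₀, hμ i₀, ?_, fun ε b hε => ?_⟩
  · rw [hsq]
    exact isLeast_eigenvalues e hmin hgraph
  · obtain ⟨Φ, hΦ⟩ := exists_energyIso e (hμ i₀) hμ₁ hgraph'
    have hG : ∀ z w, (z, w) ∈ (systemOp A ε b).graph ↔
        ∀ i, Φ w i = modeGen 𝕜 ε b (μ i) (Φ z i) := by
      intro z w
      simp only [hΦ]
      exact mem_graph_systemOp_iff_coeff e hμ hgraph' ε b z w
    have hS : IsSemigroupGeneratedBy (CoupledSystem.S A ε b) (systemOp A ε b) :=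
      isSemigroupGeneratedBy_semigroup (exists_isSemigroupGeneratedBy Φ hG hε fun i t ht =>
        norm_linFlow_le_of_energyBound (energyBound_exp hε b (μ i₀)) (hμ i₀) (hμ₁ i) ht
          (Real.exp_pos _).le)
    have happ := hS.apply_eq_linFlow Φ hG
    refine ⟨hS, ?_, ?_, ?_⟩
    · intro g hg t ht
      exact norm_le_of_linFlow_le Φ happ ht fun i =>
        norm_linFlow_le_of_energyBound hg (hμ i₀) (hμ₁ i) t.2 ht
    · intro u x v y hs
      obtain ⟨a, ha⟩ := exists_linFlow_eq_of_isModeSol (𝕜 := 𝕜) hs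
      obtain ⟨z, -, hz⟩ := exists_norm_eq_linFlow Φ happ i₀ a
      exact ⟨z, fun t => by rw [hz, ha t t.2]⟩
    · intro u x v y hs t
      refine (modeEnergy_complex_le (𝕜 := 𝕜) hs t.2).trans ?_
      exact mul_le_mul_of_nonneg_right
        (pow_le_pow_left₀ (norm_nonneg _) (norm_linFlow_le Φ happ i₀ t) 2)
        (modeEnergy_nonneg (μ i₀) u x v y 0)

end Control

/-! ### Estimating the growth bound -/

section Growth

variable {𝕜 E : Type*} [RCLike 𝕜] [SeminormedAddCommGroup E] [NormedSpace 𝕜 E]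
  {S : ℝ≥0 → E →L[𝕜] E}

theorem le_of_exp_le {c M a ω : ℝ} (hc : 0 < c)
    (h : ∀ t : ℝ≥0, c * Real.exp (a * t) ≤ M * Real.exp (ω * t)) : a ≤ ω := by
  by_contra! hlt
  have hδ : 0 < a - ω := sub_pos.2 hlt
  have hM : 0 < M := by
    have := h 0
    simp only [NNReal.coe_zero, mul_zero, Real.exp_zero, mul_one] at this
    linarith
  -- At this time `c * (1 + (a - ω) t) = M + c`, which exceeds `M`.
  have h1 := h (Real.toNNReal (M / (c * (a - ω))))
  rw [Real.coe_toNNReal _ (by positivity)] at h1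
  set t := M / (c * (a - ω)) with ht
  have h2 : c * Real.exp ((a - ω) * t) ≤ M := by
    have h3 : Real.exp (a * t) = Real.exp ((a - ω) * t) * Real.exp (ω * t) := by
      rw [← Real.exp_add]
      congr 1
      ring
    rw [h3, ← mul_assoc] at h1
    exact le_of_mul_le_mul_right h1 (Real.exp_pos _)
  have h4 := Real.add_one_le_exp ((a - ω) * t)
  have h5 : c * ((a - ω) * t) = M := by
    rw [ht]
    field_simp
  nlinarith

theorem lower_bound_growth {c a : ℝ} (hc : 0 < c)
    (h : ∀ t : ℝ≥0, c * Real.exp (a * t) ≤ ‖S t‖) :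
    a ∈ lowerBounds {ω : ℝ | ∃ M : ℝ, 1 ≤ M ∧ ∀ t : ℝ≥0, ‖S t‖ ≤ M * Real.exp (ω * t)} := by
  rintro ω ⟨M, -, hM⟩
  exact le_of_exp_le hc fun t => (h t).trans (hM t)

/-- A real `sInf` is meaningful only for a nonempty set bounded below, so each one-sided estimate of
the growth bound carries an exponential bound on the other side. -/
theorem le_growthBound {c a : ℝ} (hc : 0 < c) (h : ∀ t : ℝ≥0, c * Real.exp (a * t) ≤ ‖S t‖)
    {C ω : ℝ} (hS : ∀ t : ℝ≥0, ‖S t‖ ≤ C * Real.exp (ω * t)) : a ≤ growthBound S := by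
  refine le_csInf ⟨ω, max 1 C, le_max_left _ _, fun t => (hS t).trans ?_⟩ (lower_bound_growth hc h)
  gcongr
  exact le_max_right _ _

theorem growthBound_le {c a : ℝ} (hc : 0 < c) (h : ∀ t : ℝ≥0, c * Real.exp (a * t) ≤ ‖S t‖)
    {C ω : ℝ} (hS : ∀ t : ℝ≥0, ‖S t‖ ≤ C * Real.exp (ω * t)) : growthBound S ≤ ω := by
  refine csInf_le ⟨a, lower_bound_growth hc h⟩ ⟨max 1 C, le_max_left _ _, fun t => (hS t).trans ?_⟩
  gcongr
  exact le_max_right _ _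

theorem one_add_pow_le_exp (n : ℕ) {δ : ℝ} (hδ : 0 < δ) :
    ∃ M : ℝ, 0 ≤ M ∧ ∀ t : ℝ, 0 ≤ t → (1 + t) ^ n ≤ M * Real.exp (δ * t) := by
  -- Dividing by `n + 1` includes the case `n = 0`.
  set η := δ / (n + 1) with hη
  have hη0 : 0 < η := by positivity
  refine ⟨(1 + 1 / η) ^ n, by positivity, fun t ht => ?_⟩
  have h1 : 1 + t ≤ (1 + 1 / η) * Real.exp (η * t) := by
    have h2 := Real.add_one_le_exp (η * t)
    have h3 : (1 + 1 / η) * (η * t + 1) = 1 + t + (η * t + 1 / η) := by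
      field_simp
      ring
    have h4 : 0 ≤ η * t + 1 / η := by positivity
    calc 1 + t ≤ (1 + 1 / η) * (η * t + 1) := by linarith
      _ ≤ _ := by gcongr
  calc (1 + t) ^ n ≤ ((1 + 1 / η) * Real.exp (η * t)) ^ n := by gcongr
    _ = (1 + 1 / η) ^ n * Real.exp (n * (η * t)) := by rw [mul_pow, ← Real.exp_nat_mul]
    _ ≤ (1 + 1 / η) ^ n * Real.exp (δ * t) := by
        refine mul_le_mul_of_nonneg_left (Real.exp_le_exp.2 ?_) (by positivity)
        rw [← mul_assoc]
        refine mul_le_mul_of_nonneg_right ?_ ht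
        rw [hη, mul_div_assoc', div_le_iff₀ (by positivity)]
        nlinarith

theorem growthBound_le_of_poly {c a : ℝ} (hc : 0 < c)
    (h : ∀ t : ℝ≥0, c * Real.exp (a * t) ≤ ‖S t‖) {C ω : ℝ} {n : ℕ} (hC : 0 ≤ C)
    (hS : ∀ t : ℝ≥0, ‖S t‖ ≤ C * ((1 + (t : ℝ)) ^ n * Real.exp (ω * t))) : growthBound S ≤ ω := by
  refine le_of_forall_pos_le_add fun δ hδ => ?_
  obtain ⟨M, hM, hMt⟩ := one_add_pow_le_exp n hδ
  refine growthBound_le hc h (C := C * M) fun t => (hS t).trans ?_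
  rw [mul_assoc]
  refine mul_le_mul_of_nonneg_left ?_ hC
  calc (1 + (t : ℝ)) ^ n * Real.exp (ω * t) ≤ M * Real.exp (δ * t) * Real.exp (ω * t) := by
        gcongr
        exact hMt t t.2
    _ = _ := by
        rw [mul_assoc, ← Real.exp_add]
        ring_nf

end Growth

/-! ### Lower bounds from exponential solutions -/

section Trajectories

theorem hasDerivAt_cexp_mul (s : ℂ) (t : ℝ) :
    HasDerivAt (fun t : ℝ => Complex.exp (s * t)) (s * Complex.exp (s * t)) t := by
  have h1 : HasDerivAt (fun t : ℝ => s * (t : ℂ)) (s * 1) t :=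
    (Complex.ofRealCLM.hasDerivAt (x := t)).const_mul s
  refine h1.cexp.congr_deriv ?_
  ring

/-- The exponential solutions. -/
theorem isModeSol_exp {ε b μ : ℝ} (hb : b ≠ 0) {w s : ℂ}
    (hw : w ^ 2 + (1 - ε) * w + (b ^ 2 - ε) = 0) (hs : s ^ 2 - w * s + μ ^ 2 = 0) :
    IsModeSol ε b μ (fun t => Complex.exp (s * t)) (fun t => s * Complex.exp (s * t))
      (fun t => (w + 1) / b * Complex.exp (s * t))
      (fun t => (w + 1) / b * (s * Complex.exp (s * t))) := by
  -- The vector `(1, (w + 1) / b)` is an eigenvector of `N` for `w`.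
  have hb' : (b : ℂ) ≠ 0 := Complex.ofReal_ne_zero.2 hb
  have hd := hasDerivAt_cexp_mul s
  have hs2 : s ^ 2 = w * s - μ ^ 2 := by linear_combination hs
  refine ⟨hd, fun t => ((hd t).const_mul s).congr_deriv ?_, fun t => (hd t).const_mul _,
    fun t => (((hd t).const_mul s).const_mul _).congr_deriv ?_⟩
  · simp only [Complex.real_smul, Complex.ofReal_pow]
    field_simp
    linear_combination hs
  · simp only [Complex.real_smul, Complex.ofReal_pow]
    field_simp
    linear_combination (w + 1) * hs + s * hw

/-- Real parts of oscillating exponentials have zeros, but position and velocity do not vanish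
together; this gives a lower bound uniform in `t`. -/
theorem exists_pos_le_energy_exp {μ : ℝ} (hμ : 0 < μ) (s : ℂ) (v y : ℝ → ℝ) :
    ∃ c : ℝ, 0 < c ∧ ∀ t : ℝ, (c * Real.exp (s.re * t)) ^ 2 ≤
      modeEnergy μ (fun t : ℝ => (Complex.exp (s * t)).re) (fun t => (s * Complex.exp (s * t)).re)
        v y t := by
  have hre : ∀ t : ℝ, (Complex.exp (s * t)).re = Real.exp (s.re * t) * Real.cos (s.im * t) := by
    intro t
    simp [Complex.exp_re]
  have him : ∀ t : ℝ, (Complex.exp (s * t)).im = Real.exp (s.re * t) * Real.sin (s.im * t) := by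
    intro t
    simp [Complex.exp_im]
  have key : ∃ c : ℝ, 0 < c ∧ ∀ t : ℝ, c ^ 2 ≤ μ ^ 2 * Real.cos (s.im * t) ^ 2 +
      (s.re * Real.cos (s.im * t) - s.im * Real.sin (s.im * t)) ^ 2 := by
    by_cases h0 : s.im = 0
    · refine ⟨μ, hμ, fun t => ?_⟩
      rw [h0, zero_mul, Real.cos_zero]
      nlinarith [sq_nonneg (s.re * 1 - 0 * Real.sin 0)]
    -- With `p`, `q` the cosine and sine, the bound rests on `2 (re p - im q)² ≥ im² q² - 2 re² p²`
    -- and `p² + q² = 1`; `K` makes the coefficients large enough.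
    · set K := (s.im ^ 2 + 2 * s.re ^ 2) / μ ^ 2 + 2 with hK
      have hKp : 0 < K := by positivity
      refine ⟨|s.im| / √K, by positivity, fun t => ?_⟩
      rw [div_pow, Real.sq_sqrt hKp.le, sq_abs, div_le_iff₀ hKp]
      have h1 := Real.sin_sq_add_cos_sq (s.im * t)
      set p := Real.cos (s.im * t)
      set q := Real.sin (s.im * t)
      have h2 : (μ ^ 2 * p ^ 2 + (s.re * p - s.im * q) ^ 2) * K =
          (s.im ^ 2 + 2 * s.re ^ 2) * p ^ 2 + 2 * (s.re * p - s.im * q) ^ 2 +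
          (2 * μ ^ 2 * p ^ 2 + (s.re * p - s.im * q) ^ 2 * ((s.im ^ 2 + 2 * s.re ^ 2) / μ ^ 2)) := by
        rw [hK]
        field_simp
        ring
      have h3 : 0 ≤ 2 * μ ^ 2 * p ^ 2 +
        (s.re * p - s.im * q) ^ 2 * ((s.im ^ 2 + 2 * s.re ^ 2) / μ ^ 2) := by positivity
      have h4 : s.im ^ 2 = s.im ^ 2 * q ^ 2 + s.im ^ 2 * p ^ 2 := by
        rw [← mul_add, h1, mul_one]
      rw [h2]
      nlinarith [sq_nonneg (2 * s.re * p - s.im * q)]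
  obtain ⟨c, hc, hct⟩ := key
  refine ⟨c, hc, fun t => ?_⟩
  rw [modeEnergy_real, Complex.mul_re, hre, him, mul_pow]
  have h1 := mul_le_mul_of_nonneg_right (hct t) (sq_nonneg (Real.exp (s.re * t)))
  nlinarith [sq_nonneg (μ * v t), sq_nonneg (y t)]

variable {𝕜 E : Type*} [RCLike 𝕜] [SeminormedAddCommGroup E] [NormedSpace 𝕜 E]
  {S : ℝ≥0 → E →L[𝕜] E} {ε b μ₁ : ℝ}

/-- `s` is a characteristic exponent of the mode with frequency `μ`. -/
def IsExponent (ε b μ : ℝ) (s : ℂ) : Prop :=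
  ∃ w : ℂ, w ^ 2 + (1 - ε) * w + (b ^ 2 - ε) = 0 ∧ s ^ 2 - w * s + μ ^ 2 = 0

theorem ModeControlled.exists_trajectory (hS : ModeControlled S ε b μ₁) (hμ₁ : 0 < μ₁)
    (hb : b ≠ 0) {s : ℂ} (h : IsExponent ε b μ₁ s) :
    ∃ z : E, ∃ c : ℝ, 0 < c ∧ ∀ t : ℝ≥0, c * Real.exp (s.re * t) ≤ ‖S t z‖ := by
  obtain ⟨w, hw, hs⟩ := h
  have hsol := (isModeSol_exp hb hw hs).comp_clm Complex.reCLM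
  obtain ⟨z, hz⟩ := hS.exists_norm_eq _ _ _ _ hsol
  obtain ⟨c, hc, hct⟩ := exists_pos_le_energy_exp hμ₁ s
    (fun t => Complex.reCLM ((w + 1) / b * Complex.exp (s * t)))
    (fun t => Complex.reCLM ((w + 1) / b * (s * Complex.exp (s * t))))
  refine ⟨z, c, hc, fun t => ?_⟩
  refine le_of_sq_le_sq ?_ (norm_nonneg _)
  rw [hz]
  exact hct t

theorem exists_le_norm_of_trajectory {z : E} {c a : ℝ} (hc : 0 < c)
    (h : ∀ t : ℝ≥0, c * Real.exp (a * t) ≤ ‖S t z‖) :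
    ∃ c' : ℝ, 0 < c' ∧ ∀ t : ℝ≥0, c' * Real.exp (a * t) ≤ ‖S t‖ := by
  have hz : 0 < ‖z‖ := by
    by_contra h0
    have h1 : ‖z‖ = 0 := le_antisymm (not_lt.1 h0) (norm_nonneg _)
    have h2 := (S 0).le_opNorm z
    have h3 := h 0
    rw [h1, mul_zero] at h2
    simp only [NNReal.coe_zero, mul_zero, Real.exp_zero, mul_one] at h3
    linarith
  refine ⟨c / ‖z‖, by positivity, fun t => ?_⟩
  rw [div_mul_eq_mul_div, div_le_iff₀ hz]
  exact (h t).trans ((S t).le_opNorm z)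

theorem ModeControlled.exists_le_norm (hS : ModeControlled S ε b μ₁) (hμ₁ : 0 < μ₁)
    (hb : b ≠ 0) {s : ℂ} (h : IsExponent ε b μ₁ s) :
    ∃ c : ℝ, 0 < c ∧ ∀ t : ℝ≥0, c * Real.exp (s.re * t) ≤ ‖S t‖ := by
  obtain ⟨z, c, hc, hz⟩ := hS.exists_trajectory hμ₁ hb h
  exact exists_le_norm_of_trajectory hc hz

theorem ModeControlled.norm_le_exp (hS : ModeControlled S ε b μ₁) (hε : 0 ≤ ε) (t : ℝ≥0) :
    ‖S t‖ ≤ 1 * Real.exp (ε * t) := by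
  rw [one_mul]
  exact hS.upper _ (energyBound_exp hε b μ₁) t (Real.exp_pos _).le

theorem ModeControlled.le_growthBound (hS : ModeControlled S ε b μ₁) (hε : 0 ≤ ε) (hμ₁ : 0 < μ₁)
    (hb : b ≠ 0) {s : ℂ} (h : IsExponent ε b μ₁ s) : s.re ≤ growthBound S := by
  obtain ⟨c, hc, hct⟩ := hS.exists_le_norm hμ₁ hb h
  exact CoupledSystem.le_growthBound hc hct (hS.norm_le_exp hε)

theorem ModeControlled.blowsUp (hS : ModeControlled S ε b μ₁) (hε : 0 ≤ ε) (hμ₁ : 0 < μ₁)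
    (hb : b ≠ 0) {s : ℂ} (h : IsExponent ε b μ₁ s) (hs : 0 < s.re) : BlowsUpExponentially S := by
  refine ⟨hs.trans_le (hS.le_growthBound hε hμ₁ hb h), ?_⟩
  obtain ⟨z, c, hc, hz⟩ := hS.exists_trajectory hμ₁ hb h
  exact ⟨z, c, s.re, hc, hs, hz⟩

theorem ModeControlled.boundedNotDecaying (hS : ModeControlled S ε b μ₁) (hμ₁ : 0 < μ₁)
    (hb : b ≠ 0) {s : ℂ} (h : IsExponent ε b μ₁ s) (hs : 0 ≤ s.re) {C : ℝ} (hC : 0 ≤ C)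
    (hB : EnergyBound ε b μ₁ fun _ => C) : BoundedNotDecaying S := by
  refine ⟨⟨C, fun t => hS.upper _ hB t hC⟩, ?_⟩
  obtain ⟨z, c, hc, hz⟩ := hS.exists_trajectory hμ₁ hb h
  refine ⟨z, fun hlim => ?_⟩
  refine absurd (ge_of_tendsto' hlim fun t => ?_) (not_le.2 hc)
  refine le_trans ?_ (hz t)
  have : 1 ≤ Real.exp (s.re * t) := Real.one_le_exp (mul_nonneg hs t.2)
  nlinarith

theorem ModeControlled.growthBound_le_of_poly (hS : ModeControlled S ε b μ₁) (hμ₁ : 0 < μ₁)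
    (hb : b ≠ 0) {s : ℂ} (h : IsExponent ε b μ₁ s) {C ω : ℝ} {n : ℕ} (hC : 0 ≤ C)
    (hB : EnergyBound ε b μ₁ fun t => C * ((1 + t) ^ n * Real.exp (ω * t))) :
    growthBound S ≤ ω := by
  obtain ⟨c, hc, hct⟩ := hS.exists_le_norm hμ₁ hb h
  exact CoupledSystem.growthBound_le_of_poly hc hct hC fun t => hS.upper _ hB t (by positivity)

/-- A complex solution whose first component has modulus `c f(t)` bounds the semigroup below. -/
theorem ModeControlled.exists_mul_le_norm (hS : ModeControlled S ε b μ₁) (hμ₁ : 0 < μ₁)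
    {u x v y : ℝ → ℂ} (hs : IsModeSol ε b μ₁ u x v y) {c : ℝ} (hc : 0 < c) {f : ℝ → ℝ}
    (hf : ∀ t : ℝ, 0 ≤ t → c * f t ≤ ‖u t‖) (h0 : 0 < f 0) (hfn : ∀ t : ℝ, 0 ≤ t → 0 ≤ f t) :
    ∃ c' : ℝ, 0 < c' ∧ ∀ t : ℝ≥0, c' * f t ≤ ‖S t‖ := by
  have hle : ∀ t : ℝ, 0 ≤ t → (μ₁ * (c * f t)) ^ 2 ≤ modeEnergy μ₁ u x v y t := by
    intro t ht
    have h1 : (c * f t) ^ 2 ≤ ‖u t‖ ^ 2 :=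
      pow_le_pow_left₀ (mul_nonneg hc.le (hfn t ht)) (hf t ht) 2
    have h2 := mul_le_mul_of_nonneg_left h1 (sq_nonneg μ₁)
    unfold modeEnergy
    nlinarith [sq_nonneg ‖x t‖, sq_nonneg ‖y t‖, mul_nonneg (sq_nonneg μ₁) (sq_nonneg ‖v t‖)]
  have hE0 : 0 < modeEnergy μ₁ u x v y 0 :=
    lt_of_lt_of_le (by positivity) (hle 0 le_rfl)
  refine ⟨μ₁ * c / √(modeEnergy μ₁ u x v y 0), by positivity, fun t => ?_⟩
  rw [div_mul_eq_mul_div, div_le_iff₀ (Real.sqrt_pos.2 hE0)]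
  refine le_of_sq_le_sq ?_ (by positivity)
  rw [mul_pow ‖S t‖, Real.sq_sqrt hE0.le, mul_assoc]
  exact (hle t t.2).trans (hS.complex_le _ _ _ _ hs t)

end Trajectories

/-! ### Location of the characteristic exponents -/

section Exponents

variable {ε b μ : ℝ}

theorem exists_add_eq_mul_eq (p q : ℂ) : ∃ s₁ s₂ : ℂ, s₁ + s₂ = p ∧ s₁ * s₂ = q := by
  obtain ⟨z, hz⟩ := IsAlgClosed.exists_pow_nat_eq (p ^ 2 - 4 * q) (n := 2) two_pos
  refine ⟨(p + z) / 2, (p - z) / 2, by ring, ?_⟩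
  linear_combination -hz / 4

theorem exists_isExponent_pair (μ : ℝ) {w : ℂ} (hw : w ^ 2 + (1 - ε) * w + (b ^ 2 - ε) = 0) :
    ∃ s₁ s₂ : ℂ, IsExponent ε b μ s₁ ∧ IsExponent ε b μ s₂ ∧ s₁ + s₂ = w ∧ s₁ * s₂ = μ ^ 2 := by
  obtain ⟨s₁, s₂, hadd, hmul⟩ := exists_add_eq_mul_eq w (μ ^ 2)
  exact ⟨s₁, s₂, ⟨w, hw, by linear_combination s₁ * hadd - hmul⟩,
    ⟨w, hw, by linear_combination s₂ * hadd - hmul⟩, hadd, hmul⟩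

theorem exists_isExponent_half_re_le (μ : ℝ) {w : ℂ}
    (hw : w ^ 2 + (1 - ε) * w + (b ^ 2 - ε) = 0) :
    ∃ s : ℂ, IsExponent ε b μ s ∧ w.re / 2 ≤ s.re := by
  obtain ⟨s₁, s₂, h₁, h₂, hadd, -⟩ := exists_isExponent_pair μ hw
  have h := congrArg Complex.re hadd
  rw [Complex.add_re] at h
  rcases le_total (w.re / 2) s₁.re with h3 | h3
  · exact ⟨s₁, h₁, h3⟩
  · exact ⟨s₂, h₂, by linarith⟩

theorem exists_isExponent_of_real (μ : ℝ) {w : ℝ} (hw : w ^ 2 + (1 - ε) * w + (b ^ 2 - ε) = 0) :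
    ∃ s : ℂ, IsExponent ε b μ s ∧ w / 2 ≤ s.re :=
  exists_isExponent_half_re_le μ (w := (w : ℂ)) (by exact_mod_cast congrArg Complex.ofReal hw)

/-- One of two roots has real part at least half that of their sum. Apply this to the eigenvalues of
`N`, with sum `ε - 1`, then to the exponents, with sum `w`. -/
theorem exists_isExponent_re_ge (ε b μ : ℝ) :
    ∃ s : ℂ, IsExponent ε b μ s ∧ (ε - 1) / 4 ≤ s.re := by
  obtain ⟨w₁, w₂, hadd, hmul⟩ := exists_add_eq_mul_eq (ε - 1 : ℂ) (b ^ 2 - ε)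
  have h := congrArg Complex.re hadd
  rw [Complex.add_re, Complex.sub_re, Complex.ofReal_re, Complex.one_re] at h
  rcases le_total ((ε - 1) / 2) w₁.re with h3 | h3
  · obtain ⟨s, hs, hre⟩ := exists_isExponent_half_re_le (ε := ε) (b := b) μ (w := w₁)
      (by linear_combination w₁ * hadd - hmul)
    exact ⟨s, hs, by linarith⟩
  · obtain ⟨s, hs, hre⟩ := exists_isExponent_half_re_le (ε := ε) (b := b) μ (w := w₂)
      (by linear_combination w₂ * hadd - hmul)
    exact ⟨s, hs, by linarith⟩

/-- The determinant `b² - ε` of `N` is negative, so `N` has a positive eigenvalue. -/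
theorem exists_isExponent_re_pos (μ : ℝ) (h : b ^ 2 < ε) :
    ∃ s : ℂ, IsExponent ε b μ s ∧ 0 < s.re := by
  have h0 : 0 ≤ (1 - ε) ^ 2 + 4 * (ε - b ^ 2) := by nlinarith [sq_nonneg (1 - ε)]
  have hD := Real.sq_sqrt h0
  set D := √((1 - ε) ^ 2 + 4 * (ε - b ^ 2)) with hDdef
  have hlt : 1 - ε < D := Real.lt_sqrt_of_sq_lt (by linarith)
  obtain ⟨s, hs, hre⟩ := exists_isExponent_of_real (ε := ε) (b := b) μ
    (w := (-(1 - ε) + D) / 2) (by nlinarith)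
  exact ⟨s, hs, by linarith⟩

theorem exists_isExponent_oscillating (μ : ℝ) {β : ℝ} (hβ : β ^ 2 = b ^ 2 - (1 + ε) ^ 2 / 4) :
    ∃ s₁ s₂ : ℂ, IsExponent ε b μ s₁ ∧ IsExponent ε b μ s₂ ∧
      s₁.re + s₂.re = -((1 - ε) / 2) ∧ s₁.im + s₂.im = β ∧
      s₁.re * s₂.re - s₁.im * s₂.im = μ ^ 2 ∧ s₁.re * s₂.im + s₁.im * s₂.re = 0 := by
  have hβ' : (β : ℂ) ^ 2 = (b : ℂ) ^ 2 - (1 + ε) ^ 2 / 4 := by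
    have := congrArg Complex.ofReal hβ
    push_cast at this
    exact this
  obtain ⟨s₁, s₂, h₁, h₂, hadd, hmul⟩ := exists_isExponent_pair (ε := ε) (b := b) μ
    (w := ((-((1 - ε) / 2) : ℝ) : ℂ) + β * Complex.I) (by
      push_cast
      linear_combination β ^ 2 * Complex.I_sq - hβ')
  have h3 := congrArg Complex.re hadd
  have h4 := congrArg Complex.im hadd
  have h5 := congrArg Complex.re hmul
  have h6 := congrArg Complex.im hmul
  rw [← Complex.ofReal_pow] at h5 h6
  rw [Complex.mul_re, Complex.ofReal_re] at h5
  rw [Complex.mul_im, Complex.ofReal_im] at h6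
  refine ⟨s₁, s₂, h₁, h₂, ?_, ?_, h5, h6⟩
  · simpa using h3
  · simpa using h4

/-- The eigenvalues of `N` are real and distinct. For `d = 0` the larger gives an exponent with real
part above `-r`; in the overdamped case the smaller, more strongly damped one does, through its slow
root. -/
theorem exists_isExponent_re_gt_of_lt {r d : ℝ} (hε : 0 ≤ ε) (hb : 0 < b) (hlt : b < (1 + ε) / 2)
    (hr : 0 < r) (hrd : 2 * r + d = (1 - ε) / 2) (h : d = 0 ∨ μ ^ 2 = r * (r + d)) :
    ∃ s : ℂ, IsExponent ε b μ s ∧ -r < s.re := by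
  have h0 : 0 < (1 + ε) ^ 2 - 4 * b ^ 2 := by nlinarith
  have hD := Real.sq_sqrt h0.le
  have hDpos := Real.sqrt_pos.2 h0
  set D := √((1 + ε) ^ 2 - 4 * b ^ 2)
  rcases h with rfl | h
  · obtain ⟨s, hs, hre⟩ := exists_isExponent_of_real (ε := ε) (b := b) μ
      (w := (-(1 - ε) + D) / 2) (by nlinarith)
    exact ⟨s, hs, by linarith⟩
  · set w := (-(1 - ε) - D) / 2 with hw
    have hw0 : w ^ 2 + (1 - ε) * w + (b ^ 2 - ε) = 0 := by
      rw [hw]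
      nlinarith
    -- This makes the discriminant exceed `(w + 2 r)²`, so that `(w + Q) / 2 > -r`.
    have hdisc : w ^ 2 - 4 * μ ^ 2 = (w + 2 * r) ^ 2 + 2 * r * D := by
      rw [h]
      linear_combination (-4 * r) * hw - 4 * r * hrd
    have hrD : 0 < r * D := mul_pos hr hDpos
    have hQ := Real.sq_sqrt (show 0 ≤ w ^ 2 - 4 * μ ^ 2 by rw [hdisc]; positivity)
    have hQlt : -(w + 2 * r) < √(w ^ 2 - 4 * μ ^ 2) :=
      Real.lt_sqrt_of_sq_lt (by rw [hdisc]; nlinarith)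
    set Q := √(w ^ 2 - 4 * μ ^ 2)
    refine ⟨((w + Q) / 2 : ℝ), ⟨(w : ℂ), by exact_mod_cast congrArg Complex.ofReal hw0, ?_⟩, ?_⟩
    · have : ((w + Q) / 2) ^ 2 - w * ((w + Q) / 2) + μ ^ 2 = 0 := by linear_combination hQ / 4
      exact_mod_cast congrArg Complex.ofReal this
    · rw [Complex.ofReal_re]
      linarith

theorem exists_isExponent_re_gt_of_gt {r d : ℝ} (hε : 0 ≤ ε) (hgt : (1 + ε) / 2 < b)
    (hr : 0 < r) (hd : 0 ≤ d) (hrd : 2 * r + d = (1 - ε) / 2)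
    (h : d = 0 ∨ μ ^ 2 = r * (r + d)) :
    ∃ s : ℂ, IsExponent ε b μ s ∧ -r < s.re := by
  have h0 : 0 < b ^ 2 - (1 + ε) ^ 2 / 4 := by nlinarith
  have hβ := Real.sq_sqrt h0.le
  have hβpos := Real.sqrt_pos.2 h0
  set β := √(b ^ 2 - (1 + ε) ^ 2 / 4)
  obtain ⟨s₁, s₂, h₁, h₂, hre, him, hmr, hmi⟩ := exists_isExponent_oscillating μ hβ
  by_contra! hle
  have ha₁ := hle s₁ h₁
  have ha₂ := hle s₂ h₂
  rcases h with rfl | h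
  · have e₁ : s₁.re = -r := by linarith
    have e₂ : s₂.re = -r := by linarith
    rw [e₁, e₂] at hmi
    have : r * β = 0 := by rw [← him]; linarith
    exact absurd this (by positivity)
  -- Real parts at most `-r` have product at least `r (r + d) = μ²`, so the imaginary parts have
  -- nonnegative product. As `s₁ s₂` is real and both real parts are negative, the imaginary parts
  -- vanish, against their sum `β > 0`.
  · have h3 : 0 ≤ (-s₁.re - r) * (-s₂.re - r) := mul_nonneg (by linarith) (by linarith)
    have h4 : 0 ≤ s₁.im * s₂.im := by nlinarith
    have h5 : s₁.re * (s₁.im * s₂.im) = -(s₁.im ^ 2 * s₂.re) := by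
      linear_combination s₁.im * hmi
    have h6 : s₂.re * (s₁.im * s₂.im) = -(s₂.im ^ 2 * s₁.re) := by
      linear_combination s₂.im * hmi
    have h7 : s₁.im ^ 2 * (-s₂.re) ≤ 0 := by nlinarith
    have h8 : s₂.im ^ 2 * (-s₁.re) ≤ 0 := by nlinarith
    have h9 : s₁.im = 0 := by
      by_contra hne
      have : 0 < s₁.im ^ 2 * (-s₂.re) := mul_pos (by positivity) (by linarith)
      linarith
    have h10 : s₂.im = 0 := by
      by_contra hne
      have : 0 < s₂.im ^ 2 * (-s₁.re) := mul_pos (by positivity) (by linarith)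
      linarith
    rw [h9, h10] at him
    linarith

/-- Away from `b = (1 + ε) / 2` some exponent lies to the right of the optimal abscissa. -/
theorem exists_isExponent_re_gt {r d : ℝ} (hε : 0 ≤ ε) (hb : 0 < b) (hne : b ≠ (1 + ε) / 2)
    (hr : 0 < r) (hd : 0 ≤ d) (hrd : 2 * r + d = (1 - ε) / 2)
    (h : d = 0 ∨ μ ^ 2 = r * (r + d)) :
    ∃ s : ℂ, IsExponent ε b μ s ∧ -r < s.re :=
  hne.lt_or_gt.elim (fun hlt => exists_isExponent_re_gt_of_lt hε hb hlt hr hrd h)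
    fun hgt => exists_isExponent_re_gt_of_gt hε hgt hr hd hrd h

/-- If `a₁`, `a₂` are the real parts, eliminating the imaginary parts gives `μ² (a₁ - a₂)² = a₁ a₂
((a₁ - a₂)² + β²)`. If both were below `-η`, the right side would be at least `η² β²`, whereas `(a₁
- a₂)² ≤ (a₁ + a₂)² = ((1 - ε) / 2)²`. -/
theorem exists_isExponent_re_ge_neg {η : ℝ} (hη : 0 < η) (hε : ε < 1) (hμ : 0 < μ)
    (h : μ ^ 2 * ((1 - ε) / 2) ^ 2 < η ^ 2 * (b ^ 2 - (1 + ε) ^ 2 / 4)) :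
    ∃ s : ℂ, IsExponent ε b μ s ∧ -η ≤ s.re := by
  have h0 : 0 < b ^ 2 - (1 + ε) ^ 2 / 4 := by
    have : 0 < η ^ 2 * (b ^ 2 - (1 + ε) ^ 2 / 4) := lt_of_le_of_lt (by positivity) h
    exact pos_of_mul_pos_right this (by positivity)
  have hβ := Real.sq_sqrt h0.le
  set β := √(b ^ 2 - (1 + ε) ^ 2 / 4)
  obtain ⟨s₁, s₂, h₁, h₂, hre, him, hmr, hmi⟩ := exists_isExponent_oscillating μ hβ
  rw [← hβ] at h
  by_contra! hlt
  have ha₁ := hlt s₁ h₁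
  have ha₂ := hlt s₂ h₂
  have e₁ : s₁.im * (s₁.re - s₂.re) = β * s₁.re := by linear_combination s₁.re * him - hmi
  have e₂ : s₂.im * (s₂.re - s₁.re) = β * s₂.re := by linear_combination s₂.re * him - hmi
  have e₃ : μ ^ 2 * (s₁.re - s₂.re) ^ 2 =
      s₁.re * s₂.re * (s₁.re - s₂.re) ^ 2 + s₁.re * s₂.re * β ^ 2 := by
    linear_combination (-(s₁.re - s₂.re) ^ 2) * hmr + s₂.im * (s₂.re - s₁.re) * e₁ +
      β * s₁.re * e₂
  have h3 : η ^ 2 ≤ s₁.re * s₂.re := by nlinarith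
  have h4 : (s₁.re - s₂.re) ^ 2 ≤ ((1 - ε) / 2) ^ 2 := by
    have : ((1 - ε) / 2) ^ 2 = (s₁.re + s₂.re) ^ 2 := by rw [hre]; ring
    rw [this]
    nlinarith [sq_nonneg η]
  have h5 := mul_le_mul_of_nonneg_left h4 (sq_nonneg μ)
  have h6 := mul_le_mul_of_nonneg_right h3 (sq_nonneg β)
  have h7 : 0 ≤ s₁.re * s₂.re * (s₁.re - s₂.re) ^ 2 :=
    mul_nonneg (le_trans (sq_nonneg η) h3) (sq_nonneg _)
  linarith

end Exponents

/-! ### Resonant solutions at the critical coupling -/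

section Resonance

variable {ε b μ r : ℝ}

theorem hasDerivAt_mul_cexp {f : ℝ → ℂ} {f' : ℂ} {t : ℝ} (s : ℂ) (hf : HasDerivAt f f' t) :
    HasDerivAt (fun t : ℝ => f t * Complex.exp (s * t))
      ((f' + s * f t) * Complex.exp (s * t)) t :=
  (hf.mul (hasDerivAt_cexp_mul s t)).congr_deriv (by ring)

/-- Solutions of the form `polynomial × exponential` for `b = (1 + ε) / 2`. -/
theorem isModeSol_mul_cexp (hb : b = (1 + ε) / 2) (hr : r = (1 - ε) / 4) {s : ℂ}
    (hs : s ^ 2 + 2 * r * s + μ ^ 2 = 0) {f f' f'' g g' g'' : ℝ → ℂ}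
    (hf : ∀ t, HasDerivAt f (f' t) t) (hf' : ∀ t, HasDerivAt f' (f'' t) t)
    (hg : ∀ t, HasDerivAt g (g' t) t) (hg' : ∀ t, HasDerivAt g' (g'' t) t)
    (hgeq : ∀ t, g'' t + 2 * (s + r) * g' t = 0)
    (hfeq : ∀ t, f'' t + 2 * (s + r) * f' t = b * (g' t + s * g t)) :
    IsModeSol ε b μ (fun t => f t * Complex.exp (s * t))
      (fun t => (f' t + s * f t) * Complex.exp (s * t))
      (fun t => (f t + g t) * Complex.exp (s * t))
      (fun t => (f' t + g' t + s * (f t + g t)) * Complex.exp (s * t)) := by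
  have hb' : (b : ℂ) = (1 + ε) / 2 := by rw [hb]; push_cast; rfl
  have hr' : (r : ℂ) = (1 - ε) / 4 := by rw [hr]; push_cast; rfl
  refine ⟨fun t => hasDerivAt_mul_cexp s (hf t), fun t => ?_,
    fun t => hasDerivAt_mul_cexp s ((hf t).add (hg t)), fun t => ?_⟩
  · refine (hasDerivAt_mul_cexp s ((hf' t).add ((hf t).const_mul s))).congr_deriv ?_
    simp only [Complex.real_smul, Complex.ofReal_pow, Pi.add_apply]
    have := hfeq t
    rw [hr'] at this hs
    rw [hb'] at this ⊢
    linear_combination Complex.exp (s * t) * (this + f t * hs)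
  · refine (hasDerivAt_mul_cexp s (((hf' t).add (hg' t)).add
      (((hf t).add (hg t)).const_mul s))).congr_deriv ?_
    simp only [Complex.real_smul, Complex.ofReal_pow, Pi.add_apply]
    have h1 := hfeq t
    have h2 := hgeq t
    rw [hr'] at h1 h2 hs
    rw [hb'] at h1 ⊢
    linear_combination Complex.exp (s * t) * (h1 + h2 + (f t + g t) * hs)

theorem hasDerivAt_one_add_pow (n : ℕ) (t : ℝ) :
    HasDerivAt (fun t : ℝ => (1 + (t : ℂ)) ^ n) (n * (1 + (t : ℂ)) ^ (n - 1)) t := by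
  have h : HasDerivAt (fun t : ℝ => 1 + (t : ℂ)) 1 t :=
    (Complex.ofRealCLM.hasDerivAt (x := t)).const_add 1
  exact (h.fun_pow n).congr_deriv (by rw [mul_one])

theorem norm_mul_one_add_pow_mul_cexp (k s : ℂ) (n : ℕ) {t : ℝ} (ht : 0 ≤ t) :
    ‖k * (1 + (t : ℂ)) ^ n * Complex.exp (s * t)‖ =
      ‖k‖ * ((1 + t) ^ n * Real.exp (s.re * t)) := by
  have h : ‖1 + (t : ℂ)‖ = 1 + t := by
    rw [← Complex.ofReal_one, ← Complex.ofReal_add, Complex.norm_real, Real.norm_eq_abs,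
      abs_of_nonneg (by linarith)]
  rw [norm_mul, norm_mul, norm_pow, h, Complex.norm_exp, mul_assoc]
  simp

variable {𝕜 E : Type*} [RCLike 𝕜] [SeminormedAddCommGroup E] [NormedSpace 𝕜 E]
  {S : ℝ≥0 → E →L[𝕜] E}

theorem ModeControlled.exists_mul_le_norm_of_poly (hS : ModeControlled S ε b μ) (hμ : 0 < μ)
    {k s : ℂ} (hk : k ≠ 0) {n : ℕ} {x v y : ℝ → ℂ}
    (hs : IsModeSol ε b μ (fun t : ℝ => k * (1 + (t : ℂ)) ^ n * Complex.exp (s * t)) x v y) :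
    ∃ c : ℝ, 0 < c ∧ ∀ t : ℝ≥0, c * ((1 + (t : ℝ)) ^ n * Real.exp (s.re * t)) ≤ ‖S t‖ :=
  hS.exists_mul_le_norm hμ hs (norm_pos_iff.2 hk)
    (f := fun t => (1 + t) ^ n * Real.exp (s.re * t))
    (fun t ht => (norm_mul_one_add_pow_mul_cexp k s n ht).ge) (by positivity)
    fun t ht => by positivity

/-- Take `s = -r + i κ` and `v - u = exp (s t)`. It forces `u` at its own frequency, so `u = k (1 +
t) exp (s t)` with `2 (s + r) k = b s`. -/
theorem ModeControlled.exists_linear_le_norm (hS : ModeControlled S ε b μ) (hμ : 0 < μ)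
    (hb0 : 0 < b) (hb : b = (1 + ε) / 2) (hr : r = (1 - ε) / 4) (hlt : r ^ 2 < μ ^ 2) :
    ∃ c : ℝ, 0 < c ∧ ∀ t : ℝ≥0, c * ((1 + (t : ℝ)) ^ 1 * Real.exp (-r * t)) ≤ ‖S t‖ := by
  have hκ := Real.sq_sqrt (sub_pos.2 hlt).le
  have hκpos := Real.sqrt_pos.2 (sub_pos.2 hlt)
  set κ := √(μ ^ 2 - r ^ 2)
  have hκ' : (κ : ℂ) ^ 2 = μ ^ 2 - r ^ 2 := by
    have := congrArg Complex.ofReal hκ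
    push_cast at this
    exact this
  obtain ⟨s, hsdef⟩ : ∃ s : ℂ, s = ((-r : ℝ) : ℂ) + κ * Complex.I := ⟨_, rfl⟩
  have hre : s.re = -r := by simp [hsdef]
  have hs : s ^ 2 + 2 * r * s + μ ^ 2 = 0 := by
    rw [hsdef]
    push_cast
    linear_combination κ ^ 2 * Complex.I_sq - hκ'
  have hsr : s + r ≠ 0 := by
    have : s + r = κ * Complex.I := by rw [hsdef]; push_cast; ring
    rw [this]
    exact mul_ne_zero (Complex.ofReal_ne_zero.2 hκpos.ne') Complex.I_ne_zero
  have hs0 : s ≠ 0 := by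
    rintro rfl
    have : (μ : ℂ) ^ 2 = 0 := by linear_combination hs
    exact hμ.ne' (Complex.ofReal_eq_zero.1 (pow_eq_zero_iff two_ne_zero |>.1 this))
  have hb' : (b : ℂ) ≠ 0 := Complex.ofReal_ne_zero.2 hb0.ne'
  rw [← hre]
  refine hS.exists_mul_le_norm_of_poly hμ (k := b * s / (2 * (s + r)))
    (div_ne_zero (mul_ne_zero hb' hs0) (mul_ne_zero two_ne_zero hsr))
    (isModeSol_mul_cexp hb hr hs (fun t => (hasDerivAt_one_add_pow 1 t).const_mul _)
      (f'' := fun _ => 0) (fun t => ?_) (g := fun _ => 1) (fun t => hasDerivAt_const t _)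
      (g'' := fun _ => 0) (fun t => hasDerivAt_const t _) (fun t => by simp) fun t => ?_)
  · simpa using hasDerivAt_const t (b * s / (2 * (s + r)))
  · simp
    field_simp

/-- Here `s = -r` is a double root and the profile `f` of `u` satisfies `f'' = b (g' - r g)`. The
constant `1 / r` in `g = 1 + t + 1 / r` reduces the right side to `-b r (1 + t)`, whence the pure
cube with factor `-b r / 6`. -/
theorem ModeControlled.exists_cubic_le_norm (hS : ModeControlled S ε b μ) (hμ : 0 < μ)
    (hb0 : 0 < b) (hb : b = (1 + ε) / 2) (hr : r = (1 - ε) / 4) (hr0 : 0 < r)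
    (heq : r ^ 2 = μ ^ 2) :
    ∃ c : ℝ, 0 < c ∧ ∀ t : ℝ≥0, c * ((1 + (t : ℝ)) ^ 3 * Real.exp (-r * t)) ≤ ‖S t‖ := by
  have hs : (-r : ℂ) ^ 2 + 2 * r * (-r) + μ ^ 2 = 0 := by
    have := congrArg Complex.ofReal heq
    push_cast at this
    linear_combination -this
  have hb' : (b : ℂ) ≠ 0 := Complex.ofReal_ne_zero.2 hb0.ne'
  have hr' : (r : ℂ) ≠ 0 := Complex.ofReal_ne_zero.2 hr0.ne'
  have hre : (-r : ℂ).re = -r := by simp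
  rw [← hre]
  refine hS.exists_mul_le_norm_of_poly hμ (k := -(b * r / 6))
    (neg_ne_zero.2 (div_ne_zero (mul_ne_zero hb' hr') (by norm_num)))
    (isModeSol_mul_cexp hb hr hs (fun t => (hasDerivAt_one_add_pow 3 t).const_mul _)
      (fun t => ((hasDerivAt_one_add_pow 2 t).const_mul 3).const_mul _)
      (g := fun t : ℝ => (1 + (t : ℂ)) ^ 1 + 1 / r) (g' := fun _ => 1)
      (fun t => ?_)
      (g'' := fun _ => 0) (fun t => hasDerivAt_const t _) (fun t => by simp) fun t => ?_)
  · simpa using (hasDerivAt_one_add_pow 1 t).add_const (1 / r : ℂ)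
  · push_cast
    field_simp
    ring

end Resonance

/-! ### Regimes and optimal rate -/

section Rates

variable {𝕜 E : Type*} [RCLike 𝕜] [SeminormedAddCommGroup E] [NormedSpace 𝕜 E]
  {S : ℝ≥0 → E →L[𝕜] E} {ε b μ : ℝ}

theorem ModeControlled.blowsUp_of_sq_lt (hS : ModeControlled S ε b μ) (hε : 0 ≤ ε) (hμ : 0 < μ)
    (hb : 0 < b) (h : b ^ 2 < ε) : BlowsUpExponentially S := by
  obtain ⟨s, hs, hre⟩ := exists_isExponent_re_pos μ h
  exact hS.blowsUp hε hμ hb.ne' hs hre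

theorem ModeControlled.blowsUp_of_one_lt (hS : ModeControlled S ε b μ) (hμ : 0 < μ) (hb : 0 < b)
    (h : 1 < ε) : BlowsUpExponentially S := by
  obtain ⟨s, hs, hre⟩ := exists_isExponent_re_ge ε b μ
  exact hS.blowsUp (by linarith) hμ hb.ne' hs (by linarith)

/-- For `ε = 1` the form proportional to `(b, -1; -1, b)` is conserved, and it is positive definite
exactly because `b > 1`. -/
theorem ModeControlled.boundedNotDecaying_of_one_lt (hS : ModeControlled S 1 b μ) (hμ : 0 < μ)
    (hb : 1 < b) : BoundedNotDecaying S := by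
  obtain ⟨s, hs, hre⟩ := exists_isExponent_re_ge 1 b μ
  obtain ⟨C, hC, hB⟩ := exists_energyBound_const (ε := 1) (b := b) (α := 2 * b ^ 2)
    (β := -2 * b) (γ := 2 * b ^ 2) (by positivity) (by
      have : 0 < b ^ 2 * (b ^ 2 - 1) := mul_pos (by positivity) (by nlinarith)
      nlinarith) (fun x y => le_of_eq (by ring)) μ
  exact hS.boundedNotDecaying hμ (by linarith) hs (by linarith) hC hB

/-- `N` is singular: `w = 0` gives an exponent with nonnegative real part, while the form dissipates
a multiple of `(x - b y)²`. -/
theorem ModeControlled.boundedNotDecaying_of_sq_eq (hS : ModeControlled S ε b μ) (hμ : 0 < μ)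
    (hb : 0 < b) (h : b ^ 2 = ε) (hε1 : ε < 1) : BoundedNotDecaying S := by
  obtain ⟨s, hs, hre⟩ := exists_isExponent_of_real (ε := ε) (b := b) μ (w := 0) (by linarith)
  obtain ⟨C, hC, hB⟩ := exists_energyBound_const (ε := ε) (b := b) (α := 1 + ε)
    (β := -2 * b) (γ := 1 + ε) (by nlinarith) (by nlinarith) (fun x y => by
      have h1 : 0 ≤ (1 - ε) * (x - b * y) ^ 2 := mul_nonneg (by linarith) (sq_nonneg _)
      have h2 : ((1 + ε) * x + -2 * b * y) * (-x + b * y) +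
          (-2 * b * x + (1 + ε) * y) * (-b * x + ε * y) = -((1 - ε) * (x - b * y) ^ 2) := by
        subst h
        ring
      linarith) μ
  exact hS.boundedNotDecaying hμ hb.ne' hs (by linarith) hC hB

/-- Here `N` has negative trace and positive determinant. The form solves the Lyapunov equation `P N
+ Nᵀ P = -2 d` with `d = (1 - ε) (b² - ε)`. -/
theorem exists_energyBound_of_lt_sq (hε : 0 ≤ ε) (hε1 : ε < 1) (h : ε < b ^ 2) (hμ : 0 < μ) :
    ∃ C a, 0 ≤ C ∧ 0 < a ∧ EnergyBound ε b μ fun t => C * Real.exp (-(a * t)) := by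
  refine exists_energyBound_decay (ε := ε) (b := b) (α := 2 * b ^ 2 - ε + ε ^ 2)
    (β := -((1 + ε) * b)) (γ := 2 * b ^ 2 - ε + 1) (d := (1 - ε) * (b ^ 2 - ε)) (by nlinarith) ?_
    (mul_pos (by linarith) (by linarith)) (fun x y => le_of_eq (by ring)) hμ
  -- This product is the determinant of the form.
  have : 0 < (b ^ 2 - ε) * (4 * b ^ 2 + (1 - ε) ^ 2) := mul_pos (by linarith) (by nlinarith)
  nlinarith

theorem ModeControlled.decaysExponentially (hS : ModeControlled S ε b μ) (hε : 0 ≤ ε)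
    (hε1 : ε < 1) (h : ε < b ^ 2) (hμ : 0 < μ) : DecaysExponentially S := by
  obtain ⟨C, a, hC, ha, hB⟩ := exists_energyBound_of_lt_sq hε hε1 h hμ
  exact ⟨C, a, ha, fun t => hS.upper _ hB t (by positivity)⟩

theorem ModeControlled.growthBound_nonpos (hS : ModeControlled S ε b μ) (hε : 0 ≤ ε)
    (hε1 : ε < 1) (h : ε < b ^ 2) (hb : b ≠ 0) (hμ : 0 < μ) : growthBound S ≤ 0 := by
  obtain ⟨C, a, hC, ha, hB⟩ := exists_energyBound_of_lt_sq hε hε1 h hμ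
  obtain ⟨s, hs, -⟩ := exists_isExponent_re_ge ε b μ
  refine le_trans (hS.growthBound_le_of_poly hμ hb hs (n := 0) (ω := -a) hC ?_) (by linarith)
  simpa only [pow_zero, one_mul, neg_mul] using hB

/-- The optimal rate `r`, with `-r` and `-(r + d)` the abscissas of the lowest mode. -/
theorem exists_optimal_rate (hε1 : ε < 1) (hμ : 0 < μ) :
    ∃ r d : ℝ, 0 < r ∧ 0 ≤ d ∧ 2 * r + d = (1 - ε) / 2 ∧ r * (r + d) ≤ μ ^ 2 ∧
      (d = 0 ∨ μ ^ 2 = r * (r + d)) := by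
  rcases le_total ((1 - ε) ^ 2 / 16) (μ ^ 2) with h | h
  · exact ⟨(1 - ε) / 4, 0, by linarith, le_rfl, by ring, by linarith, Or.inl rfl⟩
  -- In the overdamped case `-r` and `-(r + d)` are the two real roots of `s² + ((1 - ε) / 2) s +
  -- μ²`.
  · have hQ := Real.sq_sqrt (sub_nonneg.2 h)
    have hQ0 := Real.sqrt_nonneg ((1 - ε) ^ 2 / 16 - μ ^ 2)
    have hQlt : √((1 - ε) ^ 2 / 16 - μ ^ 2) < (1 - ε) / 4 := by
      rw [Real.sqrt_lt' (by linarith)]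
      nlinarith
    set Q := √((1 - ε) ^ 2 / 16 - μ ^ 2)
    have he : μ ^ 2 = ((1 - ε) / 4 - Q) * ((1 - ε) / 4 - Q + 2 * Q) := by linear_combination hQ
    exact ⟨(1 - ε) / 4 - Q, 2 * Q, by linarith, by linarith, by ring, he.ge, Or.inr he⟩

theorem ModeControlled.growthBound_le_of_optimal (hS : ModeControlled S ε b μ) (hε : 0 ≤ ε)
    (hb : b = (1 + ε) / 2) {r d : ℝ} (hr : 0 < r) (hd : 0 ≤ d) (hrd : 2 * r + d = (1 - ε) / 2)
    (h : r * (r + d) ≤ μ ^ 2) (hμ : 0 < μ) : growthBound S ≤ -r := by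
  obtain ⟨C, hC, hB⟩ := exists_energyBound_cubic hb hrd hd hμ (by positivity) h
  -- Any exponent serves: it only ensures that the set defining `growthBound` is bounded below.
  obtain ⟨s, hs, -⟩ := exists_isExponent_re_ge ε b μ
  exact hS.growthBound_le_of_poly hμ (by linarith) hs hC hB

theorem ModeControlled.growthBound_eq (hS : ModeControlled S ε b μ) (hε : 0 ≤ ε) (hε1 : ε < 1)
    (hb : b = (1 + ε) / 2) (hμ : 0 < μ) (h : (1 - ε) ^ 2 / 16 ≤ μ ^ 2) :
    growthBound S = -((1 - ε) / 4) := by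
  refine le_antisymm (hS.growthBound_le_of_optimal hε hb (d := 0) (by linarith) le_rfl (by ring)
    (by linarith) hμ) ?_
  obtain ⟨s, hs, hre⟩ := exists_isExponent_re_ge ε b μ
  have := hS.le_growthBound hε hμ (by linarith) hs
  linarith

theorem ModeControlled.growthBound_lt {S' : ℝ≥0 → E →L[𝕜] E}
    (hS : ModeControlled S ε ((1 + ε) / 2) μ) (hS' : ModeControlled S' ε b μ) (hε : 0 ≤ ε)
    (hε1 : ε < 1) (hb : 0 < b) (hne : b ≠ (1 + ε) / 2) (hμ : 0 < μ) :
    growthBound S < growthBound S' := by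
  obtain ⟨r, d, hr, hd, hrd, hle, hor⟩ := exists_optimal_rate hε1 hμ
  obtain ⟨s, hs, hre⟩ := exists_isExponent_re_gt hε hb hne hr hd hrd hor
  exact (hS.growthBound_le_of_optimal hε rfl hr hd hrd hle hμ).trans_lt
    (hre.trans_le (hS'.le_growthBound hε hμ hb.ne' hs))

/-- For `ε = 1` the rate is zero and `b = 1`, which is the growth `1 + t` at the threshold. -/
theorem ModeControlled.hasExactRate_one (hS : ModeControlled S ε b μ) (hε : 0 ≤ ε)
    (hb : b = (1 + ε) / 2) (hμ : 0 < μ) (h : ((1 - ε) / 4) ^ 2 < μ ^ 2) :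
    HasExactRate S 1 (-((1 - ε) / 4)) := by
  obtain ⟨C, hC, hB⟩ := exists_energyBound_linear hb rfl hμ h
  obtain ⟨c, hc, hct⟩ := hS.exists_linear_le_norm hμ (by linarith) hb rfl h
  exact ⟨c, C, hc, fun t => ⟨hct t, hS.upper _ hB t (by positivity)⟩⟩

theorem ModeControlled.hasExactRate_three (hS : ModeControlled S ε b μ) (hε : 0 ≤ ε)
    (hε1 : ε < 1) (hb : b = (1 + ε) / 2) (hμ : 0 < μ) (h : ((1 - ε) / 4) ^ 2 = μ ^ 2) :
    HasExactRate S 3 (-((1 - ε) / 4)) := by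
  obtain ⟨C, hC, hB⟩ := exists_energyBound_cubic (r := (1 - ε) / 4) (d := 0) hb (by ring) le_rfl hμ
    (by nlinarith) (by linarith)
  obtain ⟨c, hc, hct⟩ := hS.exists_cubic_le_norm hμ (by linarith) hb rfl (by linarith) h
  exact ⟨c, C, hc, fun t => ⟨hct t, hS.upper _ hB t (by positivity)⟩⟩

theorem tendsto_growthBound {S : ℝ → ℝ≥0 → E →L[𝕜] E} (hS : ∀ b, ModeControlled (S b) ε b μ)
    (hε : 0 ≤ ε) (hε1 : ε < 1) (hμ : 0 < μ) :
    Tendsto (fun b : ℝ => growthBound (S b)) atTop (𝓝 0) := by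
  have hsq : Tendsto (fun b : ℝ => b ^ 2) atTop atTop := tendsto_pow_atTop two_ne_zero
  have hup : ∀ᶠ b : ℝ in atTop, growthBound (S b) ≤ 0 := by
    filter_upwards [eventually_gt_atTop (0 : ℝ), hsq.eventually_gt_atTop ε] with b hb hlt
    exact (hS b).growthBound_nonpos hε hε1 hlt hb.ne' hμ
  refine tendsto_order.2 ⟨fun a ha => ?_, fun a ha => hup.mono fun b hb => hb.trans_lt ha⟩
  -- Half of `-a` leaves room for the strict inequality `a < -η`.
  set η := -a / 2 with hη
  have hηpos : 0 < η := by linarith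
  filter_upwards [eventually_gt_atTop (0 : ℝ), hsq.eventually_gt_atTop
    (μ ^ 2 * ((1 - ε) / 2) ^ 2 / η ^ 2 + (1 + ε) ^ 2 / 4)] with b hb hlt
  obtain ⟨s, hs, hre⟩ := exists_isExponent_re_ge_neg (b := b) hηpos hε1 hμ (by
    rw [← div_lt_iff₀' (by positivity)]
    linarith)
  have := (hS b).le_growthBound hε hμ hb.ne' hs
  linarith

end Rates

end CoupledSystem

end

/-! ### Assembly -/

theorem mainTheorem5 {𝕜 H : Type*} [RCLike 𝕜] [NormedAddCommGroup H] [InnerProductSpace 𝕜 H]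
    [CompleteSpace H] [Nontrivial H] (A : H →ₗ.[𝕜] H) (hA : IsSelfAdjoint A)
    (hpos : IsStrictlyPos A) (hcpt : HasCompactDomain A) (ε : ℝ) (hε : 0 ≤ ε) :
    -- `A ^ (1/2)` and the first eigenvalue exist
    IsPosSqrt A (opSqrt A) ∧
    IsLeast (eigenvalues A) (firstEigenvalue A) ∧ 0 < firstEigenvalue A ∧
    -- the system generates a strongly continuous semigroup on the energy space
    (∀ b : ℝ, 0 < b →
      IsSemigroupGeneratedBy (CoupledSystem.S A ε b) (systemOp A ε b)) ∧
    -- the case `ε > 1`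
    (1 < ε → ∀ b : ℝ, 0 < b → BlowsUpExponentially (CoupledSystem.S A ε b)) ∧
    -- the case `ε = 1`
    (ε = 1 →
      (∀ b : ℝ, 0 < b → b < 1 → BlowsUpExponentially (CoupledSystem.S A ε b)) ∧
      HasExactRate (CoupledSystem.S A ε 1) 1 0 ∧
      (∀ b : ℝ, 1 < b → BoundedNotDecaying (CoupledSystem.S A ε b))) ∧
    -- the case `ε < 1`
    (ε < 1 →
      (∀ b : ℝ, 0 < b → b < √ε → BlowsUpExponentially (CoupledSystem.S A ε b)) ∧
      (∀ b : ℝ, 0 < b → b = √ε → BoundedNotDecaying (CoupledSystem.S A ε b)) ∧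
      (∀ b : ℝ, √ε < b → DecaysExponentially (CoupledSystem.S A ε b)) ∧
      -- `b = (1 + ε) / 2` is the only value with the best exponential decay rate
      (∀ b : ℝ, 0 < b → b ≠ (1 + ε) / 2 →
        growthBound (CoupledSystem.S A ε ((1 + ε) / 2)) < growthBound (CoupledSystem.S A ε b)) ∧
      -- the decay rate degenerates for large `b`
      Tendsto (fun b : ℝ => growthBound (CoupledSystem.S A ε b)) atTop (𝓝 0) ∧
      -- the best decay rate when the first eigenvalue is not small
      ((1 - ε) ^ 2 / 16 ≤ firstEigenvalue A →
        growthBound (CoupledSystem.S A ε ((1 + ε) / 2)) = -((1 - ε) / 4)) ∧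
      ((1 - ε) ^ 2 / 16 < firstEigenvalue A →
        HasExactRate (CoupledSystem.S A ε ((1 + ε) / 2)) 1 (-((1 - ε) / 4))) ∧
      ((1 - ε) ^ 2 / 16 = firstEigenvalue A →
        HasExactRate (CoupledSystem.S A ε ((1 + ε) / 2)) 3 (-((1 - ε) / 4)))) := by
  obtain ⟨hsqrt, μ, hμ, hleast, hS⟩ := exists_modeControlled hA hpos hcpt
  have hfirst : firstEigenvalue A = μ ^ 2 := hleast.csInf_eq
  have hgen := fun b => (hS ε b hε).1
  have hctl := fun b => (hS ε b hε).2
  rw [hfirst]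
  refine ⟨hsqrt, hleast, by positivity, fun b _ => hgen b,
    fun h b hb => (hctl b).blowsUp_of_one_lt hμ hb h, ?_, fun hε1 => ⟨?_, ?_, ?_, ?_, ?_, ?_, ?_, ?_⟩⟩
  · rintro rfl
    refine ⟨fun b hb hb1 => (hctl b).blowsUp_of_sq_lt hε hμ hb (by nlinarith), ?_,
      fun b hb => (hctl b).boundedNotDecaying_of_one_lt hμ hb⟩
    have h := (hctl 1).hasExactRate_one hε (by norm_num) hμ (by
      rw [sub_self, zero_div, zero_pow two_ne_zero]
      positivity)
    rwa [sub_self, zero_div, neg_zero] at h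
  · exact fun b hb hlt => (hctl b).blowsUp_of_sq_lt hε hμ hb ((Real.lt_sqrt hb.le).1 hlt)
  · rintro b hb rfl
    exact (hctl _).boundedNotDecaying_of_sq_eq hμ hb (Real.sq_sqrt hε) hε1
  · exact fun b hlt => (hctl b).decaysExponentially hε hε1
      ((Real.sqrt_lt' ((Real.sqrt_nonneg ε).trans_lt hlt)).1 hlt) hμ
  · exact fun b hb hne => (hctl _).growthBound_lt (hctl b) hε hε1 hb hne hμ
  · exact tendsto_growthBound hctl hε hε1 hμ
  · exact fun h => (hctl _).growthBound_eq hε hε1 rfl hμ h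
  · exact fun h => (hctl _).hasExactRate_one hε rfl hμ (by nlinarith)
  · exact fun h => (hctl _).hasExactRate_three hε hε1 rfl hμ (by nlinarith)
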